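/- Let $\lambda>0$ and $0\le\nu$, $\theta\le\lambda+1$. For a density $\rho$ on $[0,\lambda+1]$ put, with $L_0(x)=x\log x-x$ ($L_0(0)=0$), $$S_\lambda[\rho]=\int_0^{\lambda+1}\bigl(L_0(x)+L_0(\lambda+1-x)\bigr)\rho(x)\,dx-\frac12\int_0^{\lambda+1}\!\!\int_0^{\lambda+1}\log|x-y|\,\rho(x)\rho(y)\,dx\,dy ,$$ the rate functional for the endpoints of the lattice paths on the free boundary of the uniformly weighted cut hexagon. A density $\rho$ is called admissible for the forbidden intervals $[0,\nu]$ and $[\theta,\lambda+1]$ at the two ends of the free boundary if it is measurable, $0\le\rho\le1$, $\rho=0$ outside $[\nu,\theta]$, and $\int_\nu^\theta\rho=1$. A minimizer is an admissible $\rho$ at which $S_\lambda$ is minimal among admissible densities. Set $$a=\frac{U-\sqrt V}{4\lambda^2},\qquad b=\frac{U+\sqrt V}{4\lambda^2},$$ $$U=(\nu+\theta)\bigl(1-(\nu-\theta)^2\bigr)-(\lambda+1)\bigl((1-\nu-\theta)(1+2\lambda+\nu+\theta)+4\nu\theta\bigr),$$ $$V=(1-\nu-\theta)(1-\nu+\theta)(1+\nu-\theta)(1+\nu-\theta+2\lambda)(1-\nu+\theta+2\lambda)(1-\nu-\theta+2\lambda),$$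 and let $\rho_*$ be the function equal to $0$ outside $[\nu,\theta]$, to $1$ on the part of $[\nu,\theta]$ outside $(a,b)$, and, for $z\in(a,b)$, $$\rho_*(z)=1+\frac2\pi\left(\arctan\sqrt{\tfrac{b-z}{z-a}}\sqrt{\tfrac{a-\nu}{b-\nu}}-\arctan\sqrt{\tfrac{b-z}{z-a}}\sqrt{\tfrac ab}+\arctan\sqrt{\tfrac{z-a}{b-z}}\sqrt{\tfrac{\theta-b}{\theta-a}}-\arctan\sqrt{\tfrac{z-a}{b-z}}\sqrt{\tfrac{\lambda+1-b}{\lambda+1-a}}\right).$$ Say that a density $\rho$ has the generic shape with endpoints $a',b'$ if $\nu<a'<b'<\theta$ and, up to null sets, $\rho=1$ on $[\nu,a']\cup[b',\theta]$ and $0<\rho<1$ on $(a',b')$. Then: (i) If $\theta-\nu>1$, $\nu>\nu_c$ and $\theta<\theta_c$, where $$\nu_c=\tfrac13\Bigl(1+\lambda+\theta-\sqrt{3(1+2\lambda)+(1+\lambda-2\theta)^2}\Bigr),\qquad \theta_c=\tfrac13\Bigl(1+\lambda+\nu+\sqrt{3(1+2\lambda)+(1+\lambda-2\nu)^2}\Bigr),$$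 then $\nu<a<b<\theta$, the density $\rho_*$ has the generic shape with endpoints $a,b$ (in particular it equals $1$ on $[\nu,a]\cup[b,\theta]$), and $\rho_*$ is a minimizer of $S_\lambda$, unique up to equality almost everywhere. (ii) Whenever a minimizer $\rho$ has the generic shape with some endpoints $a',b'$, one has $a'=a$, $b'=b$, and $\rho=\rho_*$ almost everywhere. -/

import Mathlib

open MeasureTheory Set

namespace CutHexagon

noncomputable section

/-- `L₀(x) = x log x - x`, with `L₀(0) = 0`. -/
def L0 (x : ℝ) : ℝ := x * Real.log x - x

/-- The rate functional of the uniformly weighted cut hexagon with parameter `lam`, evaluated at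
a density `ρ` of endpoints on the free boundary `[0, lam + 1]`. -/
def rate (lam : ℝ) (ρ : ℝ → ℝ) : ℝ :=
  (∫ x in (0 : ℝ)..(lam + 1), (L0 x + L0 (lam + 1 - x)) * ρ x)
    - (1 / 2) * ∫ x in (0 : ℝ)..(lam + 1), ∫ y in (0 : ℝ)..(lam + 1),
        Real.log |x - y| * ρ x * ρ y

/-- Densities of endpoints that avoid the forbidden intervals `[0, ν]` and `[θ, lam + 1]`: the
endpoints of the paths are distinct lattice points (so `0 ≤ ρ ≤ 1`), and the number of outgoing
paths equals the number of incoming ones (so `ρ` has total mass `1`). -/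
structure Admissible (ν θ : ℝ) (ρ : ℝ → ℝ) : Prop where
  measurable : Measurable ρ
  nonneg : ∀ x, 0 ≤ ρ x
  le_one : ∀ x, ρ x ≤ 1
  forbidden : ∀ x, x ∉ Icc ν θ → ρ x = 0
  mass : ∫ x in ν..θ, ρ x = 1

/-- `ρ` minimizes the rate functional over all admissible densities. -/
def IsMinimizer (lam ν θ : ℝ) (ρ : ℝ → ℝ) : Prop :=
  Admissible ν θ ρ ∧ ∀ ρ' : ℝ → ℝ, Admissible ν θ ρ' → rate lam ρ ≤ rate lam ρ'

/-- The generic shape of a density: it is `1` next to both forbidden intervals, on `[ν, a]` and on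
`[b, θ]`, and takes values strictly between `0` and `1` on the interval `(a, b)` in between. -/
structure GenericShape (ν θ a b : ℝ) (ρ : ℝ → ℝ) : Prop where
  lower : ν < a
  middle : a < b
  upper : b < θ
  eq_one : ∀ᵐ x ∂volume, x ∈ Icc ν a ∪ Icc b θ → ρ x = 1
  nonconst : ∀ᵐ x ∂volume, x ∈ Ioo a b → 0 < ρ x ∧ ρ x < 1

def U (lam ν θ : ℝ) : ℝ :=
  (ν + θ) * (1 - (ν - θ) ^ 2)
    - (lam + 1) * ((1 - ν - θ) * (1 + 2 * lam + ν + θ) + 4 * ν * θ)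

def V (lam ν θ : ℝ) : ℝ :=
  (1 - ν - θ) * (1 - ν + θ) * (1 + ν - θ)
    * (1 + ν - θ + 2 * lam) * (1 - ν + θ + 2 * lam) * (1 - ν - θ + 2 * lam)

def endA (lam ν θ : ℝ) : ℝ := (U lam ν θ - √(V lam ν θ)) / (4 * lam ^ 2)

def endB (lam ν θ : ℝ) : ℝ := (U lam ν θ + √(V lam ν θ)) / (4 * lam ^ 2)

/-- The critical value of the upper end `θ` of the allowed range. -/
def thetaCrit (lam ν : ℝ) : ℝ :=
  (1 / 3) * (1 + lam + ν + √(3 * (1 + 2 * lam) + (1 + lam - 2 * ν) ^ 2))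

/-- The critical value of the lower end `ν` of the allowed range. -/
def nuCrit (lam θ : ℝ) : ℝ :=
  (1 / 3) * (1 + lam + θ - √(3 * (1 + 2 * lam) + (1 + lam - 2 * θ) ^ 2))

/-- The sum of four arctangents giving the density on `(a, b)`. -/
def arctanDensity (lam ν θ a b z : ℝ) : ℝ :=
  1 + 2 / Real.pi *
    (Real.arctan (√((b - z) / (z - a)) * √((a - ν) / (b - ν)))
      - Real.arctan (√((b - z) / (z - a)) * √(a / b))
      + Real.arctan (√((z - a) / (b - z)) * √((θ - b) / (θ - a)))
      - Real.arctan (√((z - a) / (b - z)) * √((lam + 1 - b) / (lam + 1 - a))))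

open Classical in
/-- The limit density on the whole free boundary: the arctangent formula on `(a, b)`, the value `1`
on `[ν, a] ∪ [b, θ]`, and `0` on the forbidden intervals. -/
def limitDensity (lam ν θ : ℝ) (z : ℝ) : ℝ :=
  if z ∈ Ioo (endA lam ν θ) (endB lam ν θ) then
    arctanDensity lam ν θ (endA lam ν θ) (endB lam ν θ) z
  else if z ∈ Icc ν θ then 1 else 0

end

end CutHexagon

/-! Write I(f,g) for the logarithmic energy with kernel log|x-y| on [0,λ+1]. Since L₀(x)+L₀(λ+1-x)
is the logarithmic potential of the constant 1, the functional is S[ρ] = I(ρ,1) - ½ I(ρ,ρ), and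
S[ρ+σ] = S[ρ] + ∫ Fσ - ½ I(σ,σ), where F is the potential of the density of holes 1-ρ (`rate_add`).
I is negative definite on functions of mean zero (`logEnergy_nonpos`,
`ae_eq_zero_of_logEnergy_nonneg`). An admissible ρ is therefore the unique minimizer as soon as F is
constant on [a,b] and at most that constant on [ν,a] and [b,θ], where ρ = 1 can only be lowered.

The candidate comes from potential theory. Its holes are the alternating combination, over y = 0, ν,
θ, λ+1, of the distribution functions of δ_y minus the balayage of δ_y onto [a,b]. By the inversion
x ↦ 1/(x-y) each balayage becomes an arcsine law, whose potential is explicit. Each layer then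
contributes to F' a constant on [a,b], and a constant minus a Green-type term off it. The constants
cancel exactly under the `force` equation of `EndpointEqs`, and the total mass is 1 exactly under
the `mass` equation. The signs of F' off [a,b] follow from monotonicity of the Green-type terms in
the pole.

Conversely, let a minimizer have the generic shape. Perturbing it inside (a,b) shows that F is
constant a.e. there. Pairing the holes with the arcsine law on [α,b] and differentiating at α = a
gives one equation, without any regularity of ρ; reflection gives a second one at b. Their
difference is the `force` equation and their sum the `mass` equation (`IsMinimizer.endpointEqs`).

Finally the two equations are solved in Joukowski coordinates, where they become rational: the only
possible solution is `endA`, `endB` (`endpoint_algebra`), and under the generic conditions it is a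
solution (`exists_joukowski`). Part (ii) then follows from the uniqueness behind part (i). -/

namespace CutHexagon

/-! ### Potential of the arcsine law, by the Joukowski map and Jensen's formula. -/

noncomputable section

open Real intervalIntegral

/-- The logarithmic potential at `v` of the arcsine distribution on `[α, β]`. -/
def arcPot (α β v : ℝ) : ℝ :=
  π⁻¹ * ∫ ψ in (0 : ℝ)..π, log |v - ((α + β) / 2 + (β - α) / 2 * cos ψ)|

lemma integral_cos_two_pi (f : ℝ → ℝ)
    (hf : IntervalIntegrable (fun ψ => f (cos ψ)) volume 0 (2 * π)) :
    ∫ ψ in (0 : ℝ)..(2 * π), f (cos ψ) = 2 * ∫ ψ in (0 : ℝ)..π, f (cos ψ) := by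
  have h1 : IntervalIntegrable (fun ψ => f (cos ψ)) volume 0 π :=
    hf.mono_set (by
      rw [uIcc_of_le pi_pos.le, uIcc_of_le (by positivity)]
      exact Icc_subset_Icc le_rfl (by linarith [pi_pos]))
  have h2 : IntervalIntegrable (fun ψ => f (cos ψ)) volume π (2 * π) :=
    hf.mono_set (by
      rw [uIcc_of_le (by linarith [pi_pos]), uIcc_of_le (by positivity)]
      exact Icc_subset_Icc pi_pos.le le_rfl)
  have := integral_comp_sub_left (fun ψ => f (cos ψ)) (a := 0) (b := π) (2 * π)
  simp only [cos_two_pi_sub] at this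
  rw [sub_zero, (by ring : 2 * π - π = π)] at this
  rw [← integral_add_adjacent_intervals h1 h2, ← this, ← two_mul]

/-- For z on the unit circle, (z-w)(z-1/w) = z(z + 1/z - (w + 1/w)), and z + 1/z = 2 cos ψ. This
splits the logarithm in `arcPot` into two logarithms of distances on the circle. -/
lemma norm_circleMap_sub_mul (w : ℂ) (hw : w ≠ 0) (V ψ : ℝ) (hV : w + w⁻¹ = 2 * V) :
    ‖circleMap 0 1 ψ - w‖ * ‖circleMap 0 1 ψ - w⁻¹‖ = 2 * |V - cos ψ| := by
  have h1 : circleMap 0 1 ψ = Complex.exp (ψ * Complex.I) := by simp [circleMap]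
  have h2 : (circleMap 0 1 ψ - w) * (circleMap 0 1 ψ - w⁻¹)
      = - circleMap 0 1 ψ * ((2 * (V - cos ψ) : ℝ) : ℂ) := by
    have h3 : Complex.exp (ψ * Complex.I) * Complex.exp (-ψ * Complex.I) = 1 := by
      rw [← Complex.exp_add]; simp
    have h4 : (2 : ℂ) * Complex.cos ψ
        = Complex.exp (ψ * Complex.I) + Complex.exp (-ψ * Complex.I) := by
      rw [Complex.cos]; ring
    have h5 : w * w⁻¹ = 1 := mul_inv_cancel₀ hw
    push_cast
    rw [h1]
    linear_combination (-Complex.exp (ψ * Complex.I)) * hV + h5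
      - Complex.exp (ψ * Complex.I) * h4 - h3
  rw [← norm_mul, h2, norm_mul, norm_neg, h1, Complex.norm_exp_ofReal_mul_I, one_mul,
    Complex.norm_real, Real.norm_eq_abs, abs_mul, abs_two]

/-- After the factorization over the unit circle, Jensen's formula applies: the circle average of
log|z-w| is log⁺|w|. -/
lemma arcPot_eq_posLog {α β v : ℝ} (h : α < β) (w : ℂ) (hw : w ≠ 0)
    (hv : w + w⁻¹ = 2 * ((v - (α + β) / 2) / ((β - α) / 2) : ℝ)) :
    IntervalIntegrable (fun ψ => log |v - ((α + β) / 2 + (β - α) / 2 * cos ψ)|) volume 0 π ∧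
    arcPot α β v = log ((β - α) / 4) + log⁺ ‖w‖ + log⁺ ‖w⁻¹‖ := by
  set V := (v - (α + β) / 2) / ((β - α) / 2) with hVdef
  have hr : (β - α) / 2 ≠ 0 := by linarith
  have i1 : IntervalIntegrable (fun ψ => log ‖circleMap 0 1 ψ - w‖) volume 0 (2 * π) :=
    circleIntegrable_log_norm_sub_const (a := w) (c := 0) 1
  have i2 : IntervalIntegrable (fun ψ => log ‖circleMap 0 1 ψ - w⁻¹‖) volume 0 (2 * π) :=
    circleIntegrable_log_norm_sub_const (a := w⁻¹) (c := 0) 1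
  -- Only almost everywhere: at angles with z = w or z = 1/w a factor vanishes and log(xy) = log x +
  -- log y is unavailable.
  have hae : ∀ᵐ ψ : ℝ ∂volume,
      log ((β - α) / 4) + log ‖circleMap 0 1 ψ - w‖ + log ‖circleMap 0 1 ψ - w⁻¹‖
        = log |v - ((α + β) / 2 + (β - α) / 2 * cos ψ)| := by
    have c1 : ∀ z : ℂ, ∀ᵐ ψ : ℝ ∂volume, circleMap 0 1 ψ ≠ z := fun z => by
      have := ((countable_singleton z).preimage_circleMap 0 (R := 1) one_ne_zero)
      exact (this.ae_notMem volume)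
    filter_upwards [c1 w, c1 w⁻¹] with ψ h1 h2
    have n1 : ‖circleMap 0 1 ψ - w‖ ≠ 0 := norm_ne_zero_iff.2 (sub_ne_zero.2 h1)
    have n2 : ‖circleMap 0 1 ψ - w⁻¹‖ ≠ 0 := norm_ne_zero_iff.2 (sub_ne_zero.2 h2)
    rw [← log_mul (by linarith) n1, ← log_mul (mul_ne_zero (by linarith) n1) n2, mul_assoc,
      norm_circleMap_sub_mul w hw V ψ hv]
    congr 1
    have : v - ((α + β) / 2 + (β - α) / 2 * cos ψ) = (β - α) / 2 * (V - cos ψ) := by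
      rw [hVdef, mul_sub, mul_div_cancel₀ _ hr]; ring
    rw [this, abs_mul, abs_of_pos (by linarith : 0 < (β - α) / 2)]
    ring
  have i3 : IntervalIntegrable (fun ψ => log |v - ((α + β) / 2 + (β - α) / 2 * cos ψ)|)
      volume 0 (2 * π) :=
    ((intervalIntegrable_const.add i1).add i2).congr_ae (ae_restrict_of_ae hae)
  refine ⟨i3.mono_set (by
    rw [uIcc_of_le pi_pos.le, uIcc_of_le (by positivity)]
    exact Icc_subset_Icc le_rfl (by linarith [pi_pos])), ?_⟩
  have key := integral_cos_two_pi (fun t => log |v - ((α + β) / 2 + (β - α) / 2 * t)|) i3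
  have e1 := circleAverage_log_norm_sub_const_eq_posLog (a := w)
  have e2 := circleAverage_log_norm_sub_const_eq_posLog (a := w⁻¹)
  rw [circleAverage_def, smul_eq_mul] at e1 e2
  have e3 : ∫ ψ in (0 : ℝ)..(2 * π), log |v - ((α + β) / 2 + (β - α) / 2 * cos ψ)|
      = ∫ ψ in (0 : ℝ)..(2 * π), (log ((β - α) / 4) + log ‖circleMap 0 1 ψ - w‖
        + log ‖circleMap 0 1 ψ - w⁻¹‖) :=
    intervalIntegral.integral_congr_ae (by filter_upwards [hae] with ψ h _ using h.symm)
  rw [integral_add (intervalIntegrable_const.add i1) i2,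
    integral_add intervalIntegrable_const i1, intervalIntegral.integral_const] at e3
  rw [arcPot, ← e1, ← e2]
  rw [key] at e3
  simp only [smul_eq_mul] at e3
  rw [mul_inv, ← mul_left_inj' (two_ne_zero (α := ℝ)), mul_assoc, mul_comm _ (2 : ℝ), e3]
  have hpi := mul_inv_cancel₀ pi_ne_zero
  linear_combination (2 * log ((β - α) / 4)) * hpi

lemma exists_joukowski_inside {α β v : ℝ} (h : α < β) (hv : v ∈ Icc α β) :
    ∃ w : ℂ, w ≠ 0 ∧ ‖w‖ = 1 ∧ w + w⁻¹ = 2 * ((v - (α + β) / 2) / ((β - α) / 2) : ℝ) := by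
  set V := (v - (α + β) / 2) / ((β - α) / 2)
  have h1 : -1 ≤ V := by rw [le_div_iff₀ (by linarith)]; linarith [hv.1]
  have h2 : V ≤ 1 := by rw [div_le_iff₀ (by linarith)]; linarith [hv.2]
  refine ⟨Complex.exp (arccos V * Complex.I), Complex.exp_ne_zero _,
    Complex.norm_exp_ofReal_mul_I _, ?_⟩
  rw [← Complex.exp_neg, ← neg_mul]
  have : (V : ℂ) = Complex.cos (arccos V) := by
    rw [← Complex.ofReal_cos, cos_arccos h1 h2]
  rw [this, Complex.cos]
  ring

/-- With X² = v-α and Y² = v-β, the preimage outside the unit disc is w = (X+Y)/(X-Y), and β-α =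
X²-Y² turns |w|(β-α)/4 into ((X+Y)/2)². -/
lemma exists_joukowski_right {α β v : ℝ} (h : α < β) (hv : β ≤ v) :
    ∃ w : ℂ, w ≠ 0 ∧ 1 ≤ ‖w‖ ∧
      (β - α) / 4 * ‖w‖ = ((√|v - α| + √|v - β|) / 2) ^ 2 ∧
      w + w⁻¹ = 2 * ((v - (α + β) / 2) / ((β - α) / 2) : ℝ) := by
  rw [abs_of_nonneg (by linarith : 0 ≤ v - α), abs_of_nonneg (by linarith : 0 ≤ v - β)]
  have hX : √(v - α) ^ 2 = v - α := sq_sqrt (by linarith)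
  have hY : √(v - β) ^ 2 = v - β := sq_sqrt (by linarith)
  have hX0 : 0 < √(v - α) := sqrt_pos.2 (by linarith)
  have hY0 : 0 ≤ √(v - β) := sqrt_nonneg _
  set X := √(v - α)
  set Y := √(v - β)
  have hXY : Y < X := by nlinarith
  have hβ : β = α + X ^ 2 - Y ^ 2 := by linarith
  have hv' : v = α + X ^ 2 := by linarith
  have hd : 0 < X - Y := by linarith
  have hs : 0 < X + Y := by linarith
  have hw1 : 1 ≤ (X + Y) / (X - Y) := by rw [le_div_iff₀ hd]; linarith
  refine ⟨((X + Y) / (X - Y) : ℝ), ?_, ?_, ?_, ?_⟩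
  · exact_mod_cast (by positivity : (X + Y) / (X - Y) ≠ 0)
  · rw [Complex.norm_real, Real.norm_eq_abs, abs_of_nonneg (by positivity)]; exact hw1
  · rw [Complex.norm_real, Real.norm_eq_abs, abs_of_nonneg (by positivity), hβ]
    field_simp; ring
  · norm_cast
    rw [hβ, hv']
    have : α + X ^ 2 - Y ^ 2 - α ≠ 0 := by nlinarith
    rw [inv_div]
    field_simp
    ring

lemma arcPot_reflect (α β v : ℝ) : arcPot (-β) (-α) (-v) = arcPot α β v := by
  unfold arcPot
  congr 1
  have := integral_comp_sub_left
    (fun ψ => log |v - ((α + β) / 2 + (β - α) / 2 * cos ψ)|) (a := 0) (b := π) π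
  rw [sub_self, sub_zero] at this
  rw [← this]
  congr 1 with ψ
  rw [cos_pi_sub, ← abs_neg]
  congr 2
  ring

/-- The potential of the arcsine distribution is constant on its support. -/
lemma arcPot_inside {α β v : ℝ} (h : α < β) (hv : v ∈ Icc α β) :
    arcPot α β v = log ((β - α) / 4) := by
  obtain ⟨w, hw, hn, he⟩ := exists_joukowski_inside h hv
  rw [(arcPot_eq_posLog h w hw he).2, norm_inv, hn]
  simp

lemma arcPot_right {α β v : ℝ} (h : α < β) (hv : β ≤ v) :
    arcPot α β v = 2 * log ((√|v - α| + √|v - β|) / 2) := by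
  obtain ⟨w, hw, hn, hn', he⟩ := exists_joukowski_right h hv
  have h1 : log⁺ ‖w‖ = log ‖w‖ := posLog_eq_log (by rwa [abs_of_nonneg (norm_nonneg _)])
  have h2 : log⁺ ‖w⁻¹‖ = 0 := by
    rw [posLog_eq_zero_iff, abs_of_nonneg (norm_nonneg _), norm_inv]
    exact inv_le_one_of_one_le₀ hn
  rw [(arcPot_eq_posLog h w hw he).2, h1, h2, add_zero, ← log_mul (by linarith) (by positivity),
    hn', log_pow]
  norm_num

/-- The potential of the arcsine distribution off its support. -/
lemma arcPot_outside {α β v : ℝ} (h : α < β) (hv : v ≤ α ∨ β ≤ v) :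
    arcPot α β v = 2 * log ((√|v - α| + √|v - β|) / 2) := by
  rcases hv with hv | hv
  · rw [← arcPot_reflect, arcPot_right (by linarith) (by linarith), add_comm (√|v - α|),
      neg_sub_neg, neg_sub_neg, abs_sub_comm β, abs_sub_comm α]
  · exact arcPot_right h hv

lemma arcPot_intervalIntegrable {α β : ℝ} (h : α < β) (v : ℝ) :
    IntervalIntegrable (fun ψ => log |v - ((α + β) / 2 + (β - α) / 2 * cos ψ)|) volume 0 π := by
  have right : ∀ {α β v : ℝ}, α < β → β ≤ v → IntervalIntegrable
      (fun ψ => log |v - ((α + β) / 2 + (β - α) / 2 * cos ψ)|) volume 0 π := fun h hv => by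
    obtain ⟨w, hw, -, -, he⟩ := exists_joukowski_right h hv
    exact (arcPot_eq_posLog h w hw he).1
  rcases le_total v α with h1 | h1
  · have := (right (by linarith : -β < -α) (by linarith : -α ≤ -v)).comp_sub_left π
    rw [sub_self, sub_zero] at this
    refine this.symm.congr ?_
    intro ψ _
    simp only [cos_pi_sub]
    rw [← abs_neg]
    congr 2
    ring
  · rcases le_total β v with h2 | h2
    · exact right h h2
    · obtain ⟨w, hw, -, he⟩ := exists_joukowski_inside h ⟨h1, h2⟩
      exact (arcPot_eq_posLog h w hw he).1

end

end CutHexagon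

/-! ### The rate functional as a quadratic form in the logarithmic energy. -/

namespace CutHexagon

noncomputable section

open Real

/-- A uniform bound for the `L¹`-norms of `log |x - ·|` on `[0, L]` for `x ∈ [0, L]`. -/
def logBound (L : ℝ) : ℝ := ∫ t in Icc (-L) L, |log t|

lemma integrableOn_log (a b : ℝ) : IntegrableOn log (Icc a b) := by
  rcases le_total a b with h | h
  · rw [integrableOn_Icc_iff_integrableOn_Ioc, ← intervalIntegrable_iff_integrableOn_Ioc_of_le h]
    exact intervalIntegral.intervalIntegrable_log'
  · rcases h.eq_or_lt with rfl | h
    · simp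
    · simp [Icc_eq_empty (not_le.2 h)]

lemma integrableOn_log_abs_sub (x a b : ℝ) : IntegrableOn (fun y => log |x - y|) (Icc a b) := by
  have h := (integrableOn_log (x - b) (x - a))
  have e : (fun y => x - y) ⁻¹' Icc (x - b) (x - a) = Icc a b := by
    ext y; simp only [mem_preimage, mem_Icc]; constructor <;> intro h <;> constructor <;> linarith
  have := ((Measure.measurePreserving_sub_left volume x).integrableOn_comp_preimage
    (MeasurableEquiv.subLeft x).measurableEmbedding (f := log) (s := Icc (x - b) (x - a))).2 h
  rw [e] at this
  exact this.congr_fun (fun y _ => by simp [log_abs]) measurableSet_Icc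

lemma setIntegral_abs_log_le {L x : ℝ} (hx : x ∈ Icc 0 L) :
    ∫ y in Icc 0 L, |log (|x - y|)| ≤ logBound L := by
  have e : (fun y => x - y) ⁻¹' Icc (x - L) (x - 0) = Icc 0 L := by
    ext y; simp only [mem_preimage, mem_Icc]; constructor <;> intro h <;> constructor <;> linarith
  have := (Measure.measurePreserving_sub_left volume x).setIntegral_preimage_emb
    (MeasurableEquiv.subLeft x).measurableEmbedding (fun t => |log t|) (Icc (x - L) (x - 0))
  rw [e] at this
  simp only [log_abs]
  rw [this]
  exact setIntegral_mono_set (integrableOn_log _ _).abs (ae_of_all _ fun _ => abs_nonneg _)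
    (LE.le.eventuallyLE (Icc_subset_Icc (by linarith [hx.1]) (by linarith [hx.2])))

lemma measurable_log_abs_sub {S : Type*} [MeasurableSpace S] {u : S → ℝ} (hu : Measurable u) :
    Measurable (fun p : S × ℝ => log |u p.1 - p.2|) := by
  fun_prop

/-- Integrability of the logarithmic kernel along a family of points of `[0, L]`. -/
lemma integrable_log_abs_sub {S : Type*} [MeasurableSpace S] (μ : Measure S) [IsFiniteMeasure μ]
    {L : ℝ} {u : S → ℝ} (hu : Measurable u) (hL : ∀ᵐ s ∂μ, u s ∈ Icc 0 L) :
    Integrable (fun p : S × ℝ => log |u p.1 - p.2|) (μ.prod (volume.restrict (Icc 0 L))) := by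
  have hm := measurable_log_abs_sub hu
  rw [integrable_prod_iff hm.aestronglyMeasurable]
  refine ⟨ae_of_all _ fun s => integrableOn_log_abs_sub (u s) 0 L, ?_⟩
  refine Integrable.of_bound (C := logBound L) ?_ ?_
  · exact hm.norm.stronglyMeasurable.integral_prod_right'.aestronglyMeasurable
  · filter_upwards [hL] with s hs
    rw [Real.norm_of_nonneg (integral_nonneg fun _ => norm_nonneg _)]
    simpa only [Real.norm_eq_abs] using setIntegral_abs_log_le hs

/-- Bounded measurable functions. -/
def BddMeas (f : ℝ → ℝ) : Prop := Measurable f ∧ ∃ C, ∀ x, |f x| ≤ C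

namespace BddMeas

lemma of_unit {f : ℝ → ℝ} (hf : Measurable f) (h0 : ∀ x, 0 ≤ f x) (h1 : ∀ x, f x ≤ 1) :
    BddMeas f :=
  ⟨hf, 1, fun x => by rw [abs_of_nonneg (h0 x)]; exact h1 x⟩

lemma add {f g : ℝ → ℝ} (hf : BddMeas f) (hg : BddMeas g) : BddMeas (fun x => f x + g x) := by
  obtain ⟨hf, C, hC⟩ := hf
  obtain ⟨hg, D, hD⟩ := hg
  exact ⟨hf.add hg, C + D, fun x => (abs_add_le _ _).trans (add_le_add (hC x) (hD x))⟩

lemma const_mul {f : ℝ → ℝ} (c : ℝ) (hf : BddMeas f) : BddMeas (fun x => c * f x) := by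
  obtain ⟨hf, C, hC⟩ := hf
  exact ⟨hf.const_mul c, |c| * C, fun x => by
    rw [abs_mul]; exact mul_le_mul_of_nonneg_left (hC x) (abs_nonneg _)⟩

lemma mul {f g : ℝ → ℝ} (hf : BddMeas f) (hg : BddMeas g) : BddMeas (fun x => f x * g x) := by
  obtain ⟨hf, C, hC⟩ := hf
  obtain ⟨hg, D, hD⟩ := hg
  exact ⟨hf.mul hg, C * D, fun x => by
    rw [abs_mul]
    exact mul_le_mul (hC x) (hD x) (abs_nonneg _) ((abs_nonneg _).trans (hC x))⟩

lemma const (c : ℝ) : BddMeas (fun _ => c) := ⟨measurable_const, |c|, fun _ => le_rfl⟩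

lemma sub {f g : ℝ → ℝ} (hf : BddMeas f) (hg : BddMeas g) : BddMeas (fun x => f x - g x) := by
  simpa [sub_eq_add_neg] using hf.add (hg.const_mul (-1))

lemma indicator {f : ℝ → ℝ} (hf : BddMeas f) {s : Set ℝ} (hs : MeasurableSet s) :
    BddMeas (s.indicator f) := by
  obtain ⟨hf, C, hC⟩ := hf
  refine ⟨hf.indicator hs, C, fun x => ?_⟩
  by_cases hx : x ∈ s
  · simp [hx, hC x]
  · simp [hx, (abs_nonneg _).trans (hC x)]

lemma integrable {f : ℝ → ℝ} (hf : BddMeas f) (μ : Measure ℝ) [IsFiniteMeasure μ] :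
    Integrable f μ := by
  obtain ⟨hf, C, hC⟩ := hf
  exact Integrable.of_bound hf.aestronglyMeasurable C (ae_of_all _ hC)

end BddMeas

/-- Bounded densities may be multiplied into an integrable kernel. -/
lemma Integrable.mul_bddMeas {S : Type*} [MeasurableSpace S] {μ : Measure S} {k : S → ℝ}
    (hk : Integrable k μ) {f : ℝ → ℝ} (hf : BddMeas f) {v : S → ℝ} (hv : Measurable v) :
    Integrable (fun s => k s * f (v s)) μ := by
  obtain ⟨hf, C, hC⟩ := hf
  exact hk.mul_bdd (c := C) (hf.comp hv).aestronglyMeasurable (ae_of_all _ fun s => hC (v s))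

/-- The bilinear logarithmic energy on `[0, L]`. -/
def logEnergy (L : ℝ) (f g : ℝ → ℝ) : ℝ :=
  ∫ p : ℝ × ℝ, log |p.1 - p.2| * f p.1 * g p.2
    ∂((volume.restrict (Icc 0 L)).prod (volume.restrict (Icc 0 L)))

/-- The logarithmic potential of a density on `[0, L]`. -/
def logPot (L : ℝ) (f : ℝ → ℝ) (x : ℝ) : ℝ := ∫ y in Icc 0 L, log |x - y| * f y

lemma integrable_log_kernel (L : ℝ) : Integrable (fun p : ℝ × ℝ => log |p.1 - p.2|)
    ((volume.restrict (Icc 0 L)).prod (volume.restrict (Icc 0 L))) :=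
  integrable_log_abs_sub _ measurable_id (ae_restrict_mem measurableSet_Icc)

lemma integrable_logEnergy (L : ℝ) {f g : ℝ → ℝ} (hf : BddMeas f) (hg : BddMeas g) :
    Integrable (fun p : ℝ × ℝ => log |p.1 - p.2| * f p.1 * g p.2)
    ((volume.restrict (Icc 0 L)).prod (volume.restrict (Icc 0 L))) :=
  Integrable.mul_bddMeas (Integrable.mul_bddMeas (integrable_log_kernel L) hf measurable_fst) hg
    measurable_snd

lemma logEnergy_symm (L : ℝ) (f g : ℝ → ℝ) : logEnergy L f g = logEnergy L g f := by
  unfold logEnergy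
  rw [← integral_prod_swap]
  congr 1 with p
  simp only [Prod.fst_swap, Prod.snd_swap]
  rw [abs_sub_comm]; ring

lemma logEnergy_add_left {L : ℝ} {f g h : ℝ → ℝ} (hf : BddMeas f) (hg : BddMeas g)
    (hh : BddMeas h) :
    logEnergy L (fun x => f x + g x) h = logEnergy L f h + logEnergy L g h := by
  unfold logEnergy
  rw [← integral_add (integrable_logEnergy L hf hh) (integrable_logEnergy L hg hh)]
  congr 1 with p
  ring

lemma logEnergy_const_mul_left (L c : ℝ) (f h : ℝ → ℝ) :
    logEnergy L (fun x => c * f x) h = c * logEnergy L f h := by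
  unfold logEnergy
  rw [← integral_const_mul]
  congr 1 with p
  ring

lemma logEnergy_eq_integral_integral {L : ℝ} {f g : ℝ → ℝ} (hf : BddMeas f) (hg : BddMeas g) :
    logEnergy L f g = ∫ x in Icc 0 L, ∫ y in Icc 0 L, log |x - y| * f x * g y :=
  integral_prod _ (integrable_logEnergy L hf hg)

lemma logEnergy_eq_integral_logPot {L : ℝ} {f g : ℝ → ℝ} (hf : BddMeas f) (hg : BddMeas g) :
    logEnergy L f g = ∫ x in Icc 0 L, logPot L g x * f x := by
  rw [logEnergy_eq_integral_integral hf hg]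
  congr 1 with x
  rw [logPot, ← integral_mul_const]
  congr 1 with y
  ring

lemma measurable_logPot (L : ℝ) {f : ℝ → ℝ} (hf : Measurable f) : Measurable (logPot L f) := by
  have : Measurable (fun p : ℝ × ℝ => log |p.1 - p.2| * f p.2) := by fun_prop
  exact (this.stronglyMeasurable.integral_prod_right').measurable

lemma exists_abs_logPot_le (L : ℝ) {f : ℝ → ℝ} (hf : BddMeas f) :
    ∃ C, ∀ x ∈ Icc 0 L, |logPot L f x| ≤ C := by
  obtain ⟨hm, C, hC⟩ := hf
  refine ⟨logBound L * C, fun x hx => ?_⟩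
  have h0 : 0 ≤ C := (abs_nonneg _).trans (hC 0)
  rw [logPot, ← Real.norm_eq_abs]
  refine (norm_integral_le_integral_norm _).trans ?_
  refine le_trans (integral_mono_of_nonneg (ae_of_all _ fun _ => norm_nonneg _)
    ((integrableOn_log_abs_sub x 0 L).abs.mul_const C) (ae_of_all _ fun y => ?_)) ?_
  · simp only [norm_mul, Real.norm_eq_abs]
    exact mul_le_mul_of_nonneg_left (hC y) (abs_nonneg _)
  · rw [integral_mul_const]
    exact mul_le_mul_of_nonneg_right (setIntegral_abs_log_le hx) h0

lemma intervalIntegral_log_abs_sub (x a b : ℝ) :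
    ∫ y in a..b, log |x - y| = L0 (x - a) - L0 (x - b) := by
  simp only [log_abs]
  rw [intervalIntegral.integral_comp_sub_left (fun t => log t), integral_log, L0, L0]
  ring

/-- This identifies the linear term of `rate` as an energy against the constant density 1. It uses
that `L0` is odd, `Real.log` being even. -/
lemma logPot_one {L x : ℝ} (hL : 0 ≤ L) : logPot L (fun _ => 1) x = L0 x + L0 (L - x) := by
  have h := intervalIntegral_log_abs_sub x 0 L
  rw [intervalIntegral.integral_of_le hL, ← integral_Icc_eq_integral_Ioc] at h
  simp only [logPot, mul_one]
  rw [h, sub_zero, L0, L0, L0, ← neg_sub x L, log_neg_eq_log]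
  ring

lemma rate_eq {lam : ℝ} (hlam : 0 < lam) {ρ : ℝ → ℝ} (hρ : BddMeas ρ) :
    rate lam ρ = logEnergy (lam + 1) ρ (fun _ => 1) - 1 / 2 * logEnergy (lam + 1) ρ ρ := by
  have hL : 0 ≤ lam + 1 := by linarith
  rw [logEnergy_eq_integral_logPot hρ (BddMeas.const 1), logEnergy_eq_integral_integral hρ hρ, rate]
  simp only [intervalIntegral.integral_of_le hL, ← integral_Icc_eq_integral_Ioc, logPot_one hL]

/-- Exact second order expansion of the rate functional. -/
lemma rate_add {lam : ℝ} (hlam : 0 < lam) {ρ σ : ℝ → ℝ} (hρ : BddMeas ρ) (hσ : BddMeas σ) :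
    rate lam (fun x => ρ x + σ x) = rate lam ρ
      + (∫ x in Icc 0 (lam + 1), logPot (lam + 1) (fun y => 1 - ρ y) x * σ x)
      - 1 / 2 * logEnergy (lam + 1) σ σ := by
  have h1 := BddMeas.const 1
  have hs := hρ.add hσ
  rw [rate_eq hlam hs, rate_eq hlam hρ, ← logEnergy_eq_integral_logPot hσ (h1.sub hρ),
    logEnergy_add_left hρ hσ h1, logEnergy_add_left hρ hσ hs,
    logEnergy_symm _ ρ (fun x => ρ x + σ x), logEnergy_symm _ σ (fun x => ρ x + σ x),
    logEnergy_add_left hρ hσ hρ, logEnergy_add_left hρ hσ hσ, logEnergy_symm _ σ (fun y => 1 - ρ y)]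
  have e : logEnergy (lam + 1) (fun y => 1 - ρ y) σ
      = logEnergy (lam + 1) (fun _ => 1) σ - logEnergy (lam + 1) ρ σ := by
    have := logEnergy_add_left (L := lam + 1) h1 (hρ.const_mul (-1)) hσ
    rw [logEnergy_const_mul_left] at this
    rw [sub_eq_add_neg, ← neg_one_mul, ← this]
    congr 1 with y
    ring
  rw [e, logEnergy_symm _ σ (fun _ => 1), logEnergy_symm _ σ ρ]
  ring

end

end CutHexagon

/-! ### Negative definiteness of the logarithmic energy on functions of mean zero. -/

namespace CutHexagon

noncomputable section

open Real

/-- A kernel of the form `∫ φ(x, s) φ(y, s) w(s) ds` with `w ≥ 0` is positive semidefinite. -/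
lemma integral_kernel_eq_integral_sq {S : Type*} [MeasurableSpace S] (m : Measure ℝ) [SFinite m]
    (μ : Measure S) [SFinite μ] (φ : ℝ → S → ℝ) (w : S → ℝ) (σ : ℝ → ℝ)
    (hint : Integrable (fun p : (ℝ × ℝ) × S => φ p.1.1 p.2 * φ p.1.2 p.2 * w p.2 * σ p.1.1 * σ p.1.2)
      ((m.prod m).prod μ)) :
    ∫ p : ℝ × ℝ, (∫ s, φ p.1 s * φ p.2 s * w s ∂μ) * σ p.1 * σ p.2 ∂(m.prod m)
      = ∫ s, w s * (∫ x, φ x s * σ x ∂m) ^ 2 ∂μ := by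
  have h1 := integral_prod _ hint
  have h2 := integral_prod_symm _ hint
  rw [h1] at h2
  have e1 : ∀ p : ℝ × ℝ, (∫ s, φ p.1 s * φ p.2 s * w s ∂μ) * σ p.1 * σ p.2
      = ∫ s, φ p.1 s * φ p.2 s * w s * σ p.1 * σ p.2 ∂μ := fun p => by
    rw [integral_mul_const, integral_mul_const]
  simp only [e1]
  rw [h2]
  congr 1 with s
  rw [sq, ← integral_prod_mul, ← integral_const_mul]
  congr 1 with p
  ring

lemma integral_inv_sq_shift {m M Q p : ℝ} (hp : p ≤ m) (hM : m < M) (hQ : M ≤ Q) :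
    ∫ q in M..Q, ((q - p) ^ 2)⁻¹ = (M - p)⁻¹ - (Q - p)⁻¹ := by
  rw [intervalIntegral.integral_eq_sub_of_hasDerivAt (f := fun q => -(q - p)⁻¹)]
  · ring
  · intro q hq
    rw [uIcc_of_le hQ] at hq
    have hq' : q - p ≠ 0 := by have := hq.1; intro h; linarith
    have := ((hasDerivAt_id q).sub_const p).inv hq'
    convert this.neg using 1
    · rfl
    · simp [neg_div]
  · apply ContinuousOn.intervalIntegrable
    intro q hq
    rw [uIcc_of_le hQ] at hq
    have hq' : (q - p) ^ 2 ≠ 0 := pow_ne_zero _ (by have := hq.1; intro h; linarith)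
    exact ContinuousAt.continuousWithinAt (by fun_prop (disch := assumption))

/-- The logarithmic kernel, up to terms depending on `max x y` or on `min x y` only, is the
hyperbolic area of the set of intervals containing both `x` and `y`. -/
lemma integral_integral_inv_sq {m M P Q : ℝ} (hP : P ≤ m) (hM : m < M) (hQ : M ≤ Q) :
    ∫ p in P..m, ∫ q in M..Q, ((q - p) ^ 2)⁻¹
      = log (M - P) + log (Q - m) - log (Q - P) - log (M - m) := by
  have : ∀ c, m < c → ∫ p in P..m, (c - p)⁻¹ = log (c - P) - log (c - m) := fun c hc => by
    rw [intervalIntegral.integral_comp_sub_left (fun t => t⁻¹), integral_inv_of_pos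
      (by linarith) (by linarith), log_div (by linarith) (by linarith)]
  have hii : ∀ c, m < c → IntervalIntegrable (fun p => (c - p)⁻¹) volume P m := fun c hc => by
    apply ContinuousOn.intervalIntegrable
    intro p hp
    rw [uIcc_of_le hP] at hp
    have : c - p ≠ 0 := by have := hp.2; intro h; linarith
    exact ContinuousAt.continuousWithinAt (by fun_prop (disch := assumption))
  have e : ∫ p in P..m, ∫ q in M..Q, ((q - p) ^ 2)⁻¹ = ∫ p in P..m, ((M - p)⁻¹ - (Q - p)⁻¹) := by
    apply intervalIntegral.integral_congr
    intro p hp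
    rw [uIcc_of_le hP] at hp
    exact integral_inv_sq_shift hp.2 hM hQ
  rw [e, intervalIntegral.integral_sub (hii M hM) (hii Q (by linarith)), this M hM,
    this Q (by linarith)]
  ring

/-- Indicator of the intervals `(p, q)` containing `x`. -/
def spanInd (x : ℝ) (s : ℝ × ℝ) : ℝ := if s.1 < x ∧ x < s.2 then 1 else 0

lemma measurable_spanInd : Measurable (fun p : ℝ × (ℝ × ℝ) => spanInd p.1 p.2) := by
  unfold spanInd
  refine Measurable.ite ?_ measurable_const measurable_const
  exact (measurableSet_lt (measurable_fst.comp measurable_snd) measurable_fst).inter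
    (measurableSet_lt measurable_fst (measurable_snd.comp measurable_snd))

/-- The space of intervals used for the interval `[0, L]`. -/
def spanMeasure (L : ℝ) : Measure (ℝ × ℝ) :=
  (volume.restrict (Icc (-1) L)).prod (volume.restrict (Icc 0 (L + 1)))

instance (L : ℝ) : IsFiniteMeasure (spanMeasure L) := by unfold spanMeasure; infer_instance

/-- An interval (p,q) contains both points iff p < x and q > y, so q-p stays above y-x > 0 and the
hyperbolic density is bounded on the relevant region. -/
lemma integral_spanInd {L x y : ℝ} (hx : x ∈ Icc 0 L) (hy : y ∈ Icc 0 L) (hxy : x < y) :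
    Integrable (fun s => spanInd x s * spanInd y s * ((s.2 - s.1) ^ 2)⁻¹) (spanMeasure L) ∧
    ∫ s, spanInd x s * spanInd y s * ((s.2 - s.1) ^ 2)⁻¹ ∂(spanMeasure L)
      = log (y + 1) + log (L + 1 - x) - log (L + 2) - log |x - y| := by
  have e : (fun s : ℝ × ℝ => spanInd x s * spanInd y s * ((s.2 - s.1) ^ 2)⁻¹)
      = (Iio x ×ˢ Ioi y).indicator (fun s => ((s.2 - s.1) ^ 2)⁻¹) := by
    ext s
    by_cases h : s ∈ Iio x ×ˢ Ioi y
    · have h1 : s.1 < x := h.1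
      have h2 : y < s.2 := h.2
      rw [indicator_of_mem h, spanInd, spanInd, if_pos ⟨h1, hxy.trans h2⟩,
        if_pos ⟨h1.trans hxy, h2⟩]
      ring
    · rw [indicator_of_notMem h, spanInd, spanInd]
      by_cases h1 : s.1 < x
      · have h2 : ¬ y < s.2 := fun h2 => h ⟨h1, h2⟩
        rw [if_neg (fun h => h2 h.2 : ¬ (s.1 < y ∧ y < s.2))]
        ring
      · rw [if_neg (fun h => h1 h.1 : ¬ (s.1 < x ∧ x < s.2))]
        ring
  have hms : MeasurableSet (Iio x ×ˢ Ioi y) := measurableSet_Iio.prod measurableSet_Ioi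
  have hr : (spanMeasure L).restrict (Iio x ×ˢ Ioi y)
      = (volume.restrict (Ico (-1) x)).prod (volume.restrict (Ioc y (L + 1))) := by
    have e1 : Iio x ∩ Icc (-1) L = Ico (-1) x := by
      ext p; simp only [mem_inter_iff, mem_Iio, mem_Icc, mem_Ico]
      exact ⟨fun h => ⟨h.2.1, h.1⟩, fun h => ⟨h.2, h.1, by linarith [hx.2, h.2]⟩⟩
    have e2 : Ioi y ∩ Icc 0 (L + 1) = Ioc y (L + 1) := by
      ext p; simp only [mem_inter_iff, mem_Ioi, mem_Icc, mem_Ioc]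
      exact ⟨fun h => ⟨h.1, h.2.2⟩, fun h => ⟨h.1, by linarith [hy.1, h.1], h.2⟩⟩
    rw [spanMeasure, ← Measure.prod_restrict, Measure.restrict_restrict measurableSet_Iio,
      Measure.restrict_restrict measurableSet_Ioi, e1, e2]
  have hi : Integrable (fun s : ℝ × ℝ => ((s.2 - s.1) ^ 2)⁻¹)
      ((volume.restrict (Ico (-1) x)).prod (volume.restrict (Ioc y (L + 1)))) := by
    refine Integrable.of_bound (C := ((y - x) ^ 2)⁻¹) (by fun_prop) ?_
    rw [Measure.prod_restrict]
    filter_upwards [ae_restrict_mem (measurableSet_Ico.prod measurableSet_Ioc)] with s hs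
    have h1 : s.1 < x := hs.1.2
    have h2 : y < s.2 := hs.2.1
    rw [Real.norm_of_nonneg (by positivity)]
    have : 0 < y - x := by linarith
    gcongr
  rw [e]
  refine ⟨?_, ?_⟩
  · rw [integrable_indicator_iff hms, IntegrableOn, hr]
    exact hi
  · rw [integral_indicator hms, hr, integral_prod _ hi]
    -- The margins -1 and L+1 keep the correction terms log(y+1) and log(L+1-x) bounded for points
    -- of [0,L].
    have := integral_integral_inv_sq (m := x) (M := y) (P := -1) (Q := L + 1)
      (by linarith [hx.1]) hxy (by linarith [hy.2])
    simp only [intervalIntegral.integral_of_le (by linarith [hx.1] : -1 ≤ x),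
      intervalIntegral.integral_of_le (by linarith [hy.2] : y ≤ L + 1)] at this
    rw [Measure.restrict_congr_set Ico_ae_eq_Ioc, this, abs_sub_comm, abs_of_pos (by linarith)]
    ring_nf

/-- The positive semidefinite main part of the logarithmic kernel. -/
def spanKernel (L x y : ℝ) : ℝ :=
  ∫ s, spanInd x s * spanInd y s * ((s.2 - s.1) ^ 2)⁻¹ ∂(spanMeasure L)

lemma spanKernel_eq {L x y : ℝ} (hx : x ∈ Icc 0 L) (hy : y ∈ Icc 0 L) (hxy : x ≠ y) :
    Integrable (fun s => spanInd x s * spanInd y s * ((s.2 - s.1) ^ 2)⁻¹) (spanMeasure L) ∧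
    spanKernel L x y = log (max x y + 1) + log (L + 1 - min x y) - log (L + 2) - log |x - y| := by
  rcases hxy.lt_or_gt with h | h
  · rw [max_eq_right h.le, min_eq_left h.le]
    exact integral_spanInd hx hy h
  · rw [max_eq_left h.le, min_eq_right h.le, abs_sub_comm]
    have := integral_spanInd hy hx h
    simpa only [spanKernel, mul_comm (spanInd x _)] using this

lemma ae_prod_ne (L : ℝ) : ∀ᵐ p : ℝ × ℝ
    ∂((volume.restrict (Icc 0 L)).prod (volume.restrict (Icc 0 L))),
    p.1 ∈ Icc 0 L ∧ p.2 ∈ Icc 0 L ∧ p.1 ≠ p.2 := by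
  have h1 : ∀ᵐ p : ℝ × ℝ ∂((volume.restrict (Icc 0 L)).prod (volume.restrict (Icc 0 L))),
      p ∈ Icc 0 L ×ˢ Icc 0 L := by
    rw [Measure.prod_restrict]
    exact ae_restrict_mem (measurableSet_Icc.prod measurableSet_Icc)
  have h2 : ∀ᵐ p : ℝ × ℝ ∂((volume.restrict (Icc 0 L)).prod (volume.restrict (Icc 0 L))),
      p.1 ≠ p.2 := by
    rw [Measure.ae_prod_iff_ae_ae]
    · refine ae_of_all _ fun x => ?_
      have := (countable_singleton x).ae_notMem (volume.restrict (Icc 0 L))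
      filter_upwards [this] with y hy h using hy h.symm
    · exact (measurableSet_eq_fun measurable_fst measurable_snd).compl
  filter_upwards [h1, h2] with p h h' using ⟨h.1, h.2, h'⟩

lemma abs_log_le_log {t c : ℝ} (h1 : 1 ≤ t) (h2 : t ≤ c) : |log t| ≤ log c := by
  rw [abs_of_nonneg (log_nonneg h1)]
  exact log_le_log (by linarith) h2

lemma integrable_log_max (L : ℝ) : Integrable (fun p : ℝ × ℝ => log (max p.1 p.2 + 1))
    ((volume.restrict (Icc 0 L)).prod (volume.restrict (Icc 0 L))) := by
  refine Integrable.of_bound (C := log (L + 1)) (Measurable.aestronglyMeasurable (by fun_prop)) ?_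
  filter_upwards [ae_prod_ne L] with p ⟨h1, h2, _⟩
  refine abs_log_le_log ?_ ?_
  · linarith [le_max_left p.1 p.2, h1.1]
  · linarith [max_le h1.2 h2.2]

lemma integrable_log_min (L : ℝ) : Integrable (fun p : ℝ × ℝ => log (L + 1 - min p.1 p.2))
    ((volume.restrict (Icc 0 L)).prod (volume.restrict (Icc 0 L))) := by
  refine Integrable.of_bound (C := log (L + 1)) (Measurable.aestronglyMeasurable (by fun_prop)) ?_
  filter_upwards [ae_prod_ne L] with p ⟨h1, h2, _⟩
  refine abs_log_le_log ?_ ?_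
  · linarith [min_le_left p.1 p.2, h1.2]
  · linarith [le_min h1.1 h2.1]

lemma integrable_spanKernel (L : ℝ) : Integrable (fun p : ℝ × ℝ => spanKernel L p.1 p.2)
    ((volume.restrict (Icc 0 L)).prod (volume.restrict (Icc 0 L))) := by
  have := (((integrable_log_max L).add (integrable_log_min L)).sub
    (integrable_const (log (L + 2)))).sub (integrable_log_kernel L)
  refine this.congr ?_
  filter_upwards [ae_prod_ne L] with p ⟨h1, h2, h3⟩
  rw [(spanKernel_eq h1 h2 h3).2]
  rfl

lemma spanInd_nonneg (x : ℝ) (s : ℝ × ℝ) : 0 ≤ spanInd x s := by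
  unfold spanInd; split_ifs <;> norm_num

lemma spanKernel_energy_nonneg (L : ℝ) {σ : ℝ → ℝ} (hσ : BddMeas σ) :
    0 ≤ ∫ p : ℝ × ℝ, spanKernel L p.1 p.2 * σ p.1 * σ p.2
      ∂((volume.restrict (Icc 0 L)).prod (volume.restrict (Icc 0 L))) := by
  have hi : Integrable (fun p : (ℝ × ℝ) × (ℝ × ℝ) =>
      spanInd p.1.1 p.2 * spanInd p.1.2 p.2 * ((p.2.2 - p.2.1) ^ 2)⁻¹)
      (((volume.restrict (Icc 0 L)).prod (volume.restrict (Icc 0 L))).prod (spanMeasure L)) := by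
    have hm : Measurable (fun p : (ℝ × ℝ) × (ℝ × ℝ) =>
        spanInd p.1.1 p.2 * spanInd p.1.2 p.2 * ((p.2.2 - p.2.1) ^ 2)⁻¹) := by
      refine (Measurable.mul ?_ ?_).mul (by fun_prop)
      · exact measurable_spanInd.comp
          ((measurable_fst.comp measurable_fst).prodMk measurable_snd)
      · exact measurable_spanInd.comp
          ((measurable_snd.comp measurable_fst).prodMk measurable_snd)
    rw [integrable_prod_iff hm.aestronglyMeasurable]
    refine ⟨?_, ?_⟩
    · filter_upwards [ae_prod_ne L] with p ⟨h1, h2, h3⟩ using (spanKernel_eq h1 h2 h3).1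
    -- The triple kernel is nonnegative, so integrating its norm over intervals returns
    -- `spanKernel`, whose integrability is known from its closed form.
    · refine (integrable_spanKernel L).congr (ae_of_all _ fun p => ?_)
      simp only [spanKernel]
      congr 1 with s
      have := spanInd_nonneg p.1 s
      have := spanInd_nonneg p.2 s
      rw [Real.norm_of_nonneg (by positivity)]
  have hi2 := Integrable.mul_bddMeas (Integrable.mul_bddMeas hi hσ
    (measurable_fst.comp measurable_fst)) hσ (measurable_snd.comp measurable_fst)
  have := integral_kernel_eq_integral_sq (volume.restrict (Icc 0 L)) (spanMeasure L) spanInd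
    (fun s => ((s.2 - s.1) ^ 2)⁻¹) σ hi2
  simp only [spanKernel]
  rw [this]
  exact integral_nonneg fun s => by positivity

/-- Positivity of the energy with kernel `-log (max x y + 1)` on functions of mean zero. -/
lemma log_max_energy (L : ℝ) {σ : ℝ → ℝ} (hσ : BddMeas σ) (h0 : ∫ x in Icc 0 L, σ x = 0) :
    -∫ p : ℝ × ℝ, log (max p.1 p.2 + 1) * σ p.1 * σ p.2
      ∂((volume.restrict (Icc 0 L)).prod (volume.restrict (Icc 0 L)))
    = ∫ q in Icc 0 L, (q + 1)⁻¹ * (∫ x in Icc 0 L, (Iio q).indicator σ x) ^ 2 := by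
  let φ : ℝ → ℝ → ℝ := fun x q => (Iio q).indicator (fun _ => 1) x
  have hφm : Measurable (fun p : ℝ × ℝ => φ p.1 p.2) := by
    have : (fun p : ℝ × ℝ => φ p.1 p.2) = {p : ℝ × ℝ | p.1 < p.2}.indicator (fun _ => 1) := by
      ext p; simp [φ, indicator]
    rw [this]
    exact measurable_const.indicator (measurableSet_lt measurable_fst measurable_snd)
  have hφ0 : ∀ x q, 0 ≤ φ x q := fun x q => indicator_nonneg (fun _ _ => zero_le_one) _
  have hφ1 : ∀ x q, φ x q ≤ 1 := fun x q => indicator_le_self' (fun _ _ => zero_le_one) _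
  have hi : Integrable (fun p : (ℝ × ℝ) × ℝ => φ p.1.1 p.2 * φ p.1.2 p.2 * (p.2 + 1)⁻¹)
      (((volume.restrict (Icc 0 L)).prod (volume.restrict (Icc 0 L))).prod
        (volume.restrict (Icc 0 L))) := by
    have hm : Measurable (fun p : (ℝ × ℝ) × ℝ => φ p.1.1 p.2 * φ p.1.2 p.2 * (p.2 + 1)⁻¹) := by
      refine (Measurable.mul ?_ ?_).mul (by fun_prop)
      · exact hφm.comp ((measurable_fst.comp measurable_fst).prodMk measurable_snd)
      · exact hφm.comp ((measurable_snd.comp measurable_fst).prodMk measurable_snd)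
    refine Integrable.of_bound (C := 1) hm.aestronglyMeasurable ?_
    have : ∀ᵐ p : (ℝ × ℝ) × ℝ ∂(((volume.restrict (Icc 0 L)).prod (volume.restrict (Icc 0 L))).prod
        (volume.restrict (Icc 0 L))), p.2 ∈ Icc 0 L :=
      Measure.quasiMeasurePreserving_snd.ae (ae_restrict_mem measurableSet_Icc)
    filter_upwards [this] with p hp
    have h1 : 1 ≤ p.2 + 1 := by linarith [hp.1]
    rw [Real.norm_of_nonneg (mul_nonneg (mul_nonneg (hφ0 _ _) (hφ0 _ _)) (by positivity))]
    exact mul_le_one₀ (mul_le_one₀ (hφ1 _ _) (hφ0 _ _) (hφ1 _ _)) (by positivity)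
      (inv_le_one_of_one_le₀ h1)
  have hi2 := Integrable.mul_bddMeas (Integrable.mul_bddMeas hi hσ
    (measurable_fst.comp measurable_fst)) hσ (measurable_snd.comp measurable_fst)
  have key := integral_kernel_eq_integral_sq (volume.restrict (Icc 0 L)) (volume.restrict (Icc 0 L))
    φ (fun q => (q + 1)⁻¹) σ hi2
  have hφσ : ∀ x q, φ x q * σ x = (Iio q).indicator σ x := fun x q => by
    by_cases h : x ∈ Iio q <;> simp [φ, h]
  simp only [hφσ] at key
  rw [← key]
  -- The kernel log(L+1) - log(max x y + 1) is the integral of dq/(q+1) over q > max(x,y), hence a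
  -- superposition of products 1_{x<q} 1_{y<q}. The added constant is invisible to functions of mean
  -- zero.
  have hcomp : ∀ x y, x ∈ Icc 0 L → y ∈ Icc 0 L →
      ∫ q in Icc 0 L, φ x q * φ y q * (q + 1)⁻¹ = log (L + 1) - log (max x y + 1) := by
    intro x y hx hy
    have h1 : (fun q => φ x q * φ y q * (q + 1)⁻¹)
        = (Ioi (max x y)).indicator (fun q => (q + 1)⁻¹) := by
      ext q
      by_cases hq : max x y < q
      · have := max_lt_iff.1 hq
        simp [φ, this.1, this.2]
      · rw [indicator_of_notMem (by simpa using hq)]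
        rw [max_lt_iff, not_and_or] at hq
        rcases hq with hq | hq <;> simp [φ, hq]
    have hM0 : 0 ≤ max x y := hx.1.trans (le_max_left _ _)
    have hML : max x y ≤ L := max_le hx.2 hy.2
    have h2 : Ioi (max x y) ∩ Icc 0 L = Ioc (max x y) L := by
      ext q; simp only [mem_inter_iff, mem_Ioi, mem_Icc, mem_Ioc]
      exact ⟨fun h => ⟨h.1, h.2.2⟩, fun h => ⟨h.1, hM0.trans h.1.le, h.2⟩⟩
    rw [h1, integral_indicator measurableSet_Ioi, Measure.restrict_restrict measurableSet_Ioi, h2,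
      ← intervalIntegral.integral_of_le hML,
      intervalIntegral.integral_comp_add_right (fun t => t⁻¹),
      integral_inv_of_pos (by linarith) (by linarith), log_div (by linarith) (by linarith)]
  have hc : ∫ p : ℝ × ℝ, log (L + 1) * σ p.1 * σ p.2
      ∂((volume.restrict (Icc 0 L)).prod (volume.restrict (Icc 0 L))) = 0 := by
    have := integral_prod_mul (μ := volume.restrict (Icc 0 L)) (ν := volume.restrict (Icc 0 L)) σ σ
    simp only [mul_assoc]
    rw [integral_const_mul, this, h0]
    simp
  have i1 := Integrable.mul_bddMeas (Integrable.mul_bddMeas (integrable_log_max L) hσ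
    measurable_fst) hσ measurable_snd
  have i2 := Integrable.mul_bddMeas (Integrable.mul_bddMeas
    (integrable_const (μ := (volume.restrict (Icc 0 L)).prod (volume.restrict (Icc 0 L)))
      (log (L + 1))) hσ measurable_fst) hσ measurable_snd
  refine (zero_sub _).symm.trans ?_
  have hs := integral_sub i2 i1
  rw [hc] at hs
  rw [← hs]
  apply integral_congr_ae
  filter_upwards [ae_prod_ne L] with p ⟨h1, h2, _⟩
  rw [hcomp _ _ h1 h2]
  ring

lemma log_max_energy_nonneg (L : ℝ) {σ : ℝ → ℝ} (hσ : BddMeas σ)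
    (h0 : ∫ x in Icc 0 L, σ x = 0) :
    0 ≤ -∫ p : ℝ × ℝ, log (max p.1 p.2 + 1) * σ p.1 * σ p.2
      ∂((volume.restrict (Icc 0 L)).prod (volume.restrict (Icc 0 L))) := by
  rw [log_max_energy L hσ h0]
  refine setIntegral_nonneg measurableSet_Icc fun q hq => ?_
  have : 0 ≤ q + 1 := by linarith [hq.1]
  positivity

lemma measurePreserving_reflect (L : ℝ) : MeasurePreserving (fun x => L - x)
    (volume.restrict (Icc 0 L)) (volume.restrict (Icc 0 L)) := by
  have := (Measure.measurePreserving_sub_left volume L).restrict_preimage_emb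
    (MeasurableEquiv.subLeft L).measurableEmbedding (Icc 0 L)
  have e : (fun y => L - y) ⁻¹' Icc 0 L = Icc 0 L := by
    ext y; simp only [mem_preimage, mem_Icc]; constructor <;> intro h <;> constructor <;> linarith
  rwa [e] at this

lemma integral_reflect (L : ℝ) (f : ℝ → ℝ) :
    ∫ x in Icc 0 L, f (L - x) = ∫ x in Icc 0 L, f x :=
  (measurePreserving_reflect L).integral_comp (MeasurableEquiv.subLeft L).measurableEmbedding f

lemma BddMeas.reflect {f : ℝ → ℝ} (hf : BddMeas f) (L : ℝ) : BddMeas (fun x => f (L - x)) := by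
  obtain ⟨hf, C, hC⟩ := hf
  exact ⟨hf.comp (measurable_const.sub measurable_id), C, fun x => hC _⟩

/-- The reflection x ↦ L-x exchanges min and max, so this is the previous positivity for the
reflected function. -/
lemma log_min_energy_nonneg (L : ℝ) {σ : ℝ → ℝ} (hσ : BddMeas σ)
    (h0 : ∫ x in Icc 0 L, σ x = 0) :
    0 ≤ -∫ p : ℝ × ℝ, log (L + 1 - min p.1 p.2) * σ p.1 * σ p.2
      ∂((volume.restrict (Icc 0 L)).prod (volume.restrict (Icc 0 L))) := by
  have h := log_max_energy_nonneg L (hσ.reflect L) (by rw [integral_reflect L σ, h0])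
  have mp := (measurePreserving_reflect L).prod (measurePreserving_reflect L)
  have := mp.integral_comp
    ((MeasurableEquiv.subLeft L).prodCongr (MeasurableEquiv.subLeft L)).measurableEmbedding
    (fun p : ℝ × ℝ => log (max p.1 p.2 + 1) * σ (L - p.1) * σ (L - p.2))
  rw [← this] at h
  simp only [Prod.map_fst, Prod.map_snd, sub_sub_cancel] at h
  have e : ∀ x y : ℝ, max (L - x) (L - y) + 1 = L + 1 - min x y := fun x y => by
    rw [max_sub_sub_left]; ring
  simpa only [e] using h

/-- The logarithmic energy is negative semidefinite on functions of mean zero. -/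
lemma logEnergy_le {L : ℝ} {σ : ℝ → ℝ} (hσ : BddMeas σ) (h0 : ∫ x in Icc 0 L, σ x = 0) :
    logEnergy L σ σ ≤ ∫ p : ℝ × ℝ, log (max p.1 p.2 + 1) * σ p.1 * σ p.2
      ∂((volume.restrict (Icc 0 L)).prod (volume.restrict (Icc 0 L))) := by
  have h1 := spanKernel_energy_nonneg L hσ
  have h2 := log_min_energy_nonneg L hσ h0
  have hc : ∫ p : ℝ × ℝ, log (L + 2) * σ p.1 * σ p.2
      ∂((volume.restrict (Icc 0 L)).prod (volume.restrict (Icc 0 L))) = 0 := by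
    have := integral_prod_mul (μ := volume.restrict (Icc 0 L)) (ν := volume.restrict (Icc 0 L)) σ σ
    simp only [mul_assoc]
    rw [integral_const_mul, this, h0]
    simp
  have i0 := integrable_logEnergy L hσ hσ
  have i1 := Integrable.mul_bddMeas (Integrable.mul_bddMeas (integrable_log_max L) hσ
    measurable_fst) hσ measurable_snd
  have i2 := Integrable.mul_bddMeas (Integrable.mul_bddMeas (integrable_log_min L) hσ
    measurable_fst) hσ measurable_snd
  have i3 := Integrable.mul_bddMeas (Integrable.mul_bddMeas
    (integrable_const (μ := (volume.restrict (Icc 0 L)).prod (volume.restrict (Icc 0 L)))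
      (log (L + 2))) hσ measurable_fst) hσ measurable_snd
  -- Decomposition of -log|x-y| into `spanKernel`, a max term, a min term and a constant. The first
  -- is positive semidefinite, the min term is so on mean zero, and the constant drops out; only the
  -- max term is kept in the bound.
  have e : ∫ p : ℝ × ℝ, spanKernel L p.1 p.2 * σ p.1 * σ p.2
      ∂((volume.restrict (Icc 0 L)).prod (volume.restrict (Icc 0 L)))
      = (∫ p : ℝ × ℝ, log (max p.1 p.2 + 1) * σ p.1 * σ p.2
      ∂((volume.restrict (Icc 0 L)).prod (volume.restrict (Icc 0 L))))
      + (∫ p : ℝ × ℝ, log (L + 1 - min p.1 p.2) * σ p.1 * σ p.2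
      ∂((volume.restrict (Icc 0 L)).prod (volume.restrict (Icc 0 L))))
      - (∫ p : ℝ × ℝ, log (L + 2) * σ p.1 * σ p.2
      ∂((volume.restrict (Icc 0 L)).prod (volume.restrict (Icc 0 L)))) - logEnergy L σ σ := by
    rw [logEnergy, ← integral_add' i1 i2, ← integral_sub' (i1.add i2) i3,
      ← integral_sub' ((i1.add i2).sub i3) i0]
    apply integral_congr_ae
    filter_upwards [ae_prod_ne L] with p ⟨h1, h2, h3⟩
    rw [(spanKernel_eq h1 h2 h3).2]
    simp only [Pi.add_apply, Pi.sub_apply]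
    ring
  linarith

lemma logEnergy_nonpos {L : ℝ} {σ : ℝ → ℝ} (hσ : BddMeas σ) (h0 : ∫ x in Icc 0 L, σ x = 0) :
    logEnergy L σ σ ≤ 0 := by
  linarith [logEnergy_le hσ h0, log_max_energy_nonneg L hσ h0]

/-- The logarithmic energy is negative definite on functions of mean zero. -/
lemma ae_eq_zero_of_logEnergy_nonneg {L : ℝ} {σ : ℝ → ℝ} (hσ : BddMeas σ)
    (h0 : ∫ x in Icc 0 L, σ x = 0) (h : 0 ≤ logEnergy L σ σ) :
    ∀ᵐ x ∂(volume.restrict (Icc 0 L)), σ x = 0 := by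
  -- The max term alone gives definiteness: its energy is the integral of G²/(q+1). If that
  -- vanishes, G = 0 a.e., hence everywhere on [0,L] by continuity, and σ = G' a.e. by Lebesgue
  -- differentiation.
  set G : ℝ → ℝ := fun q => ∫ x in (0 : ℝ)..q, σ x with hG
  have hii : ∀ a b, IntervalIntegrable σ volume a b := fun a b => by
    exact ⟨hσ.integrable _, hσ.integrable _⟩
  have hcont : Continuous G := intervalIntegral.continuous_primitive hii 0
  have hGq : ∀ q ∈ Icc 0 L, ∫ x in Icc 0 L, (Iio q).indicator σ x = G q := fun q hq => by
    have e : Iio q ∩ Icc 0 L = Ico 0 q := by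
      ext x; simp only [mem_inter_iff, mem_Iio, mem_Icc, mem_Ico]
      exact ⟨fun h => ⟨h.2.1, h.1⟩, fun h => ⟨h.2, h.1, h.2.le.trans hq.2⟩⟩
    rw [integral_indicator measurableSet_Iio, Measure.restrict_restrict measurableSet_Iio, e]
    simp only [hG]
    rw [intervalIntegral.integral_of_le hq.1, Measure.restrict_congr_set Ico_ae_eq_Ioc]
  have hint : ∫ q in Icc 0 L, (q + 1)⁻¹ * (G q) ^ 2 = 0 := by
    have h1 := log_max_energy L hσ h0
    have h2 := logEnergy_le hσ h0
    have h3 := log_max_energy_nonneg L hσ h0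
    have h4 : ∫ q in Icc 0 L, (q + 1)⁻¹ * (G q) ^ 2
        = ∫ q in Icc 0 L, (q + 1)⁻¹ * (∫ x in Icc 0 L, (Iio q).indicator σ x) ^ 2 :=
      setIntegral_congr_fun measurableSet_Icc fun q hq => by simp only [hGq q hq]
    linarith
  have hcont2 : ContinuousOn (fun q => (q + 1)⁻¹ * (G q) ^ 2) (Icc 0 L) := by
    refine ContinuousOn.mul (ContinuousOn.inv₀ (by fun_prop) ?_) (by fun_prop)
    intro q hq h
    linarith [hq.1]
  have hae : G =ᵐ[volume.restrict (Icc 0 L)] fun _ => 0 := by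
    have hnn : 0 ≤ᵐ[volume.restrict (Icc 0 L)] fun q => (q + 1)⁻¹ * (G q) ^ 2 := by
      filter_upwards [ae_restrict_mem measurableSet_Icc] with q hq
      have h1 : 0 ≤ q + 1 := by linarith [hq.1]
      simp only [Pi.zero_apply]
      positivity
    have := (integral_eq_zero_iff_of_nonneg_ae hnn
      (hcont2.integrableOn_compact isCompact_Icc)).1 hint
    filter_upwards [this, ae_restrict_mem measurableSet_Icc] with q hq hq2
    have h1 : q + 1 ≠ 0 := by linarith [hq2.1]
    simpa [h1] using hq
  have hd : ∀ᵐ x, ∀ c, HasDerivAt (fun x => ∫ t in c..x, σ t) (σ x) x :=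
    LocallyIntegrable.ae_hasDerivAt_integral (by
      obtain ⟨hm, C, hC⟩ := hσ
      exact (locallyIntegrable_const C).mono hm.aestronglyMeasurable (ae_of_all _ fun x => by
        rw [Real.norm_eq_abs, Real.norm_eq_abs]
        exact (hC x).trans (le_abs_self C)))
  have hIoo : ∀ᵐ x ∂(volume.restrict (Icc 0 L)), x ∈ Ioo 0 L := by
    rw [← Measure.restrict_congr_set Ioo_ae_eq_Icc]
    exact ae_restrict_mem measurableSet_Ioo
  filter_upwards [hIoo, ae_restrict_of_ae hd] with x hx hdx
  have hzero := Measure.eqOn_Icc_of_ae_eq volume (hx.1.trans hx.2).ne hae hcont.continuousOn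
    continuousOn_const
  have h1 : G =ᶠ[nhds x] fun _ => 0 := by
    filter_upwards [Icc_mem_nhds hx.1 hx.2] with y hy using hzero hy
  exact ((hdx 0).congr_of_eventuallyEq h1.symm).unique (hasDerivAt_const x 0)

end

end CutHexagon

/-! ### Balayage of a point mass onto [a,b], and the potential of the resulting layer. -/

namespace CutHexagon

noncomputable section

open Real

/-- A parametrisation of the image of `[a, b]` under the inversion `x ↦ 1 / (x - y)`. -/
def invArc (a b y ψ : ℝ) : ℝ :=
  ((b - y)⁻¹ + (a - y)⁻¹) / 2 + ((a - y)⁻¹ - (b - y)⁻¹) / 2 * cos ψ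

/-- The point of `[a, b]` with angular parameter `ψ`; for uniform `ψ` its law is the balayage of the
point mass at `y` onto `[a, b]`. -/
def balPt (a b y ψ : ℝ) : ℝ := y + (invArc a b y ψ)⁻¹

lemma inv_lt_inv_of_notMem {a b y : ℝ} (hab : a < b) (hy : y < a ∨ b < y) :
    (b - y)⁻¹ < (a - y)⁻¹ := by
  rcases hy with hy | hy
  · exact (inv_lt_inv₀ (by linarith) (by linarith)).2 (by linarith)
  · exact (inv_lt_inv_of_neg (by linarith) (by linarith)).2 (by linarith)

lemma invArc_mem {a b y : ℝ} (hab : a < b) (hy : y < a ∨ b < y) (ψ : ℝ) :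
    invArc a b y ψ ∈ Icc (b - y)⁻¹ (a - y)⁻¹ := by
  have h := inv_lt_inv_of_notMem hab hy
  have h1 := neg_one_le_cos ψ
  have h2 := cos_le_one ψ
  unfold invArc
  constructor <;> nlinarith

lemma inv_mem_Icc_iff {a b y x : ℝ} (hab : a < b) (hy : y < a ∨ b < y) :
    x⁻¹ ∈ Icc (b - y)⁻¹ (a - y)⁻¹ ↔ y + x ∈ Icc a b := by
  rcases hy with hy | hy
  · rcases le_or_gt x 0 with hx | hx
    · have h1 : x⁻¹ ≤ 0 := inv_nonpos.2 hx
      have h2 : 0 < (b - y)⁻¹ := inv_pos.2 (by linarith)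
      constructor
      · intro h; linarith [h.1]
      · intro h; linarith [h.1]
    · simp only [mem_Icc]
      rw [inv_le_inv₀ (by linarith) hx, inv_le_inv₀ hx (by linarith)]
      constructor <;> rintro ⟨h1, h2⟩ <;> constructor <;> linarith
  · rcases le_or_gt 0 x with hx | hx
    · have h1 : 0 ≤ x⁻¹ := inv_nonneg.2 hx
      have h2 : (a - y)⁻¹ < 0 := inv_lt_zero.2 (by linarith)
      constructor
      · intro h; linarith [h.2]
      · intro h; linarith [h.2]
    · simp only [mem_Icc]
      rw [inv_le_inv_of_neg (by linarith) hx, inv_le_inv_of_neg hx (by linarith)]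
      constructor <;> rintro ⟨h1, h2⟩ <;> constructor <;> linarith

lemma invArc_ne_zero {a b y : ℝ} (hab : a < b) (hy : y < a ∨ b < y) (ψ : ℝ) :
    invArc a b y ψ ≠ 0 := by
  have h := invArc_mem hab hy ψ
  rcases hy with hy | hy
  · have : 0 < (b - y)⁻¹ := inv_pos.2 (by linarith)
    exact (this.trans_le h.1).ne'
  · have : (a - y)⁻¹ < 0 := inv_lt_zero.2 (by linarith)
    exact (h.2.trans_lt this).ne

lemma balPt_mem {a b y : ℝ} (hab : a < b) (hy : y < a ∨ b < y) (ψ : ℝ) :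
    balPt a b y ψ ∈ Icc a b := by
  rw [balPt, ← inv_mem_Icc_iff hab hy, inv_inv]
  exact invArc_mem hab hy ψ

lemma measurable_balPt (a b y : ℝ) : Measurable (balPt a b y) := by
  unfold balPt invArc
  fun_prop

/-- On [a,b] the inversion x ↦ 1/(x-y) is decreasing whether y lies to the left or to the right,
because x-y keeps a constant sign there. -/
lemma lt_balPt_iff {a b y z : ℝ} (hab : a < b) (hy : y < a ∨ b < y) (hz : z ∈ Icc a b) (ψ : ℝ) :
    z < balPt a b y ψ ↔ invArc a b y ψ < (z - y)⁻¹ := by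
  have h := invArc_mem hab hy ψ
  rw [balPt]
  rcases hy with hy | hy
  · have h0 : 0 < invArc a b y ψ := lt_of_lt_of_le (inv_pos.2 (by linarith)) h.1
    rw [lt_inv_comm₀ h0 (by linarith [hz.1])]
    constructor <;> intro h <;> linarith
  · have h0 : invArc a b y ψ < 0 := lt_of_le_of_lt h.2 (inv_lt_zero.2 (by linarith))
    have h1 : z - y < 0 := by linarith [hz.2]
    rw [lt_inv_of_neg h0 h1]
    constructor <;> intro h <;> linarith

/-- The mass that the balayage of the point mass at `y` onto `[a, b]` gives to `(z, ∞)`. -/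
def balTail (a b y z : ℝ) : ℝ :=
  if z ≤ a then 1 else if b ≤ z then 0 else
    2 / π * arctan (√((b - z) / (z - a)) * √((y - a) / (y - b)))

lemma ratio_pos {a b y : ℝ} (hab : a < b) (hy : y < a ∨ b < y) : 0 < (y - a) / (y - b) := by
  rcases hy with hy | hy
  · exact div_pos_of_neg_of_neg (by linarith) (by linarith)
  · exact div_pos (by linarith) (by linarith)

lemma cos_two_mul_arctan_eq {x : ℝ} : cos (2 * arctan x) = (1 - x ^ 2) / (1 + x ^ 2) := by
  rw [cos_two_mul, cos_sq_arctan]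
  have : 1 + x ^ 2 ≠ 0 := by positivity
  field_simp
  ring

lemma intervalIntegral_indicator_lt_cos {φ : ℝ} (hφ : φ ∈ Icc 0 π) :
    ∫ ψ in (0 : ℝ)..π, (if cos ψ < -cos φ then (1 : ℝ) else 0) = φ := by
  have h1 : ∀ ψ ∈ Ioc 0 π, (if cos ψ < -cos φ then (1 : ℝ) else 0)
      = (Ioc (π - φ) π).indicator (fun _ => 1) ψ := by
    intro ψ hψ
    have h2 : π - φ ∈ Icc 0 π := ⟨by linarith [hφ.2], by linarith [hφ.1]⟩
    have h3 : cos ψ < cos (π - φ) ↔ π - φ < ψ :=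
      strictAntiOn_cos.lt_iff_gt ⟨hψ.1.le, hψ.2⟩ h2
    simp only [← cos_pi_sub, h3]
    by_cases h : π - φ < ψ
    · rw [if_pos h, indicator_of_mem (show ψ ∈ Ioc (π - φ) π from ⟨h, hψ.2⟩)]
    · rw [if_neg h, indicator_of_notMem (fun h' : ψ ∈ Ioc (π - φ) π => h h'.1)]
  rw [intervalIntegral.integral_of_le pi_pos.le, setIntegral_congr_fun measurableSet_Ioc h1,
    setIntegral_indicator measurableSet_Ioc]
  have : Ioc 0 π ∩ Ioc (π - φ) π = Ioc (π - φ) π :=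
    inter_eq_right.2 (Ioc_subset_Ioc (by linarith [hφ.2]) le_rfl)
  rw [this]
  simp [hφ.1]

/-- The event z < `balPt` is cos ψ < -cos(2 arctan t), where t is the argument of the arctangent in
`balTail`; among ψ in (0,π) this set has length 2 arctan t. -/
lemma balTail_eq {a b y z : ℝ} (hab : a < b) (hy : y < a ∨ b < y) (hz : z ≠ a) :
    balTail a b y z = π⁻¹ * ∫ ψ in (0 : ℝ)..π, (if z < balPt a b y ψ then (1 : ℝ) else 0) := by
  unfold balTail
  have hpi := pi_ne_zero
  split_ifs with h1 h2
  · have : ∀ ψ, z < balPt a b y ψ := fun ψ => (lt_of_le_of_ne h1 hz).trans_le (balPt_mem hab hy ψ).1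
    simp [this, hpi]
  · have : ∀ ψ, ¬ z < balPt a b y ψ := fun ψ => not_lt.2 ((balPt_mem hab hy ψ).2.trans h2)
    simp [this]
  · push Not at h1 h2
    set t := √((b - z) / (z - a)) * √((y - a) / (y - b)) with ht
    have ht0 : 0 ≤ t := by positivity
    have ht2 : t ^ 2 = (b - z) / (z - a) * ((y - a) / (y - b)) := by
      rw [ht, mul_pow, sq_sqrt (div_pos (by linarith) (by linarith)).le,
        sq_sqrt (ratio_pos hab hy).le]
    have hφ : 2 * arctan t ∈ Icc 0 π :=
      ⟨by linarith [arctan_nonneg.2 ht0], by linarith [arctan_lt_pi_div_two t]⟩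
    have hza : 0 < z - a := by linarith
    have hbz : 0 < b - z := by linarith
    have hlt := inv_lt_inv_of_notMem hab hy
    have key : ∀ ψ, z < balPt a b y ψ ↔ cos ψ < -cos (2 * arctan t) := by
      intro ψ
      rw [lt_balPt_iff hab hy ⟨h1.le, h2.le⟩, cos_two_mul_arctan_eq, ht2]
      have e : ((z - y)⁻¹ - ((b - y)⁻¹ + (a - y)⁻¹) / 2) / (((a - y)⁻¹ - (b - y)⁻¹) / 2)
          = -((1 - (b - z) / (z - a) * ((y - a) / (y - b)))
            / (1 + (b - z) / (z - a) * ((y - a) / (y - b)))) := by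
        have n1 : z - y ≠ 0 := by rcases hy with hy | hy <;> intro h <;> linarith
        have n2 : b - y ≠ 0 := by rcases hy with hy | hy <;> intro h <;> linarith
        have n3 : a - y ≠ 0 := by rcases hy with hy | hy <;> intro h <;> linarith
        have n4 : y - b ≠ 0 := by intro h; apply n2; linarith
        have n5 : ((a - y)⁻¹ - (b - y)⁻¹) / 2 ≠ 0 := by linarith
        have n6 : 1 + (b - z) / (z - a) * ((y - a) / (y - b)) ≠ 0 := by
          have := mul_pos (div_pos hbz hza) (ratio_pos hab hy)
          linarith
        rw [← neg_div, div_eq_div_iff n5 n6]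
        have n7 := hza.ne'
        field_simp
        ring
      rw [← e, lt_div_iff₀ (by linarith), invArc]
      constructor <;> intro h <;> linarith
    simp only [key]
    rw [intervalIntegral_indicator_lt_cos hφ]
    field_simp

lemma measurable_balTail (a b y : ℝ) : Measurable (balTail a b y) := by
  unfold balTail
  refine Measurable.ite measurableSet_Iic measurable_const
    (Measurable.ite measurableSet_Ici measurable_const ?_)
  fun_prop

/-- The signed layer: `δ_y` minus its balayage onto `[a, b]`, integrated over `(-∞, z]`. -/
def layer (a b y z : ℝ) : ℝ := balTail a b y z - (if z < y then 1 else 0)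

lemma balTail_nonneg (a b y z : ℝ) : 0 ≤ balTail a b y z := by
  unfold balTail
  split_ifs
  · exact zero_le_one
  · exact le_rfl
  · have := arctan_nonneg.2 (by positivity : 0 ≤ √((b - z) / (z - a)) * √((y - a) / (y - b)))
    positivity

lemma balTail_le_one (a b y z : ℝ) : balTail a b y z ≤ 1 := by
  unfold balTail
  split_ifs
  · exact le_rfl
  · exact zero_le_one
  · have := arctan_lt_pi_div_two (√((b - z) / (z - a)) * √((y - a) / (y - b)))
    rw [div_mul_eq_mul_div, div_le_one pi_pos]
    linarith

lemma bddMeas_layer (a b y : ℝ) : BddMeas (layer a b y) := by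
  refine BddMeas.sub (BddMeas.of_unit (measurable_balTail a b y) (balTail_nonneg a b y)
    (balTail_le_one a b y)) (BddMeas.of_unit (Measurable.ite measurableSet_Iio measurable_const
      measurable_const) (fun x => ?_) (fun x => ?_))
  · split_ifs <;> norm_num
  · split_ifs <;> norm_num

lemma integral_ite_lt (f : ℝ → ℝ) {L u : ℝ} (hu : u ∈ Icc 0 L) :
    ∫ z in Icc 0 L, f z * (if z < u then 1 else 0) = ∫ z in (0 : ℝ)..u, f z := by
  have e1 : ∀ z, f z * (if z < u then 1 else 0) = (Iio u).indicator f z := fun z => by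
    by_cases h : z < u <;> simp [h]
  have e : Iio u ∩ Icc 0 L = Ico 0 u := by
    ext x; simp only [mem_inter_iff, mem_Iio, mem_Icc, mem_Ico]
    exact ⟨fun h => ⟨h.2.1, h.1⟩, fun h => ⟨h.2, h.1, h.2.le.trans hu.2⟩⟩
  simp only [e1]
  rw [integral_indicator measurableSet_Iio, Measure.restrict_restrict measurableSet_Iio, e,
    intervalIntegral.integral_of_le hu.1, Measure.restrict_congr_set Ico_ae_eq_Ioc]

/-- Layer-cake formula for integrals against `layer`. -/
lemma integral_mul_layer {a b y L : ℝ} (hab : a < b) (hy : y < a ∨ b < y) (ha : 0 ≤ a) (hb : b ≤ L)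
    (hyL : y ∈ Icc 0 L) {f : ℝ → ℝ} (hf : Integrable f (volume.restrict (Icc 0 L))) :
    ∫ z in Icc 0 L, f z * layer a b y z
      = π⁻¹ * ∫ ψ in (0 : ℝ)..π, ∫ z in y..balPt a b y ψ, f z := by
  -- An oriented integral from y to u is an integral against a difference of indicators; averaging
  -- over u = `balPt` and exchanging the integrals produces `layer`.
  have hsplit : ∀ u ∈ Icc 0 L, ∫ z in y..u, f z
      = ∫ z in Icc 0 L, f z * ((if z < u then 1 else 0) - (if z < y then 1 else 0)) := by
    intro u hu
    have hi : ∀ w ∈ Icc 0 L, IntervalIntegrable f volume 0 w := fun w hw => by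
      rw [intervalIntegrable_iff_integrableOn_Icc_of_le hw.1]
      exact IntegrableOn.mono_set hf (Icc_subset_Icc le_rfl hw.2)
    have hi2 : ∀ w : ℝ, Integrable (fun z => f z * (if z < w then 1 else 0))
        (volume.restrict (Icc 0 L)) := fun w => by
      refine hf.mul_bdd (c := 1) (Measurable.aestronglyMeasurable
        (Measurable.ite measurableSet_Iio measurable_const measurable_const))
        (ae_of_all _ fun z => ?_)
      split_ifs <;> norm_num
    simp only [mul_sub]
    rw [integral_sub (hi2 u) (hi2 y), integral_ite_lt f hu, integral_ite_lt f hyL,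
      intervalIntegral.integral_interval_sub_left (hi u hu) (hi y hyL)]
  have hbal : ∀ ψ, balPt a b y ψ ∈ Icc 0 L := fun ψ =>
    ⟨ha.trans (balPt_mem hab hy ψ).1, (balPt_mem hab hy ψ).2.trans hb⟩
  have hm : Measurable (fun p : ℝ × ℝ => (if p.1 < balPt a b y p.2 then (1 : ℝ) else 0)
      - (if p.1 < y then 1 else 0)) := by
    refine (Measurable.ite (measurableSet_lt measurable_fst ?_) measurable_const
      measurable_const).sub (Measurable.ite (measurableSet_lt measurable_fst measurable_const)
        measurable_const measurable_const)
    exact (measurable_balPt a b y).comp measurable_snd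
  have hint : Integrable (fun p : ℝ × ℝ => f p.1 * ((if p.1 < balPt a b y p.2 then (1 : ℝ) else 0)
      - (if p.1 < y then 1 else 0)))
      ((volume.restrict (Icc 0 L)).prod (volume.restrict (Ioc 0 π))) := by
    refine (hf.comp_fst _).mul_bdd (c := 1) hm.aestronglyMeasurable (ae_of_all _ fun p => ?_)
    split_ifs <;> norm_num
  simp only [hsplit _ (hbal _)]
  rw [intervalIntegral.integral_of_le pi_pos.le, ← integral_integral_swap hint, ← integral_const_mul]
  apply integral_congr_ae
  filter_upwards [(countable_singleton a).ae_notMem (volume.restrict (Icc 0 L))] with z hz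
  rw [integral_const_mul, layer, balTail_eq hab hy hz, intervalIntegral.integral_of_le pi_pos.le,
    integral_sub]
  · rw [MeasureTheory.integral_const, measureReal_restrict_apply_univ,
      Real.volume_real_Ioc_of_le pi_pos.le, sub_zero, smul_eq_mul]
    have hpi := inv_mul_cancel₀ pi_ne_zero
    linear_combination (f z * (if z < y then 1 else 0)) * hpi
  · refine Integrable.of_bound (C := 1) (Measurable.aestronglyMeasurable
      (Measurable.ite (measurableSet_lt measurable_const (measurable_balPt a b y)) measurable_const
        measurable_const)) (ae_of_all _ fun p => ?_)
    split_ifs <;> norm_num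
  · exact integrable_const _

lemma cos_ne_ae (c : ℝ) : ∀ᵐ ψ ∂(volume.restrict (Ioc 0 π)), cos ψ ≠ c := by
  have hs : ({ψ | cos ψ = c} ∩ Ioc 0 π).Subsingleton := by
    rintro x ⟨hx, hx1, hx2⟩ y ⟨hy, hy1, hy2⟩
    exact injOn_cos ⟨hx1.le, hx2⟩ ⟨hy1.le, hy2⟩ (Eq.trans hx hy.symm)
  rw [ae_restrict_iff' measurableSet_Ioc]
  filter_upwards [hs.countable.ae_notMem volume] with ψ h h1 h2 using h ⟨h2, h1⟩

lemma balPt_ne_ae {a b y : ℝ} (hab : a < b) (hy : y < a ∨ b < y) (t : ℝ) :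
    ∀ᵐ ψ ∂(volume.restrict (Ioc 0 π)), invArc a b y ψ ≠ t := by
  have h := inv_lt_inv_of_notMem hab hy
  filter_upwards [cos_ne_ae ((t - ((b - y)⁻¹ + (a - y)⁻¹) / 2) / (((a - y)⁻¹ - (b - y)⁻¹) / 2))]
    with ψ hψ h1
  apply hψ
  rw [eq_div_iff (by linarith), ← h1, invArc]
  ring

/-- The potential of the balayage of `δ_y`, by inversion. -/
lemma integral_log_balPt {a b y t : ℝ} (hab : a < b) (hy : y < a ∨ b < y) (ht : t ≠ y) :
    π⁻¹ * ∫ ψ in (0 : ℝ)..π, log |balPt a b y ψ - t|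
      = log |t - y| + arcPot (b - y)⁻¹ (a - y)⁻¹ (t - y)⁻¹ - arcPot (b - y)⁻¹ (a - y)⁻¹ 0 := by
  have h := inv_lt_inv_of_notMem hab hy
  have i1 := arcPot_intervalIntegrable h (t - y)⁻¹
  have i2 := arcPot_intervalIntegrable h 0
  -- With v = `invArc`, balPt - t = y + 1/v - t, so |balPt - t| = |t-y| · |1/(t-y) - v| / |v|. The
  -- last two factors integrate to arcsine potentials.
  have e : ∫ ψ in (0 : ℝ)..π, log |balPt a b y ψ - t| = ∫ ψ in (0 : ℝ)..π,
      (log |t - y| + log |(t - y)⁻¹ - (((b - y)⁻¹ + (a - y)⁻¹) / 2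
        + ((a - y)⁻¹ - (b - y)⁻¹) / 2 * cos ψ)| - log |0 - (((b - y)⁻¹ + (a - y)⁻¹) / 2
        + ((a - y)⁻¹ - (b - y)⁻¹) / 2 * cos ψ)|) := by
    rw [intervalIntegral.integral_of_le pi_pos.le, intervalIntegral.integral_of_le pi_pos.le]
    apply integral_congr_ae
    filter_upwards [balPt_ne_ae hab hy (t - y)⁻¹] with ψ hψ
    have h0 := invArc_ne_zero hab hy ψ
    have hty : t - y ≠ 0 := sub_ne_zero.2 ht
    have h1 : (t - y)⁻¹ - invArc a b y ψ ≠ 0 := sub_ne_zero.2 hψ.symm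
    have h2 : 0 - invArc a b y ψ ≠ 0 := by simpa using h0
    rw [abs_sub_comm]
    change _ = log |t - y| + log |(t - y)⁻¹ - invArc a b y ψ| - log |0 - invArc a b y ψ|
    simp only [log_abs]
    rw [← log_mul hty h1, ← log_div (mul_ne_zero hty h1) h2]
    congr 1
    rw [balPt]
    generalize invArc a b y ψ = v at *
    have : -v ≠ 0 := neg_ne_zero.2 h0
    rw [zero_sub]
    field_simp
    ring
  rw [e, intervalIntegral.integral_sub (intervalIntegrable_const.add i1) i2,
    intervalIntegral.integral_add intervalIntegrable_const i1, intervalIntegral.integral_const,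
    arcPot, arcPot]
  have hpi := mul_inv_cancel₀ pi_ne_zero
  simp only [smul_eq_mul]
  linear_combination (log |t - y|) * hpi

/-- The derivative of the logarithmic potential of `layer`. -/
def layerForce (a b y t : ℝ) : ℝ :=
  arcPot (b - y)⁻¹ (a - y)⁻¹ 0 - arcPot (b - y)⁻¹ (a - y)⁻¹ (t - y)⁻¹

/-- By the layer-cake formula the potential is an average of L₀(x-y) - L₀(x-u) over u = `balPt`,
whose x-derivative is log|x-y| - log|x-u|. The integrated form avoids differentiating at the
singularity x = y and at the endpoints. -/
lemma logPot_layer_sub {a b y L x₁ x₂ : ℝ} (hab : a < b) (hy : y < a ∨ b < y) (ha : 0 ≤ a)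
    (hb : b ≤ L) (hyL : y ∈ Icc 0 L) (h1 : 0 ≤ x₁) (h12 : x₁ ≤ x₂) (h2 : x₂ ≤ L) :
    IntervalIntegrable (layerForce a b y) volume x₁ x₂ ∧
    logPot L (layer a b y) x₂ - logPot L (layer a b y) x₁
      = ∫ t in x₁..x₂, layerForce a b y t := by
  have hbal : ∀ ψ, balPt a b y ψ ∈ Icc 0 L := fun ψ =>
    ⟨ha.trans (balPt_mem hab hy ψ).1, (balPt_mem hab hy ψ).2.trans hb⟩
  have hsub : Ioc x₁ x₂ ⊆ Icc 0 L := fun t ht => ⟨h1.trans ht.1.le, ht.2.trans h2⟩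
  have hI : Integrable (fun p : ℝ × ℝ => log |balPt a b y p.1 - p.2|)
      ((volume.restrict (Ioc 0 π)).prod (volume.restrict (Ioc x₁ x₂))) := by
    have := integrable_log_abs_sub (volume.restrict (Ioc 0 π)) (measurable_balPt a b y)
      (ae_of_all _ hbal)
    exact this.mono_measure (Measure.prod_mono le_rfl (Measure.restrict_mono hsub le_rfl))
  have hly : IntervalIntegrable (fun t => log |y - t|) volume x₁ x₂ := by
    rw [intervalIntegrable_iff_integrableOn_Icc_of_le h12]
    exact integrableOn_log_abs_sub y x₁ x₂
  have hforce : ∀ᵐ t ∂volume, t ∈ Ioc x₁ x₂ → layerForce a b y t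
      = log |y - t| - π⁻¹ * ∫ ψ in (0 : ℝ)..π, log |balPt a b y ψ - t| := by
    filter_upwards [(countable_singleton y).ae_notMem volume] with t ht _
    rw [integral_log_balPt hab hy ht, layerForce, abs_sub_comm y]
    ring
  have hI2 : IntervalIntegrable (fun t => π⁻¹ * ∫ ψ in (0 : ℝ)..π, log |balPt a b y ψ - t|)
      volume x₁ x₂ := by
    simp only [intervalIntegral.integral_of_le pi_pos.le]
    rw [intervalIntegrable_iff_integrableOn_Ioc_of_le h12]
    exact hI.integral_prod_right.const_mul _
  refine ⟨(hly.sub hI2).congr_ae ?_, ?_⟩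
  · rw [uIoc_of_le h12]
    rw [Filter.EventuallyEq, ae_restrict_iff' measurableSet_Ioc]
    filter_upwards [hforce] with t ht h using (ht h).symm
  · have hN : ∀ x, logPot L (layer a b y) x
        = π⁻¹ * ∫ ψ in (0 : ℝ)..π, (L0 (x - y) - L0 (x - balPt a b y ψ)) := fun x => by
      rw [logPot, integral_mul_layer hab hy ha hb hyL (integrableOn_log_abs_sub x 0 L)]
      simp only [intervalIntegral_log_abs_sub]
    have hc : Continuous L0 := by
      unfold L0
      exact continuous_mul_log.sub continuous_id
    have hbi : ∀ x, IntervalIntegrable (fun ψ => L0 (x - y) - L0 (x - balPt a b y ψ)) volume 0 π := by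
      intro x
      obtain ⟨C, hC⟩ := (isCompact_Icc (a := x - L) (b := x)).exists_bound_of_continuousOn
        hc.continuousOn
      refine intervalIntegrable_const.sub ?_
      rw [intervalIntegrable_iff_integrableOn_Ioc_of_le pi_pos.le]
      refine Integrable.of_bound (C := C) (hc.measurable.comp
        (measurable_const.sub (measurable_balPt a b y))).aestronglyMeasurable (ae_of_all _ fun ψ => ?_)
      exact hC _ ⟨by linarith [(hbal ψ).2], by linarith [(hbal ψ).1]⟩
    have hdiff : ∀ u, L0 (x₂ - u) - L0 (x₁ - u) = ∫ t in x₁..x₂, log |u - t| := fun u => by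
      rw [intervalIntegral_log_abs_sub, L0, L0, L0, L0, ← neg_sub u x₁, ← neg_sub u x₂,
        log_neg_eq_log, log_neg_eq_log]
      ring
    rw [hN, hN, ← mul_sub, ← intervalIntegral.integral_sub (hbi x₂) (hbi x₁)]
    have e1 : ∀ ψ, (L0 (x₂ - y) - L0 (x₂ - balPt a b y ψ)) - (L0 (x₁ - y) - L0 (x₁ - balPt a b y ψ))
        = (∫ t in x₁..x₂, log |y - t|) - ∫ t in x₁..x₂, log |balPt a b y ψ - t| := fun ψ => by
      rw [← hdiff, ← hdiff]; ring
    simp only [e1]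
    have e2 : ∫ t in x₁..x₂, layerForce a b y t
        = ∫ t in x₁..x₂, (log |y - t| - π⁻¹ * ∫ ψ in (0 : ℝ)..π, log |balPt a b y ψ - t|) := by
      apply intervalIntegral.integral_congr_ae
      rw [uIoc_of_le h12]
      exact hforce
    have hI3 : IntervalIntegrable (fun ψ => ∫ t in x₁..x₂, log |balPt a b y ψ - t|) volume 0 π := by
      simp only [intervalIntegral.integral_of_le h12]
      rw [intervalIntegrable_iff_integrableOn_Ioc_of_le pi_pos.le]
      exact hI.integral_prod_left
    rw [e2, intervalIntegral.integral_sub hly hI2,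
      intervalIntegral.integral_sub intervalIntegrable_const hI3, intervalIntegral.integral_const,
      intervalIntegral.integral_const_mul]
    have e3 : ∫ ψ in (0 : ℝ)..π, ∫ t in x₁..x₂, log |balPt a b y ψ - t|
        = ∫ t in x₁..x₂, ∫ ψ in (0 : ℝ)..π, log |balPt a b y ψ - t| := by
      simp only [intervalIntegral.integral_of_le h12, intervalIntegral.integral_of_le pi_pos.le]
      exact integral_integral_swap hI
    rw [e3]
    have hpi := mul_inv_cancel₀ pi_ne_zero
    simp only [smul_eq_mul]
    linear_combination (∫ t in x₁..x₂, log |y - t|) * hpi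

end

end CutHexagon

/-! ### Explicit force and total mass of a layer. -/

namespace CutHexagon

noncomputable section

open Real

lemma abs_sub_pos_of_notMem {a b y : ℝ} (hab : a < b) (hy : y < a ∨ b < y) :
    0 < |y - a| ∧ 0 < |y - b| ∧
      (a - y)⁻¹ - (b - y)⁻¹ = (b - a) / (√|y - a| * √|y - b|) ^ 2 := by
  have h1 : y - a ≠ 0 := by rcases hy with hy | hy <;> intro h <;> linarith
  have h2 : y - b ≠ 0 := by rcases hy with hy | hy <;> intro h <;> linarith
  refine ⟨abs_pos.2 h1, abs_pos.2 h2, ?_⟩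
  rw [mul_pow, sq_sqrt (abs_nonneg _), sq_sqrt (abs_nonneg _), ← abs_mul, abs_of_pos]
  · have h3 : a - y ≠ 0 := by intro h; apply h1; linarith
    have h4 : b - y ≠ 0 := by intro h; apply h2; linarith
    field_simp
    ring
  · rcases hy with hy | hy
    · exact mul_pos_of_neg_of_neg (by linarith) (by linarith)
    · exact mul_pos (by linarith) (by linarith)

lemma arcPot_inv_zero {a b y : ℝ} (hab : a < b) (hy : y < a ∨ b < y) :
    arcPot (b - y)⁻¹ (a - y)⁻¹ 0
      = 2 * log ((√|y - a| + √|y - b|) / (2 * (√|y - a| * √|y - b|))) := by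
  obtain ⟨h1, h2, -⟩ := abs_sub_pos_of_notMem hab hy
  have h0 : 0 ≤ (b - y)⁻¹ ∨ (a - y)⁻¹ ≤ 0 := by
    rcases hy with hy | hy
    · exact Or.inl (inv_nonneg.2 (by linarith))
    · exact Or.inr (inv_nonpos.2 (by linarith))
  rw [arcPot_outside (inv_lt_inv_of_notMem hab hy) h0, zero_sub, zero_sub, abs_neg, abs_neg,
    abs_inv, abs_inv, sqrt_inv, sqrt_inv, abs_sub_comm b, abs_sub_comm a]
  have h3 := sqrt_pos.2 h1
  have h4 := sqrt_pos.2 h2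
  congr 2
  field_simp

/-- On `[a, b]` the force of a layer is constant. -/
lemma layerForce_inside {a b y t : ℝ} (hab : a < b) (hy : y < a ∨ b < y) (ht : t ∈ Icc a b) :
    layerForce a b y t = 2 * log (√|y - a| + √|y - b|) - log (b - a) := by
  obtain ⟨h1, h2, h5⟩ := abs_sub_pos_of_notMem hab hy
  have h3 := sqrt_pos.2 h1
  have h4 := sqrt_pos.2 h2
  have hba : 0 < b - a := by linarith
  rw [layerForce, arcPot_inv_zero hab hy, arcPot_inside (inv_lt_inv_of_notMem hab hy)
    ((inv_mem_Icc_iff hab hy).2 (by simpa using ht)), h5]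
  generalize √|y - a| = X at *
  generalize √|y - b| = Y at *
  rw [log_div (by positivity) (by positivity), log_div (by positivity) (by norm_num),
    log_div (by positivity) (by positivity), log_pow, log_mul (by norm_num) (by positivity),
    (by norm_num : (4 : ℝ) = 2 ^ 2), log_pow]
  push_cast
  ring

/-- Off `[a, b]` the force of a layer is governed by the Green function of the complement. -/
lemma layerForce_outside {a b y t : ℝ} (hab : a < b) (hy : y < a ∨ b < y) (ht : t < a ∨ b < t)
    (hty : t ≠ y) :
    layerForce a b y t = 2 * log (√|y - a| + √|y - b|)
      - 2 * log (√(|b - t| * (|y - a| / |t - y|)) + √(|a - t| * (|y - b| / |t - y|))) := by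
  obtain ⟨h1, h2, -⟩ := abs_sub_pos_of_notMem hab hy
  have h3 := sqrt_pos.2 h1
  have h4 := sqrt_pos.2 h2
  have hα := inv_lt_inv_of_notMem hab hy
  have hmem : ¬ (t - y)⁻¹ ∈ Icc (b - y)⁻¹ (a - y)⁻¹ := by
    rw [inv_mem_Icc_iff hab hy, add_sub_cancel]
    rcases ht with ht | ht
    · exact fun h => not_le.2 ht h.1
    · exact fun h => not_le.2 ht h.2
  have hout : (t - y)⁻¹ ≤ (b - y)⁻¹ ∨ (a - y)⁻¹ ≤ (t - y)⁻¹ := by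
    by_contra hcon
    push Not at hcon
    exact hmem ⟨hcon.1.le, hcon.2.le⟩
  have hty' : 0 < |t - y| := abs_pos.2 (sub_ne_zero.2 hty)
  have hbt : 0 < |b - t| := abs_pos.2 (by rcases ht with ht | ht <;> intro h <;> linarith)
  have hat : 0 < |a - t| := abs_pos.2 (by rcases ht with ht | ht <;> intro h <;> linarith)
  have e1 : ∀ c, 0 < |y - c| → |(t - y)⁻¹ - (c - y)⁻¹| = |c - t| / (|t - y| * |y - c|) := by
    intro c hc
    have n1 : t - y ≠ 0 := sub_ne_zero.2 hty
    have n2 : c - y ≠ 0 := by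
      rw [abs_sub_comm] at hc
      exact abs_pos.1 hc
    rw [abs_sub_comm y c, ← abs_mul, ← abs_div]
    congr 1
    field_simp
    ring
  rw [layerForce, arcPot_inv_zero hab hy, arcPot_outside hα hout, e1 b h2, e1 a h1]
  rw [sqrt_div (abs_nonneg _), sqrt_div (abs_nonneg _), sqrt_mul (abs_nonneg _),
    sqrt_mul (abs_nonneg _), sqrt_mul (abs_nonneg _), sqrt_mul (abs_nonneg _),
    sqrt_div (abs_nonneg _), sqrt_div (abs_nonneg _)]
  have h5 := sqrt_pos.2 hty'
  have h6 := sqrt_pos.2 hbt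
  have h7 := sqrt_pos.2 hat
  generalize √|y - a| = X at *
  generalize √|y - b| = Y at *
  generalize √|t - y| = T at *
  generalize √|b - t| = P at *
  generalize √|a - t| = Q at *
  have e2 : (P / (T * Y) + Q / (T * X)) / 2 = (P * (X / T) + Q * (Y / T)) / (2 * (X * Y)) := by
    field_simp
  rw [e2, log_div (by positivity) (by positivity), log_div (by positivity) (by positivity)]
  ring

/-- The half-angle substitution: the primitive is a multiple of arctan(r tan(ψ/2)) with r = √(α/β).
-/
lemma integral_inv_add_cos {α β : ℝ} (hα : 0 < α) (hαβ : α < β) :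
    ∫ ψ in (0 : ℝ)..π, ((α + β) / 2 + (β - α) / 2 * cos ψ)⁻¹ = π / √(α * β) := by
  have hβ : 0 < β := hα.trans hαβ
  set r := √(α / β) with hr
  have hr0 : 0 < r := sqrt_pos.2 (div_pos hα hβ)
  have hr2 : r ^ 2 = α / β := sq_sqrt (div_pos hα hβ).le
  have hs : √(α * β) = β * r := by
    rw [hr, sqrt_mul hα.le, sqrt_div hα.le]
    have := sq_sqrt hβ.le
    have h0 := (sqrt_pos.2 hβ).ne'
    field_simp
    rw [this]
  have hpos : ∀ ψ, 0 < (α + β) / 2 + (β - α) / 2 * cos ψ := fun ψ => by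
    have := neg_one_le_cos ψ
    nlinarith
  have hderiv : ∀ ψ ∈ Ioo 0 π, HasDerivAt (fun ψ => 2 / (β * r) * arctan (r * tan (ψ / 2)))
      ((α + β) / 2 + (β - α) / 2 * cos ψ)⁻¹ ψ := by
    intro ψ hψ
    have hc : 0 < cos (ψ / 2) := cos_pos_of_mem_Ioo ⟨by linarith [hψ.1, pi_pos], by linarith [hψ.2]⟩
    have h1 : HasDerivAt (fun ψ => tan (ψ / 2)) (1 / cos (ψ / 2) ^ 2 * (1 / 2)) ψ := by
      have := (hasDerivAt_tan hc.ne').comp ψ ((hasDerivAt_id ψ).div_const 2)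
      exact this
    have h2 := ((h1.const_mul r).arctan).const_mul (2 / (β * r))
    refine h2.congr_deriv ?_
    have e : cos ψ = 2 * cos (ψ / 2) ^ 2 - 1 := by rw [← cos_two_mul]; congr 1; ring
    have e2 : (r * tan (ψ / 2)) ^ 2 = α / β * ((1 - cos (ψ / 2) ^ 2) / cos (ψ / 2) ^ 2) := by
      rw [mul_pow, hr2, tan_eq_sin_div_cos, div_pow, sin_sq]
    have hp := hpos ψ
    rw [e] at hp ⊢
    have e3 : 1 + (r * tan (ψ / 2)) ^ 2
        = ((α + β) / 2 + (β - α) / 2 * (2 * cos (ψ / 2) ^ 2 - 1)) / (β * cos (ψ / 2) ^ 2) := by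
      rw [e2]; field_simp; ring
    rw [e3]
    have := hp.ne'
    field_simp
  have hcont : Continuous (fun ψ => ((α + β) / 2 + (β - α) / 2 * cos ψ)⁻¹) :=
    Continuous.inv₀ (by fun_prop) fun ψ => (hpos ψ).ne'
  -- The primitive is used on the open interval with one-sided limits: at ψ = π the convention
  -- tan(π/2) = 0 makes it discontinuous.
  have key := intervalIntegral.integral_eq_sub_of_hasDerivAt_of_tendsto pi_pos (fa := 0)
    (fb := 2 / (β * r) * (π / 2)) hderiv (hcont.intervalIntegrable _ _) ?_ ?_
  · rw [key, hs]
    field_simp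
    ring
  · have : ContinuousAt (fun ψ => 2 / (β * r) * arctan (r * tan (ψ / 2))) 0 := by
      have h0 : ContinuousAt tan (0 / 2) := continuousAt_tan.2 (by simp)
      have h1 : ContinuousAt (fun ψ : ℝ => tan (ψ / 2)) 0 :=
        ContinuousAt.comp (f := fun ψ : ℝ => ψ / 2) h0 (by fun_prop)
      exact (continuous_arctan.continuousAt.comp (h1.const_mul r)).const_mul _
    have h2 := this.tendsto
    simp only [zero_div, tan_zero, mul_zero, arctan_zero] at h2
    exact h2.mono_left nhdsWithin_le_nhds
  · have h1 : Filter.Tendsto (fun ψ : ℝ => ψ / 2) (nhdsWithin π (Iio π))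
        (nhdsWithin (π / 2) (Iio (π / 2))) := by
      refine tendsto_nhdsWithin_iff.2 ⟨?_, ?_⟩
      · exact ((continuous_id.div_const 2).tendsto π).mono_left nhdsWithin_le_nhds
      · filter_upwards [self_mem_nhdsWithin] with ψ hψ
        simp only [mem_Iio] at hψ ⊢
        linarith
    have h2 := (tendsto_tan_pi_div_two.comp h1).const_mul_atTop hr0
    exact ((tendsto_arctan_atTop.mono_right nhdsWithin_le_nhds).comp h2).const_mul _

lemma integral_inv_invArc_left {a b y : ℝ} (hab : a < b) (hy : y < a) :
    π⁻¹ * ∫ ψ in (0 : ℝ)..π, (invArc a b y ψ)⁻¹ = √(a - y) * √(b - y) := by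
  have h := inv_lt_inv_of_notMem hab (Or.inl hy)
  have := integral_inv_add_cos (inv_pos.2 (by linarith : 0 < b - y)) h
  unfold invArc
  rw [this, ← mul_inv, sqrt_inv, div_inv_eq_mul, ← mul_assoc, inv_mul_cancel₀ pi_ne_zero, one_mul,
    sqrt_mul (by linarith), mul_comm]

lemma integral_inv_invArc_right {a b y : ℝ} (hab : a < b) (hy : b < y) :
    π⁻¹ * ∫ ψ in (0 : ℝ)..π, (invArc a b y ψ)⁻¹ = -(√(y - a) * √(y - b)) := by
  have h := integral_inv_invArc_left (neg_lt_neg hab) (neg_lt_neg hy)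
  have e := intervalIntegral.integral_comp_sub_left (fun ψ => (invArc (-b) (-a) (-y) ψ)⁻¹)
    (a := 0) (b := π) π
  rw [sub_self, sub_zero] at e
  rw [← e] at h
  have e2 : ∀ ψ, (invArc (-b) (-a) (-y) (π - ψ))⁻¹ = -(invArc a b y ψ)⁻¹ := fun ψ => by
    rw [← inv_neg]
    congr 1
    rw [invArc, invArc, cos_pi_sub, neg_sub_neg, neg_sub_neg, ← neg_sub a y, ← neg_sub b y, inv_neg,
      inv_neg]
    ring
  simp only [e2, intervalIntegral.integral_neg, neg_sub_neg] at h
  rw [mul_comm (√(y - a)), ← h]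
  ring

/-- The mass of a layer is the mean displacement from y to its balayage, which is the average of
`balPt` - y = 1/`invArc`. -/
lemma integral_layer {a b y L : ℝ} (hab : a < b) (hy : y < a ∨ b < y) (ha : 0 ≤ a) (hb : b ≤ L)
    (hyL : y ∈ Icc 0 L) :
    ∫ z in Icc 0 L, layer a b y z = π⁻¹ * ∫ ψ in (0 : ℝ)..π, (invArc a b y ψ)⁻¹ := by
  have := integral_mul_layer hab hy ha hb hyL (f := fun _ => 1) (integrable_const _)
  simp only [one_mul, intervalIntegral.integral_const, smul_eq_mul, mul_one] at this
  rw [this]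
  congr 2 with ψ
  rw [balPt]
  ring

end

end CutHexagon

/-! ### The candidate density and its variational inequalities. -/

namespace CutHexagon

noncomputable section

open Real

/-- The two equations for the endpoints `a`, `b` of the liquid part of the free boundary. -/
structure EndpointEqs (lam ν θ a b : ℝ) : Prop where
  lam_pos : 0 < lam
  nonneg : 0 ≤ ν
  lower : ν < a
  middle : a < b
  upper : b < θ
  le_top : θ ≤ lam + 1
  force : (√a + √b) * (√(θ - a) + √(θ - b))
    = (√(lam + 1 - a) + √(lam + 1 - b)) * (√(a - ν) + √(b - ν))
  mass : √(lam + 1 - a) * √(lam + 1 - b) - √(θ - a) * √(θ - b)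
    + √a * √b - √(a - ν) * √(b - ν) = lam

open Classical in
/-- The candidate density with endpoints `a`, `b`. -/
def profile (lam ν θ a b z : ℝ) : ℝ :=
  if z ∈ Ioo a b then arctanDensity lam ν θ a b z else if z ∈ Icc ν θ then 1 else 0

/-- The complementary density of the candidate, as a combination of layers. -/
def holes (lam ν θ a b z : ℝ) : ℝ :=
  layer a b 0 z - layer a b ν z + layer a b θ z - layer a b (lam + 1) z

/-- The force of the complementary density. -/
def holesForce (lam ν θ a b t : ℝ) : ℝ :=
  layerForce a b 0 t - layerForce a b ν t + layerForce a b θ t - layerForce a b (lam + 1) t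

namespace EndpointEqs

variable {lam ν θ a b : ℝ}

/-- If exactly one of ν = 0 and θ = λ+1 holds, the two sides of `force` are strictly ordered; if
both hold, `mass` reads 0 = λ. The strictness is what puts the arctangent density strictly below 1.
-/
lemma pos_and_lt (h : EndpointEqs lam ν θ a b) : 0 < ν ∧ θ < lam + 1 := by
  obtain ⟨hlam, hν, h1, h2, h3, hθ, hf, hm⟩ := h
  have pa : 0 < √a := sqrt_pos.2 (by linarith)
  have pb : 0 < √b := sqrt_pos.2 (by linarith)
  have pa' : 0 < √(a - ν) := sqrt_pos.2 (by linarith)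
  have pb' : 0 < √(b - ν) := sqrt_pos.2 (by linarith)
  have qa : 0 < √(θ - a) := sqrt_pos.2 (by linarith)
  have qb : 0 < √(θ - b) := sqrt_pos.2 (by linarith)
  have qa' : √(θ - a) ≤ √(lam + 1 - a) := sqrt_le_sqrt (by linarith)
  have qb' : √(θ - b) ≤ √(lam + 1 - b) := sqrt_le_sqrt (by linarith)
  have ra : √(a - ν) ≤ √a := sqrt_le_sqrt (by linarith)
  have rb : √(b - ν) ≤ √b := sqrt_le_sqrt (by linarith)
  have hboth : ¬ (ν = 0 ∧ θ = lam + 1) := by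
    rintro ⟨rfl, rfl⟩
    simp only [sub_zero] at hm
    linarith
  rcases hν.eq_or_lt with h0 | h0
  · exfalso
    rcases hθ.eq_or_lt with h4 | h4
    · exact hboth ⟨h0.symm, h4⟩
    · have : √(θ - a) < √(lam + 1 - a) := sqrt_lt_sqrt (by linarith) (by linarith)
      rw [← h0, sub_zero, sub_zero] at hf
      nlinarith
  · refine ⟨h0, ?_⟩
    rcases hθ.eq_or_lt with h4 | h4
    · exfalso
      have : √(a - ν) < √a := sqrt_lt_sqrt (by linarith) (by linarith)
      rw [← h4] at hf
      nlinarith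
    · exact h4

lemma sep (h : EndpointEqs lam ν θ a b) : (0 < a ∨ b < 0) ∧ (ν < a ∨ b < ν) ∧ (θ < a ∨ b < θ) ∧
    (lam + 1 < a ∨ b < lam + 1) :=
  ⟨Or.inl (by linarith [h.nonneg, h.lower]), Or.inl h.lower, Or.inr h.upper,
    Or.inr (by linarith [h.upper, h.le_top])⟩

lemma mem (h : EndpointEqs lam ν θ a b) : (0 : ℝ) ∈ Icc 0 (lam + 1) ∧ ν ∈ Icc 0 (lam + 1) ∧
    θ ∈ Icc 0 (lam + 1) ∧ lam + 1 ∈ Icc 0 (lam + 1) := by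
  obtain ⟨hlam, hν, h1, h2, h3, hθ, hf, hm⟩ := h
  refine ⟨⟨le_rfl, ?_⟩, ⟨?_, ?_⟩, ⟨?_, ?_⟩, ⟨?_, le_rfl⟩⟩ <;> linarith

/-- Moving the poles from ν to 0 and from θ to λ+1 increases the arctangents, so their signed sum is
negative. The two subtracted ones are below arctan s and arctan(1/s), which add up to π/2, so the
sum exceeds -π/2. -/
lemma arctanDensity_mem (h : EndpointEqs lam ν θ a b) {z : ℝ} (hz : z ∈ Ioo a b) :
    0 < arctanDensity lam ν θ a b z ∧ arctanDensity lam ν θ a b z < 1 := by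
  obtain ⟨hν0, hθ0⟩ := h.pos_and_lt
  obtain ⟨hlam, hν, h1, h2, h3, hθ, hf, hm⟩ := h
  obtain ⟨hz1, hz2⟩ := hz
  unfold arctanDensity
  have e : √((z - a) / (b - z)) = (√((b - z) / (z - a)))⁻¹ := by
    rw [← sqrt_inv, inv_div]
  have hs : 0 < √((b - z) / (z - a)) := sqrt_pos.2 (div_pos (by linarith) (by linarith))
  rw [e]
  generalize √((b - z) / (z - a)) = s at *
  have hsi : 0 < s⁻¹ := inv_pos.2 hs
  have r1 : √((a - ν) / (b - ν)) < √(a / b) := by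
    apply sqrt_lt_sqrt (div_nonneg (by linarith) (by linarith))
    rw [div_lt_div_iff₀ (by linarith) (by linarith)]
    nlinarith
  have r2 : √((θ - b) / (θ - a)) < √((lam + 1 - b) / (lam + 1 - a)) := by
    apply sqrt_lt_sqrt (div_nonneg (by linarith) (by linarith))
    rw [div_lt_div_iff₀ (by linarith) (by linarith)]
    nlinarith
  have r3 : √(a / b) < 1 := by
    rw [sqrt_lt' one_pos, one_pow, div_lt_one (by linarith)]; exact h2
  have r4 : √((lam + 1 - b) / (lam + 1 - a)) < 1 := by
    rw [sqrt_lt' one_pos, one_pow, div_lt_one (by linarith)]; linarith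
  have a1 := arctan_strictMono (mul_lt_mul_of_pos_left r1 hs)
  have a2 := arctan_strictMono (mul_lt_mul_of_pos_left r2 hsi)
  have a3 := arctan_strictMono (mul_lt_mul_of_pos_left r3 hs)
  have a4 := arctan_strictMono (mul_lt_mul_of_pos_left r4 hsi)
  have a5 : 0 ≤ arctan (s * √((a - ν) / (b - ν))) := arctan_nonneg.2 (by positivity)
  have a6 : 0 ≤ arctan (s⁻¹ * √((θ - b) / (θ - a))) := arctan_nonneg.2 (by positivity)
  have a7 := arctan_inv_of_pos hs
  simp only [mul_one] at a3 a4
  have hpi := pi_pos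
  generalize arctan (s * √((a - ν) / (b - ν))) = A1 at *
  generalize arctan (s * √(a / b)) = A2 at *
  generalize arctan (s⁻¹ * √((θ - b) / (θ - a))) = A3 at *
  generalize arctan (s⁻¹ * √((lam + 1 - b) / (lam + 1 - a))) = A4 at *
  have e2 : 1 + 2 / π * (A1 - A2 + A3 - A4) = (π + 2 * (A1 - A2 + A3 - A4)) / π := by
    field_simp
  rw [e2]
  constructor
  · apply div_pos _ hpi
    linarith
  · rw [div_lt_one hpi]
    linarith

lemma profile_nonneg (h : EndpointEqs lam ν θ a b) (z : ℝ) : 0 ≤ profile lam ν θ a b z := by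
  unfold profile
  split_ifs with h1 h2
  · exact (h.arctanDensity_mem h1).1.le
  · exact zero_le_one
  · exact le_rfl

lemma profile_le_one (h : EndpointEqs lam ν θ a b) (z : ℝ) : profile lam ν θ a b z ≤ 1 := by
  unfold profile
  split_ifs with h1 h2
  · exact (h.arctanDensity_mem h1).2.le
  · exact le_rfl
  · exact zero_le_one

lemma profile_eq_zero (h : EndpointEqs lam ν θ a b) {z : ℝ} (hz : z ∉ Icc ν θ) :
    profile lam ν θ a b z = 0 := by
  unfold profile
  rw [if_neg, if_neg hz]
  exact fun h' => hz ⟨by linarith [h.lower, h'.1], by linarith [h.upper, h'.2]⟩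

lemma profile_eq_one {z : ℝ} (h : EndpointEqs lam ν θ a b) (hz : z ∈ Icc ν a ∪ Icc b θ) :
    profile lam ν θ a b z = 1 := by
  unfold profile
  have h1 := h.lower
  have h2 := h.middle
  have h3 := h.upper
  rw [if_neg, if_pos]
  · rcases hz with hz | hz
    · exact ⟨hz.1, by linarith [hz.2]⟩
    · exact ⟨by linarith [hz.1], hz.2⟩
  · rintro ⟨h4, h5⟩
    rcases hz with hz | hz
    · linarith [hz.2]
    · linarith [hz.1]

lemma measurable_profile : Measurable (profile lam ν θ a b) := by
  unfold profile
  refine Measurable.ite measurableSet_Ioo ?_ (Measurable.ite measurableSet_Icc measurable_const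
    measurable_const)
  unfold arctanDensity
  fun_prop

lemma genericShape (h : EndpointEqs lam ν θ a b) :
    GenericShape ν θ a b (profile lam ν θ a b) where
  lower := h.lower
  middle := h.middle
  upper := h.upper
  eq_one := ae_of_all _ fun _ hx => h.profile_eq_one hx
  nonconst := ae_of_all _ fun x hx => by
    rw [profile, if_pos hx]
    exact h.arctanDensity_mem hx

lemma bddMeas_profile (h : EndpointEqs lam ν θ a b) : BddMeas (profile lam ν θ a b) :=
  BddMeas.of_unit measurable_profile h.profile_nonneg h.profile_le_one

lemma layer_of_le {y z : ℝ} (hz : z ≤ a) : layer a b y z = 1 - if z < y then 1 else 0 := by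
  rw [layer, balTail, if_pos hz]

lemma layer_of_ge {y z : ℝ} (hab : a < b) (hz : b ≤ z) :
    layer a b y z = 0 - if z < y then 1 else 0 := by
  rw [layer, balTail, if_neg (by linarith), if_pos hz]

/-- The candidate density is complementary to `holes`. -/
lemma profile_eq_one_sub_holes (h : EndpointEqs lam ν θ a b) {z : ℝ} (hz : z ∈ Icc 0 (lam + 1))
    (hθz : z ≠ θ) (hLz : z ≠ lam + 1) : profile lam ν θ a b z = 1 - holes lam ν θ a b z := by
  obtain ⟨hlam, hν, h1, h2, h3, hθ, hf, hm⟩ := id h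
  obtain ⟨hz0, hzL⟩ := hz
  have hzL' : z < lam + 1 := lt_of_le_of_ne hzL hLz
  unfold holes
  rcases le_or_gt z a with hza | hza
  · simp only [layer_of_le hza, if_neg (not_lt.2 hz0), if_pos hzL',
      if_pos (by linarith : z < θ)]
    by_cases hzν : z < ν
    · rw [profile_eq_zero h (fun h' => by linarith [h'.1]), if_pos hzν]; norm_num
    · rw [profile_eq_one h (Or.inl ⟨not_lt.1 hzν, hza⟩), if_neg hzν]; norm_num
  rcases le_or_gt b z with hzb | hzb
  · simp only [layer_of_ge h2 hzb, if_neg (not_lt.2 hz0), if_pos hzL',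
      if_neg (by linarith : ¬ z < ν)]
    by_cases hzν : z < θ
    · rw [profile_eq_one h (Or.inr ⟨hzb, hzν.le⟩), if_pos hzν]; norm_num
    · rw [profile_eq_zero h (fun h' => hzν (lt_of_le_of_ne h'.2 hθz)), if_neg hzν]; norm_num
  · rw [profile, if_pos ⟨hza, hzb⟩]
    simp only [layer, balTail, if_neg (not_le.2 hza), if_neg (not_le.2 hzb),
      if_neg (not_lt.2 hz0), if_pos hzL', if_neg (by linarith : ¬ z < ν),
      if_pos (by linarith : z < θ)]
    unfold arctanDensity
    have e : √((z - a) / (b - z)) = (√((b - z) / (z - a)))⁻¹ := by rw [← sqrt_inv, inv_div]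
    have hs : 0 < √((b - z) / (z - a)) := sqrt_pos.2 (div_pos (by linarith) (by linarith))
    rw [e]
    generalize √((b - z) / (z - a)) = s at *
    have e0 : (0 - a) / (0 - b) = a / b := by rw [zero_sub, zero_sub, neg_div_neg_eq]
    have e1 : (ν - a) / (ν - b) = (a - ν) / (b - ν) := by
      rw [← neg_sub a ν, ← neg_sub b ν, neg_div_neg_eq]
    -- For the poles to the right of b the formula uses the reciprocal argument; arctan x +
    -- arctan(1/x) = π/2 brings it to the form in `balTail`, and the two terms π/2 cancel between θ
    -- and λ+1.
    have e2 : ∀ w, b < w → arctan (s⁻¹ * √((w - b) / (w - a)))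
        = π / 2 - arctan (s * √((w - a) / (w - b))) := fun w hw => by
      have hr : 0 < √((w - a) / (w - b)) := sqrt_pos.2 (div_pos (by linarith) (by linarith))
      rw [← arctan_inv_of_pos (mul_pos hs hr), mul_inv, ← sqrt_inv, inv_div]
    rw [e0, e1, e2 θ h3, e2 (lam + 1) (by linarith)]
    ring

lemma profile_ae_eq (h : EndpointEqs lam ν θ a b) :
    ∀ᵐ z ∂(volume.restrict (Icc 0 (lam + 1))),
      profile lam ν θ a b z = 1 - holes lam ν θ a b z := by
  filter_upwards [ae_restrict_mem measurableSet_Icc,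
    (countable_singleton θ).ae_notMem (volume.restrict (Icc 0 (lam + 1))),
    (countable_singleton (lam + 1)).ae_notMem (volume.restrict (Icc 0 (lam + 1)))] with z h1 h2 h3
  exact h.profile_eq_one_sub_holes h1 h2 h3

/-- The four layer masses are ±√|y-a|√|y-b|, with sign + for y to the left of [a,b]; their
alternating sum is the left side of the `mass` equation. -/
lemma integral_holes (h : EndpointEqs lam ν θ a b) :
    ∫ z in Icc 0 (lam + 1), holes lam ν θ a b z = lam := by
  obtain ⟨s0, s1, s2, s3⟩ := h.sep
  obtain ⟨m0, m1, m2, m3⟩ := h.mem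
  obtain ⟨hlam, hν, h1, h2, h3, hθ, hf, hm⟩ := id h
  have ha : 0 ≤ a := by linarith
  have hb : b ≤ lam + 1 := by linarith
  have hi : ∀ y, Integrable (layer a b y) (volume.restrict (Icc 0 (lam + 1))) := fun y =>
    (bddMeas_layer a b y).integrable _
  change ∫ z in Icc 0 (lam + 1),
    (layer a b 0 - layer a b ν + layer a b θ - layer a b (lam + 1)) z = lam
  rw [integral_sub' (((hi 0).sub (hi ν)).add (hi θ)) (hi _),
    integral_add' ((hi 0).sub (hi ν)) (hi θ), integral_sub' (hi 0) (hi ν),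
    integral_layer h2 s0 ha hb m0, integral_layer h2 s1 ha hb m1, integral_layer h2 s2 ha hb m2,
    integral_layer h2 s3 ha hb m3, integral_inv_invArc_left h2 (by linarith : (0 : ℝ) < a),
    integral_inv_invArc_left h2 h1, integral_inv_invArc_right h2 h3,
    integral_inv_invArc_right h2 (by linarith : b < lam + 1), sub_zero, sub_zero]
  linarith

lemma integral_profile (h : EndpointEqs lam ν θ a b) :
    ∫ z in Icc 0 (lam + 1), profile lam ν θ a b z = 1 := by
  have hi : Integrable (holes lam ν θ a b) (volume.restrict (Icc 0 (lam + 1))) :=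
    ((((bddMeas_layer a b 0).sub (bddMeas_layer a b ν)).add (bddMeas_layer a b θ)).sub
      (bddMeas_layer a b (lam + 1))).integrable _
  rw [integral_congr_ae h.profile_ae_eq, integral_sub (integrable_const _) hi, h.integral_holes]
  simp [(by linarith [h.lam_pos] : 0 ≤ lam + 1)]

lemma logPot_profile_sub (h : EndpointEqs lam ν θ a b) {x₁ x₂ : ℝ} (h1 : 0 ≤ x₁) (h12 : x₁ ≤ x₂)
    (h2 : x₂ ≤ lam + 1) :
    logPot (lam + 1) (fun z => 1 - profile lam ν θ a b z) x₂
      - logPot (lam + 1) (fun z => 1 - profile lam ν θ a b z) x₁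
      = ∫ t in x₁..x₂, holesForce lam ν θ a b t := by
  obtain ⟨s0, s1, s2, s3⟩ := h.sep
  obtain ⟨m0, m1, m2, m3⟩ := h.mem
  have ha : 0 ≤ a := by linarith [h.nonneg, h.lower]
  have hb : b ≤ lam + 1 := by linarith [h.upper, h.le_top]
  have hab := h.middle
  obtain ⟨i0, e0⟩ := logPot_layer_sub hab s0 ha hb m0 h1 h12 h2
  obtain ⟨i1, e1⟩ := logPot_layer_sub hab s1 ha hb m1 h1 h12 h2
  obtain ⟨i2, e2⟩ := logPot_layer_sub hab s2 ha hb m2 h1 h12 h2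
  obtain ⟨i3, e3⟩ := logPot_layer_sub hab s3 ha hb m3 h1 h12 h2
  have key : ∀ x, logPot (lam + 1) (fun z => 1 - profile lam ν θ a b z) x
      = logPot (lam + 1) (layer a b 0) x - logPot (lam + 1) (layer a b ν) x
        + logPot (lam + 1) (layer a b θ) x - logPot (lam + 1) (layer a b (lam + 1)) x := by
    intro x
    have hi : ∀ y, Integrable (fun z => log |x - z| * layer a b y z)
        (volume.restrict (Icc 0 (lam + 1))) := fun y =>
      Integrable.mul_bddMeas (integrableOn_log_abs_sub x 0 (lam + 1)) (bddMeas_layer a b y)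
        measurable_id
    unfold logPot
    rw [← integral_sub' (hi 0) (hi ν), ← integral_add' ((hi 0).sub (hi ν)) (hi θ),
      ← integral_sub' (((hi 0).sub (hi ν)).add (hi θ)) (hi _)]
    apply integral_congr_ae
    filter_upwards [h.profile_ae_eq] with z hz
    simp only [Pi.sub_apply, Pi.add_apply]
    rw [hz, holes]
    ring
  unfold holesForce
  rw [intervalIntegral.integral_sub ((i0.sub i1).add i2) i3,
    intervalIntegral.integral_add (i0.sub i1) i2, intervalIntegral.integral_sub i0 i1, ← e0, ← e1,
    ← e2, ← e3, key, key]
  ring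

lemma force_log (h : EndpointEqs lam ν θ a b) :
    log (√|0 - a| + √|0 - b|) - log (√|ν - a| + √|ν - b|) + log (√|θ - a| + √|θ - b|)
      - log (√|lam + 1 - a| + √|lam + 1 - b|) = 0 := by
  obtain ⟨hlam, hν, h1, h2, h3, hθ, hf, hm⟩ := h
  rw [zero_sub, zero_sub, abs_neg, abs_neg, abs_sub_comm ν, abs_sub_comm ν,
    abs_of_pos (by linarith : 0 < a), abs_of_pos (by linarith : 0 < b),
    abs_of_pos (by linarith : 0 < a - ν), abs_of_pos (by linarith : 0 < b - ν),
    abs_of_pos (by linarith : 0 < θ - a), abs_of_pos (by linarith : 0 < θ - b),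
    abs_of_pos (by linarith : 0 < lam + 1 - a), abs_of_pos (by linarith : 0 < lam + 1 - b)]
  have pa : 0 < √a := sqrt_pos.2 (by linarith)
  have pa' : 0 < √(a - ν) := sqrt_pos.2 (by linarith)
  have qa : 0 < √(θ - a) := sqrt_pos.2 (by linarith)
  have qa' : 0 < √(lam + 1 - a) := sqrt_pos.2 (by linarith)
  have := congrArg log hf
  rw [log_mul (by positivity) (by positivity), log_mul (by positivity) (by positivity)] at this
  linarith

/-- The terms log(b-a) cancel by the alternating signs, and what remains is twice the logarithm of
the `force` equation. -/
lemma holesForce_inside (h : EndpointEqs lam ν θ a b) {t : ℝ} (ht : t ∈ Icc a b) :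
    holesForce lam ν θ a b t = 0 := by
  obtain ⟨s0, s1, s2, s3⟩ := h.sep
  have hab := h.middle
  have := h.force_log
  rw [holesForce, layerForce_inside hab s0 ht, layerForce_inside hab s1 ht,
    layerForce_inside hab s2 ht, layerForce_inside hab s3 ht]
  linarith

/-- The pole y enters this part of `layerForce_outside` only through |y-a|/|t-y| and |y-b|/|t-y|,
and the expression increases in both. -/
lemma greenTerm_le {a b t y y' : ℝ} (hy : |y - a| / |t - y| ≤ |y' - a| / |t - y'|)
    (hy' : |y - b| / |t - y| ≤ |y' - b| / |t - y'|) (hpos : 0 < |b - t| * (|y - a| / |t - y|)) :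
    log (√(|b - t| * (|y - a| / |t - y|)) + √(|a - t| * (|y - b| / |t - y|)))
    ≤ log (√(|b - t| * (|y' - a| / |t - y'|)) + √(|a - t| * (|y' - b| / |t - y'|))) := by
  apply log_le_log
  · have := sqrt_pos.2 hpos
    positivity
  · gcongr

/-- The constant parts cancel by `force_log`. For c > t, the ratio |y-c|/|t-y| grows as y moves from
0 to ν below t, and, for c < θ, from θ to λ+1. So both differences of Green-type terms have the same
sign. -/
lemma holesForce_left (h : EndpointEqs lam ν θ a b) {t : ℝ} (ht : t ∈ Ioo ν a) :
    0 ≤ holesForce lam ν θ a b t := by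
  obtain ⟨s0, s1, s2, s3⟩ := h.sep
  have hfl := h.force_log
  obtain ⟨hlam, hν, h1, h2, h3, hθ, hf, hm⟩ := h
  obtain ⟨ht1, ht2⟩ := ht
  have hta : t < a ∨ b < t := Or.inl ht2
  rw [holesForce, layerForce_outside h2 s0 hta (by linarith : 0 < t).ne',
    layerForce_outside h2 s1 hta ht1.ne', layerForce_outside h2 s2 hta (by linarith : t < θ).ne,
    layerForce_outside h2 s3 hta (by linarith : t < lam + 1).ne]
  have g1 : ∀ c, t < c → |0 - c| / |t - 0| ≤ |ν - c| / |t - ν| := fun c hc => by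
    rw [abs_sub_comm 0, abs_sub_comm ν, abs_of_pos (by linarith : 0 < c - 0),
      abs_of_pos (by linarith : 0 < t - 0), abs_of_pos (by linarith : 0 < c - ν),
      abs_of_pos (by linarith : 0 < t - ν), div_le_div_iff₀ (by linarith) (by linarith)]
    nlinarith
  have g2 : ∀ c, t < c → c < θ → |θ - c| / |t - θ| ≤ |lam + 1 - c| / |t - (lam + 1)| :=
    fun c hc hc' => by
    rw [abs_sub_comm t, abs_sub_comm t, abs_of_pos (by linarith : 0 < θ - c),
      abs_of_pos (by linarith : 0 < lam + 1 - c), abs_of_pos (by linarith : 0 < θ - t),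
      abs_of_pos (by linarith : 0 < lam + 1 - t), div_le_div_iff₀ (by linarith) (by linarith)]
    nlinarith
  have pb : 0 < |b - t| := abs_pos.2 (by linarith : 0 < b - t).ne'
  have k1 := greenTerm_le (g1 a ht2) (g1 b (by linarith)) (mul_pos pb (div_pos
    (abs_pos.2 (by linarith : 0 - a < 0).ne) (abs_pos.2 (by linarith : 0 < t - 0).ne')))
  have k2 := greenTerm_le (g2 a ht2 (by linarith)) (g2 b (by linarith) h3) (mul_pos pb (div_pos
    (abs_pos.2 (by linarith : 0 < θ - a).ne') (abs_pos.2 (by linarith : t - θ < 0).ne)))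
  linarith

lemma holesForce_right (h : EndpointEqs lam ν θ a b) {t : ℝ} (ht : t ∈ Ioo b θ) :
    holesForce lam ν θ a b t ≤ 0 := by
  obtain ⟨s0, s1, s2, s3⟩ := h.sep
  have hfl := h.force_log
  obtain ⟨hlam, hν, h1, h2, h3, hθ, hf, hm⟩ := h
  obtain ⟨ht1, ht2⟩ := ht
  have hta : t < a ∨ b < t := Or.inr ht1
  rw [holesForce, layerForce_outside h2 s0 hta (by linarith : 0 < t).ne',
    layerForce_outside h2 s1 hta (by linarith : ν < t).ne', layerForce_outside h2 s2 hta ht2.ne,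
    layerForce_outside h2 s3 hta (by linarith : t < lam + 1).ne]
  have g1 : ∀ c, c < t → ν < c → |ν - c| / |t - ν| ≤ |0 - c| / |t - 0| := fun c hc hc' => by
    rw [abs_sub_comm 0, abs_sub_comm ν, abs_of_pos (by linarith : 0 < c - 0),
      abs_of_pos (by linarith : 0 < t - 0), abs_of_pos (by linarith : 0 < c - ν),
      abs_of_pos (by linarith : 0 < t - ν), div_le_div_iff₀ (by linarith) (by linarith)]
    nlinarith
  have g2 : ∀ c, c < t → |lam + 1 - c| / |t - (lam + 1)| ≤ |θ - c| / |t - θ| :=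
    fun c hc => by
    rw [abs_sub_comm t, abs_sub_comm t, abs_of_pos (by linarith : 0 < θ - c),
      abs_of_pos (by linarith : 0 < lam + 1 - c), abs_of_pos (by linarith : 0 < θ - t),
      abs_of_pos (by linarith : 0 < lam + 1 - t), div_le_div_iff₀ (by linarith) (by linarith)]
    nlinarith
  have pb : 0 < |b - t| := abs_pos.2 (by linarith : b - t < 0).ne
  have k1 := greenTerm_le (g1 a (by linarith) h1) (g1 b ht1 (by linarith)) (mul_pos pb (div_pos
    (abs_pos.2 (by linarith : ν - a < 0).ne) (abs_pos.2 (by linarith : 0 < t - ν).ne')))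
  have k2 := greenTerm_le (g2 a (by linarith)) (g2 b ht1) (mul_pos pb (div_pos
    (abs_pos.2 (by linarith : 0 < lam + 1 - a).ne')
    (abs_pos.2 (by linarith : t - (lam + 1) < 0).ne)))
  linarith

/-- The variational inequalities satisfied by the candidate density. -/
lemma logPot_profile (h : EndpointEqs lam ν θ a b) :
    (∀ x ∈ Icc a b, logPot (lam + 1) (fun z => 1 - profile lam ν θ a b z) x
      = logPot (lam + 1) (fun z => 1 - profile lam ν θ a b z) a) ∧
    (∀ x ∈ Icc ν a ∪ Icc b θ, logPot (lam + 1) (fun z => 1 - profile lam ν θ a b z) x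
      ≤ logPot (lam + 1) (fun z => 1 - profile lam ν θ a b z) a) := by
  obtain ⟨hlam, hν, h1, h2, h3, hθ, -, -⟩ := id h
  have hin : ∀ x ∈ Icc a b, logPot (lam + 1) (fun z => 1 - profile lam ν θ a b z) x
      = logPot (lam + 1) (fun z => 1 - profile lam ν θ a b z) a := by
    intro x hx
    have := h.logPot_profile_sub (by linarith : 0 ≤ a) hx.1 (by linarith [hx.2])
    rw [intervalIntegral.integral_congr (g := fun _ => 0)] at this
    · simp only [intervalIntegral.integral_zero] at this
      linarith
    · intro t ht
      rw [uIcc_of_le hx.1] at ht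
      exact h.holesForce_inside ⟨ht.1, ht.2.trans hx.2⟩
  refine ⟨hin, ?_⟩
  rintro x (hx | hx)
  · have := h.logPot_profile_sub (hν.trans hx.1) hx.2 (by linarith)
    have h4 : 0 ≤ ∫ t in x..a, holesForce lam ν θ a b t := by
      rw [intervalIntegral.integral_of_le hx.2, integral_Ioc_eq_integral_Ioo]
      exact setIntegral_nonneg measurableSet_Ioo fun t ht =>
        h.holesForce_left ⟨lt_of_le_of_lt hx.1 ht.1, ht.2⟩
    linarith
  · have := h.logPot_profile_sub (by linarith : 0 ≤ b) hx.1 (by linarith [hx.2])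
    have h4 : ∫ t in b..x, holesForce lam ν θ a b t ≤ 0 := by
      rw [intervalIntegral.integral_of_le hx.1, integral_Ioc_eq_integral_Ioo]
      exact setIntegral_nonpos measurableSet_Ioo fun t ht =>
        h.holesForce_right ⟨ht.1, ht.2.trans_le hx.2⟩
    have := hin b ⟨h2.le, le_rfl⟩
    linarith

end EndpointEqs

/-! ### Minimality and uniqueness of the candidate. -/

lemma Admissible.bddMeas {ν θ : ℝ} {ρ : ℝ → ℝ} (h : Admissible ν θ ρ) : BddMeas ρ :=
  BddMeas.of_unit h.measurable h.nonneg h.le_one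

lemma integral_Icc_eq_of_forbidden {ν θ L : ℝ} {ρ : ℝ → ℝ} (hν : 0 ≤ ν) (hνθ : ν ≤ θ) (hθ : θ ≤ L)
    (h : ∀ x, x ∉ Icc ν θ → ρ x = 0) : ∫ x in Icc 0 L, ρ x = ∫ x in ν..θ, ρ x := by
  rw [intervalIntegral.integral_of_le hνθ, ← integral_Icc_eq_integral_Ioc]
  exact setIntegral_eq_of_subset_of_forall_sdiff_eq_zero measurableSet_Icc
    (Icc_subset_Icc hν hθ) fun x hx => h x hx.2

namespace EndpointEqs

variable {lam ν θ a b : ℝ}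

lemma admissible (h : EndpointEqs lam ν θ a b) : Admissible ν θ (profile lam ν θ a b) where
  measurable := measurable_profile
  nonneg := h.profile_nonneg
  le_one := h.profile_le_one
  forbidden _ hx := h.profile_eq_zero hx
  mass := by
    rw [← integral_Icc_eq_of_forbidden h.nonneg (by linarith [h.lower, h.middle, h.upper]) h.le_top
      (fun _ hx => h.profile_eq_zero hx), h.integral_profile]

/-- The first variation is nonnegative. As the perturbation has mean zero, F may be replaced by F -
F(a). This vanishes on [a,b]; on the saturated bands it is ≤ 0 and so is ρ - 1; outside [ν,θ] both
densities vanish. -/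
lemma rate_profile_add_le (h : EndpointEqs lam ν θ a b) {ρ : ℝ → ℝ} (hρ : Admissible ν θ ρ) :
    (∫ x in Icc 0 (lam + 1), (ρ x - profile lam ν θ a b x) = 0) ∧
    rate lam (profile lam ν θ a b) - 1 / 2 * logEnergy (lam + 1)
      (fun x => ρ x - profile lam ν θ a b x) (fun x => ρ x - profile lam ν θ a b x)
      ≤ rate lam ρ := by
  have hνθ : ν ≤ θ := by linarith [h.lower, h.middle, h.upper]
  have hσ := hρ.bddMeas.sub h.bddMeas_profile
  have hmass : ∫ x in Icc 0 (lam + 1), (ρ x - profile lam ν θ a b x) = 0 := by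
    rw [integral_sub (hρ.bddMeas.integrable _) (h.bddMeas_profile.integrable _),
      integral_Icc_eq_of_forbidden h.nonneg hνθ h.le_top hρ.forbidden, hρ.mass, h.integral_profile,
      sub_self]
  refine ⟨hmass, ?_⟩
  have hexp := rate_add h.lam_pos h.bddMeas_profile hσ
  have e : (fun x => profile lam ν θ a b x + (ρ x - profile lam ν θ a b x)) = ρ := by
    ext x; ring
  rw [e] at hexp
  rw [hexp]
  set F := logPot (lam + 1) (fun z => 1 - profile lam ν θ a b z) with hF
  obtain ⟨hin, hout⟩ := h.logPot_profile
  -- The potential is controlled only on [0,λ+1], so it is cut off there to obtain a globally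
  -- bounded function.
  have hFb : BddMeas ((Icc 0 (lam + 1)).indicator F) := by
    obtain ⟨C, hC⟩ := exists_abs_logPot_le (lam + 1) ((BddMeas.const 1).sub h.bddMeas_profile)
    refine ⟨(measurable_logPot _ (measurable_const.sub measurable_profile)).indicator
      measurableSet_Icc, max C 0, fun x => ?_⟩
    by_cases hx : x ∈ Icc 0 (lam + 1)
    · rw [indicator_of_mem hx]
      exact (hC x hx).trans (le_max_left _ _)
    · rw [indicator_of_notMem hx, abs_zero]
      exact le_max_right _ _
  have h1 : ∫ x in Icc 0 (lam + 1), F x * (ρ x - profile lam ν θ a b x)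
      = ∫ x in Icc 0 (lam + 1), ((Icc 0 (lam + 1)).indicator F x - F a)
        * (ρ x - profile lam ν θ a b x) := by
    simp only [sub_mul _ (F a)]
    rw [integral_sub ((hFb.mul hσ).integrable _) ((hσ.integrable _).const_mul _),
      integral_const_mul, hmass, mul_zero, sub_zero]
    exact setIntegral_congr_fun measurableSet_Icc fun x hx => by
      simp only [indicator_of_mem hx]
  have h2 : 0 ≤ ∫ x in Icc 0 (lam + 1), ((Icc 0 (lam + 1)).indicator F x - F a)
        * (ρ x - profile lam ν θ a b x) := by
    refine setIntegral_nonneg measurableSet_Icc fun x hx => ?_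
    rw [indicator_of_mem hx]
    by_cases hx1 : x ∈ Icc a b
    · rw [hF, hin x hx1, sub_self, zero_mul]
    · by_cases hx2 : x ∈ Icc ν θ
      · have hx3 : x ∈ Icc ν a ∪ Icc b θ := by
          rcases lt_or_ge x a with h4 | h4
          · exact Or.inl ⟨hx2.1, h4.le⟩
          · exact Or.inr ⟨not_lt.1 fun h5 => hx1 ⟨h4, h5.le⟩, hx2.2⟩
        rw [h.profile_eq_one hx3]
        exact mul_nonneg_of_nonpos_of_nonpos (sub_nonpos.2 (hout x hx3))
          (sub_nonpos.2 (hρ.le_one x))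
      · rw [hρ.forbidden x hx2, h.profile_eq_zero hx2, sub_zero, mul_zero]
  linarith

/-- The candidate density minimizes the rate functional. -/
lemma isMinimizer (h : EndpointEqs lam ν θ a b) :
    IsMinimizer lam ν θ (profile lam ν θ a b) := by
  refine ⟨h.admissible, fun ρ hρ => ?_⟩
  obtain ⟨h1, h2⟩ := h.rate_profile_add_le hρ
  have := logEnergy_nonpos (hρ.bddMeas.sub h.bddMeas_profile) h1
  linarith

/-- The minimizer is unique up to null sets. -/
lemma ae_eq_of_isMinimizer (h : EndpointEqs lam ν θ a b) {ρ : ℝ → ℝ}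
    (hρ : IsMinimizer lam ν θ ρ) : ρ =ᵐ[volume] profile lam ν θ a b := by
  obtain ⟨h1, h2⟩ := h.rate_profile_add_le hρ.1
  have h3 := hρ.2 _ h.admissible
  have h4 := ae_eq_zero_of_logEnergy_nonneg (hρ.1.bddMeas.sub h.bddMeas_profile) h1 (by linarith)
  rw [ae_restrict_iff' measurableSet_Icc] at h4
  filter_upwards [h4] with x hx
  by_cases hx2 : x ∈ Icc ν θ
  · have := hx ⟨h.nonneg.trans hx2.1, hx2.2.trans h.le_top⟩
    linarith
  · rw [hρ.1.forbidden x hx2, h.profile_eq_zero hx2]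

end EndpointEqs

end

end CutHexagon

/-! ### Euler–Lagrange condition for a minimizer, and duality with arcsine laws. -/

namespace CutHexagon

noncomputable section

open Real Filter Topology

section EulerLagrange

variable {lam ν θ a b : ℝ} {ρ : ℝ → ℝ}

lemma nonneg_of_forall_mul_le {A K : ℝ} (h : ∀ t : ℝ, 0 < t → t ≤ 1 → t * K ≤ A) : 0 ≤ A := by
  have h1 : Tendsto (fun t : ℝ => t * K) (𝓝[>] 0) (𝓝 0) := by
    have : Tendsto (fun t : ℝ => t * K) (𝓝 0) (𝓝 (0 * K)) := tendsto_id.mul_const K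
    rw [zero_mul] at this
    exact this.mono_left nhdsWithin_le_nhds
  refine le_of_tendsto h1 ?_
  filter_upwards [Ioc_mem_nhdsGT (zero_lt_one (α := ℝ))] with t ht using h t ht.1 ht.2

/-- First order condition along an admissible direction. -/
lemma IsMinimizer.integral_logPot_nonneg (hlam : 0 < lam) (hρ : IsMinimizer lam ν θ ρ)
    {σ : ℝ → ℝ} (hσ : BddMeas σ)
    (had : ∀ t : ℝ, 0 < t → t ≤ 1 → Admissible ν θ (fun x => ρ x + t * σ x)) :
    0 ≤ ∫ x in Icc 0 (lam + 1), logPot (lam + 1) (fun y => 1 - ρ y) x * σ x := by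
  refine nonneg_of_forall_mul_le (K := 1 / 2 * logEnergy (lam + 1) σ σ) fun t ht ht1 => ?_
  have h1 := hρ.2 _ (had t ht ht1)
  rw [rate_add hlam hρ.1.bddMeas (hσ.const_mul t), logEnergy_const_mul_left, logEnergy_symm,
    logEnergy_const_mul_left] at h1
  have h2 : ∫ x in Icc 0 (lam + 1), logPot (lam + 1) (fun y => 1 - ρ y) x * (t * σ x)
      = t * ∫ x in Icc 0 (lam + 1), logPot (lam + 1) (fun y => 1 - ρ y) x * σ x := by
    rw [← integral_const_mul]
    congr 1 with x
    ring
  rw [h2] at h1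
  have h3 : 0 ≤ t * ((∫ x in Icc 0 (lam + 1), logPot (lam + 1) (fun y => 1 - ρ y) x * σ x)
      - t * (1 / 2 * logEnergy (lam + 1) σ σ)) := by linarith
  have := nonneg_of_mul_nonneg_right h3 ht
  linarith

/-- The effective potential of a minimizer is constant where the density is neither `0` nor `1`. -/
lemma IsMinimizer.exists_logPot_eq (hlam : 0 < lam) (hν : 0 ≤ ν) (hθ : θ ≤ lam + 1)
    (hρ : IsMinimizer lam ν θ ρ) (hg : GenericShape ν θ a b ρ) :
    ∃ c, ∀ᵐ x ∂volume, x ∈ Ioo a b → logPot (lam + 1) (fun y => 1 - ρ y) x = c := by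
  have h1 := hg.lower
  have h2 := hg.middle
  have h3 := hg.upper
  have hρb := hρ.1.bddMeas
  set F := logPot (lam + 1) (fun y => 1 - ρ y) with hF
  set G := (Icc 0 (lam + 1)).indicator F with hG
  obtain ⟨C, hC⟩ := exists_abs_logPot_le (lam + 1) ((BddMeas.const 1).sub hρb)
  have hGb : BddMeas G := by
    refine ⟨(measurable_logPot _ (measurable_const.sub hρ.1.measurable)).indicator
      measurableSet_Icc, max C 0, fun x => ?_⟩
    by_cases hx : x ∈ Icc 0 (lam + 1)
    · rw [hG, indicator_of_mem hx]
      exact (hC x hx).trans (le_max_left _ _)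
    · rw [hG, indicator_of_notMem hx, abs_zero]
      exact le_max_right _ _
  -- The weight ρ(1-ρ) vanishes to first order where a constraint is active: ρ + s·ρ(1-ρ) stays in
  -- [0,1] for |s| ≤ 1.
  set w : ℝ → ℝ := (Ioo a b).indicator (fun x => ρ x * (1 - ρ x)) with hw
  have hwb : BddMeas w := (hρb.mul ((BddMeas.const 1).sub hρb)).indicator measurableSet_Ioo
  have hw0 : ∀ x, 0 ≤ w x := fun x =>
    indicator_nonneg (fun y _ => mul_nonneg (hρ.1.nonneg y) (sub_nonneg.2 (hρ.1.le_one y))) x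
  set m := volume.restrict (Icc 0 (lam + 1)) with hm
  have hsub : Ioo a b ⊆ Icc 0 (lam + 1) := fun x hx => ⟨by linarith [hx.1], by linarith [hx.2]⟩
  have hwpos : ∀ᵐ x ∂volume, x ∈ Ioo a b → 0 < w x := by
    filter_upwards [hg.nonconst] with x hx hx2
    rw [hw, indicator_of_mem hx2]
    exact mul_pos (hx hx2).1 (sub_pos.2 (hx hx2).2)
  have hwi : 0 < ∫ x, w x ∂m := by
    rw [integral_pos_iff_support_of_nonneg hw0 (hwb.integrable _)]
    have h4 : Ioo a b ≤ᵐ[m] Function.support w := by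
      filter_upwards [ae_restrict_of_ae hwpos] with x hx hx2
      exact (hx hx2).ne'
    refine lt_of_lt_of_le ?_ (measure_mono_ae h4)
    rw [hm, Measure.restrict_apply measurableSet_Ioo, inter_eq_left.2 hsub, Real.volume_Ioo]
    simpa using h2
  -- The w-weighted mean of the potential, so that w(c-G) has integral zero and preserves the mass.
  set c := (∫ x, w x * G x ∂m) / ∫ x, w x ∂m with hc
  refine ⟨c, ?_⟩
  have hhb : BddMeas (fun x => c - G x) := (BddMeas.const c).sub hGb
  have hmean : ∫ x, w x * (c - G x) ∂m = 0 := by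
    have e : ∀ x, w x * (c - G x) = c * w x - w x * G x := fun x => by ring
    simp only [e]
    rw [integral_sub ((hwb.integrable _).const_mul _) ((hwb.mul hGb).integrable _),
      integral_const_mul, hc, div_mul_cancel₀ _ hwi.ne', sub_self]
  obtain ⟨-, K, hK⟩ := id hhb
  have hK0 : 0 ≤ K := (abs_nonneg _).trans (hK 0)
  -- Dividing by K+1 makes the relative perturbation at most 1 in absolute value, including when K =
  -- 0.
  set σ : ℝ → ℝ := fun x => (K + 1)⁻¹ * (w x * (c - G x)) with hσ
  have hσb : BddMeas σ := (hwb.mul hhb).const_mul _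
  have hσ0 : ∀ x, x ∉ Icc ν θ → σ x = 0 := fun x hx => by
    have : x ∉ Ioo a b := fun h => hx ⟨by linarith [h.1], by linarith [h.2]⟩
    simp [hσ, hw, this]
  have had : ∀ t : ℝ, 0 < t → t ≤ 1 → Admissible ν θ (fun x => ρ x + t * σ x) := by
    intro t ht ht1
    have hbound : ∀ x, |t * ((K + 1)⁻¹ * (c - G x))| ≤ 1 := fun x => by
      rw [abs_mul, abs_mul, abs_of_pos ht, abs_of_pos (inv_pos.2 (by linarith : 0 < K + 1))]
      have : (K + 1)⁻¹ * |c - G x| ≤ 1 := by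
        rw [inv_mul_le_iff₀ (by linarith)]
        linarith [hK x]
      calc t * ((K + 1)⁻¹ * |c - G x|) ≤ 1 * 1 := by
            gcongr
        _ = 1 := one_mul 1
    have hform : ∀ x, ρ x + t * σ x = ρ x ∨ ρ x + t * σ x
        = ρ x + ρ x * (1 - ρ x) * (t * ((K + 1)⁻¹ * (c - G x))) := fun x => by
      by_cases hx : x ∈ Ioo a b
      · right
        simp only [hσ, hw, indicator_of_mem hx]
        ring
      · left
        simp [hσ, hw, hx]
    refine ⟨hρ.1.measurable.add (hσb.const_mul t).1, fun x => ?_, fun x => ?_, fun x hx => ?_, ?_⟩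
    · rcases hform x with h | h
      · rw [h]; exact hρ.1.nonneg x
      · rw [h]
        have := abs_le.1 (hbound x)
        have h4 := hρ.1.nonneg x
        have h5 := hρ.1.le_one x
        have h6 : ρ x * (1 - ρ x) ≤ ρ x := by nlinarith
        have h7 : 0 ≤ ρ x * (1 - ρ x) := mul_nonneg h4 (by linarith)
        nlinarith
    · rcases hform x with h | h
      · rw [h]; exact hρ.1.le_one x
      · rw [h]
        have := abs_le.1 (hbound x)
        have h4 := hρ.1.nonneg x
        have h5 := hρ.1.le_one x
        have h6 : ρ x * (1 - ρ x) ≤ 1 - ρ x := by nlinarith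
        have h7 : 0 ≤ ρ x * (1 - ρ x) := mul_nonneg h4 (by linarith)
        nlinarith
    · rw [hρ.1.forbidden x hx, hσ0 x hx]
      ring
    · have hνθ : ν ≤ θ := by linarith
      rw [← integral_Icc_eq_of_forbidden hν hνθ hθ (fun x hx => by
          rw [hρ.1.forbidden x hx, hσ0 x hx]; ring),
        integral_add (hρb.integrable _) ((hσb.const_mul t).integrable _), integral_const_mul,
        integral_Icc_eq_of_forbidden hν hνθ hθ hρ.1.forbidden, hρ.1.mass, hσ, integral_const_mul,
        hmean]
      ring
  have hpos := hρ.integral_logPot_nonneg hlam hσb had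
  -- Since ∫ w(c-G) = 0, the first-order condition 0 ≤ ∫ G·w(c-G) says that ∫ w(c-G)² ≤ 0.
  have hsq : ∫ x, w x * (c - G x) ^ 2 ∂m = 0 := by
    refine le_antisymm ?_ (integral_nonneg fun x => mul_nonneg (hw0 x) (sq_nonneg _))
    have e1 : ∫ x, F x * σ x ∂m = (K + 1)⁻¹ * ∫ x, G x * (w x * (c - G x)) ∂m := by
      rw [← integral_const_mul]
      refine setIntegral_congr_fun measurableSet_Icc fun x hx => ?_
      simp only [hσ, hG, indicator_of_mem hx]
      ring
    have e2 : ∀ x, w x * (c - G x) ^ 2 = c * (w x * (c - G x)) - G x * (w x * (c - G x)) :=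
      fun x => by ring
    simp only [e2]
    rw [integral_sub (((hwb.mul hhb).integrable _).const_mul _)
      ((hGb.mul (hwb.mul hhb)).integrable _), integral_const_mul, hmean]
    rw [e1] at hpos
    have := nonneg_of_mul_nonneg_right hpos (inv_pos.2 (by linarith : 0 < K + 1))
    linarith
  have hae := (integral_eq_zero_iff_of_nonneg (fun x => mul_nonneg (hw0 x) (sq_nonneg _))
    ((hwb.mul (by simpa only [sq] using hhb.mul hhb)).integrable m)).1 hsq
  rw [hm, Filter.EventuallyEq, ae_restrict_iff' measurableSet_Icc] at hae
  filter_upwards [hae, hwpos] with x h4 h5 hx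
  have h6 := h4 (hsub hx)
  simp only [Pi.zero_apply, mul_eq_zero, (h5 hx).ne', false_or, pow_eq_zero_iff, ne_eq,
    OfNat.ofNat_ne_zero, not_false_eq_true] at h6
  rw [hG, indicator_of_mem (hsub hx)] at h6
  linarith

/-- Averaging over an arcsine distribution ignores null sets. -/
lemma ae_arc_mem {α β : ℝ} (h : α < β) {p : ℝ → Prop} (hp : ∀ᵐ x ∂volume, x ∈ Ioo α β → p x) :
    ∀ᵐ ψ ∂(volume.restrict (Ioc 0 π)), p ((α + β) / 2 + (β - α) / 2 * cos ψ) := by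
  set N := {x | ¬ (x ∈ Ioo α β → p x)} with hN
  have hN0 : volume N = 0 := hp
  have hsub : N ⊆ Ioo α β := fun x hx => by
    simp only [hN, mem_ofPred_eq, Classical.not_imp] at hx
    exact hx.1
  -- The inverse of the cosine parametrization. It is differentiable on the open interval, so it
  -- sends the exceptional null set to a null set of angles.
  set f : ℝ → ℝ := fun x => arccos ((x - (α + β) / 2) / ((β - α) / 2))
  have hd : DifferentiableOn ℝ f N := by
    intro x hx
    have hx' := hsub hx
    refine DifferentiableAt.differentiableWithinAt ?_
    have h1 : (x - (α + β) / 2) / ((β - α) / 2) ≠ -1 := by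
      have : -1 < (x - (α + β) / 2) / ((β - α) / 2) := by
        rw [lt_div_iff₀ (by linarith)]; linarith [hx'.1]
      exact this.ne'
    have h2 : (x - (α + β) / 2) / ((β - α) / 2) ≠ 1 := by
      have : (x - (α + β) / 2) / ((β - α) / 2) < 1 := by
        rw [div_lt_iff₀ (by linarith)]; linarith [hx'.2]
      exact this.ne
    exact DifferentiableAt.comp (g := arccos)
      (f := fun x => (x - (α + β) / 2) / ((β - α) / 2)) x
      (differentiableAt_arccos.2 ⟨h1, h2⟩) (by fun_prop)
  have himg : volume (f '' N) = 0 :=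
    addHaar_image_eq_zero_of_differentiableOn_of_addHaar_eq_zero volume hd hN0
  rw [← restrict_Ioo_eq_restrict_Ioc, ae_restrict_iff' measurableSet_Ioo]
  have h0 : ∀ᵐ ψ ∂volume, ψ ∉ f '' N := measure_eq_zero_iff_ae_notMem.1 himg
  filter_upwards [h0] with ψ h1 hψ
  by_contra hcon
  apply h1
  have hc1 : -1 < cos ψ := by
    rw [← cos_pi]; exact cos_lt_cos_of_nonneg_of_le_pi hψ.1.le le_rfl hψ.2
  have hc2 : cos ψ < 1 := by
    rw [← cos_zero]; exact cos_lt_cos_of_nonneg_of_le_pi le_rfl hψ.2.le hψ.1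
  refine ⟨(α + β) / 2 + (β - α) / 2 * cos ψ, ?_, ?_⟩
  · simp only [hN, mem_ofPred_eq, Classical.not_imp]
    refine ⟨⟨?_, ?_⟩, hcon⟩ <;> nlinarith
  · simp only [f]
    rw [add_sub_cancel_left, mul_div_cancel_left₀ _ (by linarith), arccos_cos hψ.1.le hψ.2.le]

lemma arc_mem {α β : ℝ} (h : α < β) (ψ : ℝ) :
    (α + β) / 2 + (β - α) / 2 * cos ψ ∈ Icc α β := by
  have h1 := neg_one_le_cos ψ
  have h2 := cos_le_one ψ
  constructor <;> nlinarith

/-- Duality between the potential of a density and the potential of an arcsine distribution. -/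
lemma integral_arcPot {L α β c : ℝ} (h : α < β) (hα : 0 ≤ α) (hβ : β ≤ L) {τ : ℝ → ℝ}
    (hτ : BddMeas τ) (hc : ∀ᵐ x ∂volume, x ∈ Ioo α β → logPot L τ x = c) :
    Integrable (arcPot α β) (volume.restrict (Icc 0 L)) ∧
    ∫ y in Icc 0 L, arcPot α β y * τ y = c := by
  set u : ℝ → ℝ := fun ψ => (α + β) / 2 + (β - α) / 2 * cos ψ with hu
  have hI : Integrable (fun p : ℝ × ℝ => log |u p.1 - p.2|)
      ((volume.restrict (Ioc 0 π)).prod (volume.restrict (Icc 0 L))) :=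
    integrable_log_abs_sub _ (by fun_prop) (ae_of_all _ fun ψ =>
      ⟨hα.trans (arc_mem h ψ).1, (arc_mem h ψ).2.trans hβ⟩)
  have hI2 := Integrable.mul_bddMeas hI hτ measurable_snd
  have e : ∀ y, arcPot α β y = π⁻¹ * ∫ ψ in Ioc 0 π, log |u ψ - y| := fun y => by
    rw [arcPot, intervalIntegral.integral_of_le pi_pos.le]
    simp only [hu, abs_sub_comm y]
  refine ⟨?_, ?_⟩
  · have : arcPot α β = fun y => π⁻¹ * ∫ ψ in Ioc 0 π, log |u ψ - y| := funext e
    rw [this]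
    exact hI.integral_prod_right.const_mul _
  · simp only [e]
    have e2 : ∀ y, (π⁻¹ * ∫ ψ in Ioc 0 π, log |u ψ - y|) * τ y
        = π⁻¹ * ∫ ψ in Ioc 0 π, log |u ψ - y| * τ y := fun y => by
      rw [integral_mul_const]; ring
    simp only [e2]
    rw [integral_const_mul, ← integral_integral_swap hI2]
    have e3 : ∀ᵐ ψ ∂(volume.restrict (Ioc 0 π)), ∫ y in Icc 0 L, log |u ψ - y| * τ y = c :=
      ae_arc_mem h hc
    rw [integral_congr_ae e3]
    have hpi := pi_ne_zero
    simp only [MeasureTheory.integral_const, measureReal_restrict_apply_univ,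
      Real.volume_real_Ioc_of_le pi_pos.le, smul_eq_mul]
    field_simp
    ring

end EulerLagrange

end

end CutHexagon

/-! ### Endpoint equations from varying the end of the arcsine law. -/

namespace CutHexagon

noncomputable section

open Real Filter Topology

/-- Primitive of the arcsine potential, in terms of the square roots of the distances to the
endpoints. -/
def potPrim (X Y : ℝ) : ℝ := (X ^ 2 + Y ^ 2) * log ((X + Y) / 2) - X * Y

lemma hasDerivAt_potPrim {X Y : ℝ → ℝ} {X' Y' t : ℝ} (hX : HasDerivAt X X' t)
    (hY : HasDerivAt Y Y' t) (hpos : 0 < X t + Y t) :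
    HasDerivAt (fun s => potPrim (X s) (Y s))
      ((2 * X t * X' + 2 * Y t * Y') * log ((X t + Y t) / 2)
        + (X t ^ 2 + Y t ^ 2) * ((X' + Y') / (X t + Y t)) - (X' * Y t + X t * Y')) t := by
  have h1 := ((hX.pow 2).add (hY.pow 2)).mul (((hX.add hY).div_const 2).log (by
    simp only [Pi.add_apply]; linarith))
  have h2 := h1.sub (hX.mul hY)
  refine (h2.congr_deriv ?_)
  simp only [Pi.add_apply, Pi.pow_apply]
  have := hpos.ne'
  field_simp
  ring

lemma hasDerivAt_sqrt_sub_const {c t : ℝ} (h : c < t) :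
    HasDerivAt (fun s => √(s - c)) (1 / (2 * √(t - c))) t := by
  have := ((hasDerivAt_id t).sub_const c).sqrt (by simpa using (by linarith : t - c ≠ 0))
  simpa using this

lemma hasDerivAt_sqrt_const_sub {c t : ℝ} (h : t < c) :
    HasDerivAt (fun s => √(c - s)) (-1 / (2 * √(c - t))) t := by
  have := ((hasDerivAt_id t).const_sub c).sqrt (by simpa using (by linarith : c - t ≠ 0))
  simpa using this

lemma continuous_logSum {α β : ℝ} (h : α < β) :
    Continuous fun y => log ((√|y - α| + √|y - β|) / 2) := by
  refine Continuous.log (by fun_prop) fun y => ?_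
  have : 0 < √|y - α| + √|y - β| := by
    rcases eq_or_ne y α with rfl | hy
    · have : 0 < √|y - β| := sqrt_pos.2 (abs_pos.2 (by linarith : y - β < 0).ne)
      positivity
    · have : 0 < √|y - α| := sqrt_pos.2 (abs_pos.2 (sub_ne_zero.2 hy))
      positivity
  positivity

lemma integral_arcPot_left {α β u v : ℝ} (h : α < β) (huv : u ≤ v) (hv : v < α) :
    ∫ y in u..v, arcPot α β y
      = potPrim (√(α - u)) (√(β - u)) - potPrim (√(α - v)) (√(β - v)) := by
  have e : ∀ y ∈ uIcc u v, arcPot α β y = 2 * log ((√|y - α| + √|y - β|) / 2) := fun y hy => by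
    rw [uIcc_of_le huv] at hy
    exact arcPot_outside h (Or.inl (by linarith [hy.2]))
  rw [intervalIntegral.integral_congr e, intervalIntegral.integral_eq_sub_of_hasDerivAt
    (f := fun y => -potPrim (√(α - y)) (√(β - y)))]
  · ring
  · intro y hy
    rw [uIcc_of_le huv] at hy
    have h1 : y < α := by linarith [hy.2]
    have hX : 0 < √(α - y) := sqrt_pos.2 (by linarith)
    have hY : 0 < √(β - y) := sqrt_pos.2 (by linarith)
    refine ((hasDerivAt_potPrim (hasDerivAt_sqrt_const_sub h1)
      (hasDerivAt_sqrt_const_sub (h1.trans h)) (by positivity)).neg).congr_deriv ?_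
    rw [abs_sub_comm y, abs_sub_comm y, abs_of_pos (by linarith : 0 < α - y),
      abs_of_pos (by linarith : 0 < β - y)]
    field_simp
    ring
  · exact ((continuous_logSum h).const_mul 2).intervalIntegrable _ _

lemma integral_arcPot_right {α β u v : ℝ} (h : α < β) (huv : u ≤ v) (hu : β < u) :
    ∫ y in u..v, arcPot α β y
      = potPrim (√(v - α)) (√(v - β)) - potPrim (√(u - α)) (√(u - β)) := by
  have e := intervalIntegral.integral_comp_neg (fun y => arcPot α β (-y)) (a := u) (b := v)
  simp only [neg_neg] at e
  have e2 : ∀ y, arcPot α β (-y) = arcPot (-β) (-α) y := fun y => by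
    rw [← arcPot_reflect, neg_neg]
  rw [e]
  simp only [e2]
  rw [integral_arcPot_left (neg_lt_neg h) (neg_le_neg huv) (neg_lt_neg hu), neg_sub_neg,
    neg_sub_neg, neg_sub_neg, neg_sub_neg]
  simp only [potPrim]
  rw [add_comm (√(v - β)), add_comm (√(u - β)), add_comm (√(v - β) ^ 2),
    add_comm (√(u - β) ^ 2), mul_comm (√(v - β)), mul_comm (√(u - β))]

/-- The contribution of a point with distances `X²`, `Y²` to `a`, `b` to the equation obtained by
moving the endpoint `a`. -/
def endTerm (X Y : ℝ) : ℝ := (Y - X) / (2 * (X + Y)) - log ((X + Y) / 2)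

lemma hasDerivAt_potPrim_left {a b y : ℝ} (hab : a < b) (hy : y < a) :
    HasDerivAt (fun α => potPrim (√(α - y)) (√(b - y))) (-endTerm (√(a - y)) (√(b - y))) a := by
  have hX : 0 < √(a - y) := sqrt_pos.2 (by linarith)
  have hY : 0 < √(b - y) := sqrt_pos.2 (by linarith)
  refine (hasDerivAt_potPrim (hasDerivAt_sqrt_sub_const hy)
    (hasDerivAt_const a (√(b - y))) (by positivity)).congr_deriv ?_
  rw [endTerm]
  field_simp
  ring

lemma hasDerivAt_potPrim_right {a b y : ℝ} (hab : a < b) (hy : b < y) :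
    HasDerivAt (fun α => potPrim (√(y - α)) (√(y - b))) (endTerm (√(y - a)) (√(y - b))) a := by
  have hX : 0 < √(y - a) := sqrt_pos.2 (by linarith)
  have hY : 0 < √(y - b) := sqrt_pos.2 (by linarith)
  refine (hasDerivAt_potPrim (hasDerivAt_sqrt_const_sub (hab.trans hy))
    (hasDerivAt_const a (√(y - b))) (by positivity)).congr_deriv ?_
  rw [endTerm]
  field_simp
  ring

/-- A function with a derivative at `a` that is `o(x - a)` from the right has derivative zero. -/
lemma deriv_eq_zero_of_abs_le {H B : ℝ → ℝ} {a b d : ℝ} (hab : a < b) (hH : HasDerivAt H d a)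
    (hHa : H a = 0) (hB : Tendsto B (𝓝[>] a) (𝓝 0))
    (hle : ∀ α ∈ Ioo a b, |H α| ≤ (α - a) * B α) : d = 0 := by
  have h1 : Tendsto (slope H a) (𝓝[>] a) (𝓝 d) := (hasDerivAt_iff_tendsto_slope.1 hH).mono_left
    (nhdsWithin_mono a fun x hx => (mem_Ioi.1 hx).ne')
  have h2 : Tendsto (slope H a) (𝓝[>] a) (𝓝 0) := by
    refine squeeze_zero_norm' ?_ hB
    filter_upwards [Ioo_mem_nhdsGT hab] with α hα
    have h3 : 0 < α - a := by linarith [hα.1]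
    rw [slope_def_field, hHa, sub_zero, norm_div, Real.norm_eq_abs, Real.norm_eq_abs,
      abs_of_pos h3, div_le_iff₀ h3]
    linarith [hle α hα]
  exact tendsto_nhds_unique h1 h2

/-- To the left of the arc [α,b] the potential exceeds its value on the arc, by at most the bound at
y = a. That bound tends to 0 as α → a. -/
lemma arcPot_sub_bounds {a α b y : ℝ} (hαb : α < b) (hay : a ≤ y) (hy : y ≤ α) :
    0 ≤ arcPot α b y - log ((b - α) / 4) ∧ arcPot α b y - log ((b - α) / 4)
      ≤ 2 * log ((√(α - a) + √(b - a)) / 2) - log ((b - α) / 4) := by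
  rw [arcPot_outside hαb (Or.inl hy), abs_sub_comm y, abs_sub_comm y,
    abs_of_nonneg (by linarith : 0 ≤ α - y), abs_of_nonneg (by linarith : 0 ≤ b - y)]
  have hY : 0 < √(b - y) := sqrt_pos.2 (by linarith)
  have hX : 0 ≤ √(α - y) := sqrt_nonneg _
  constructor
  · rw [sub_nonneg]
    have e : 2 * log ((√(α - y) + √(b - y)) / 2) = log (((√(α - y) + √(b - y)) / 2) ^ 2) := by
      rw [log_pow]; norm_num
    rw [e]
    apply log_le_log (by linarith)
    have h1 := sq_sqrt (by linarith : 0 ≤ α - y)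
    have h2 := sq_sqrt (by linarith : 0 ≤ b - y)
    nlinarith [mul_nonneg hX hY.le]
  · have : log ((√(α - y) + √(b - y)) / 2) ≤ log ((√(α - a) + √(b - a)) / 2) := by
      apply log_le_log (by positivity)
      gcongr
    linarith

/-- Hypotheses on the complementary density of a minimizer of generic shape. -/
structure HoleData (L ν θ a b : ℝ) (τ : ℝ → ℝ) : Prop where
  nonneg : 0 ≤ ν
  lower : ν < a
  middle : a < b
  upper : b < θ
  le_top : θ ≤ L
  measurable : Measurable τ
  pos : ∀ x, 0 ≤ τ x
  le_one : ∀ x, τ x ≤ 1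
  eq_one : ∀ᵐ x ∂volume, x ∈ Ioo 0 ν ∪ Ioo θ L → τ x = 1
  eq_zero : ∀ᵐ x ∂volume, x ∈ Ioo ν a ∪ Ioo b θ → τ x = 0
  pot : ∃ c, ∀ᵐ x ∂volume, x ∈ Ioo a b → logPot L τ x = c

namespace HoleData

variable {L ν θ a b : ℝ} {τ : ℝ → ℝ}

lemma bddMeas (h : HoleData L ν θ a b τ) : BddMeas τ := BddMeas.of_unit h.measurable h.pos h.le_one

lemma intervalIntegrable (h : HoleData L ν θ a b τ) (x y : ℝ) : IntervalIntegrable τ volume x y :=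
  ⟨h.bddMeas.integrable _, h.bddMeas.integrable _⟩

lemma setIntegral_eq_add (h : HoleData L ν θ a b τ) {f : ℝ → ℝ}
    (hf : Integrable f (volume.restrict (Icc 0 L))) :
    ∫ y in Icc 0 L, f y * τ y
      = (∫ y in (0 : ℝ)..ν, f y) + (∫ y in a..b, f y * τ y) + ∫ y in θ..L, f y := by
  obtain ⟨h0, h1, h2, h3, h4, hm, hp, hp1, he1, he0, -⟩ := id h
  have hfτ : Integrable (fun y => f y * τ y) (volume.restrict (Icc 0 L)) :=
    Integrable.mul_bddMeas hf h.bddMeas measurable_id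
  have hi : ∀ x y, 0 ≤ x → x ≤ y → y ≤ L → IntervalIntegrable (fun y => f y * τ y) volume x y :=
    fun x y hx hxy hy => by
      rw [intervalIntegrable_iff_integrableOn_Icc_of_le hxy]
      exact IntegrableOn.mono_set hfτ (Icc_subset_Icc hx hy)
  have hone : ∀ x y, x ≤ y → (∀ᵐ z ∂volume, z ∈ Ioo x y → τ z = 1) →
      ∫ z in x..y, f z * τ z = ∫ z in x..y, f z := fun x y hxy hz => by
    rw [intervalIntegral.integral_of_le hxy, intervalIntegral.integral_of_le hxy,
      integral_Ioc_eq_integral_Ioo, integral_Ioc_eq_integral_Ioo]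
    refine setIntegral_congr_ae measurableSet_Ioo ?_
    filter_upwards [hz] with z hz hzm
    rw [hz hzm, mul_one]
  have hzero : ∀ x y, x ≤ y → (∀ᵐ z ∂volume, z ∈ Ioo x y → τ z = 0) →
      ∫ z in x..y, f z * τ z = 0 := fun x y hxy hz => by
    rw [intervalIntegral.integral_of_le hxy, integral_Ioc_eq_integral_Ioo]
    refine setIntegral_eq_zero_of_ae_eq_zero ?_
    filter_upwards [hz] with z hz hzm
    rw [hz hzm, mul_zero]
  rw [integral_Icc_eq_integral_Ioc, ← intervalIntegral.integral_of_le (by linarith),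
    ← intervalIntegral.integral_add_adjacent_intervals (b := ν)
      (hi 0 ν le_rfl h0 (by linarith)) (hi ν L h0 (by linarith) le_rfl),
    ← intervalIntegral.integral_add_adjacent_intervals (a := ν) (b := a)
      (hi ν a h0 h1.le (by linarith)) (hi a L (by linarith) (by linarith) le_rfl),
    ← intervalIntegral.integral_add_adjacent_intervals (a := a) (b := b)
      (hi a b (by linarith) h2.le (by linarith)) (hi b L (by linarith) (by linarith) le_rfl),
    ← intervalIntegral.integral_add_adjacent_intervals (a := b) (b := θ)
      (hi b θ (by linarith) h3.le (by linarith)) (hi θ L (by linarith) (by linarith) le_rfl),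
    hone 0 ν h0 (by filter_upwards [he1] with z hz hz' using hz (Or.inl hz')),
    hone θ L h4 (by filter_upwards [he1] with z hz hz' using hz (Or.inr hz')),
    hzero ν a h1.le (by filter_upwards [he0] with z hz hz' using hz (Or.inl hz')),
    hzero b θ h3.le (by filter_upwards [he0] with z hz hz' using hz (Or.inr hz'))]
  ring

/-- On [α,b] the arcsine potential is the constant log((b-α)/4), so the error lives on [a,α]. Only 0
≤ τ ≤ 1 is needed there: a length α-a times a quantity tending to 0 is o(α-a). -/
lemma abs_edge_le (h : HoleData L ν θ a b τ) {α : ℝ} (hα : α ∈ Ico a b)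
    (hi : Integrable (arcPot α b) (volume.restrict (Icc 0 L))) :
    |(∫ y in a..b, arcPot α b y * τ y) - log ((b - α) / 4) * ∫ y in a..b, τ y|
      ≤ (α - a) * (2 * log ((√(α - a) + √(b - a)) / 2) - log ((b - α) / 4)) := by
  obtain ⟨h0, h1, h2, h3, h4, hm, hp, hp1, -, -, -⟩ := id h
  have hii : ∀ x y, a ≤ x → x ≤ y → y ≤ b →
      IntervalIntegrable (fun y => (arcPot α b y - log ((b - α) / 4)) * τ y) volume x y :=
    fun x y hx hxy hy => by
      rw [intervalIntegrable_iff_integrableOn_Icc_of_le hxy]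
      exact IntegrableOn.mono_set (Integrable.mul_bddMeas (hi.sub (integrable_const _))
        h.bddMeas measurable_id) (Icc_subset_Icc (by linarith) (by linarith))
  have hiτ : IntervalIntegrable (fun y => arcPot α b y * τ y) volume a b := by
    rw [intervalIntegrable_iff_integrableOn_Icc_of_le h2.le]
    exact IntegrableOn.mono_set (Integrable.mul_bddMeas hi h.bddMeas measurable_id)
      (Icc_subset_Icc (by linarith) (by linarith))
  have e : (∫ y in a..b, arcPot α b y * τ y) - log ((b - α) / 4) * ∫ y in a..b, τ y
      = ∫ y in a..α, (arcPot α b y - log ((b - α) / 4)) * τ y := by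
    rw [← intervalIntegral.integral_const_mul,
      ← intervalIntegral.integral_sub hiτ ((h.intervalIntegrable a b).const_mul _)]
    simp only [← sub_mul]
    rw [← intervalIntegral.integral_add_adjacent_intervals (hii a α le_rfl hα.1 hα.2.le)
      (hii α b hα.1 hα.2.le le_rfl)]
    have : ∫ y in α..b, (arcPot α b y - log ((b - α) / 4)) * τ y = ∫ y in α..b, 0 := by
      apply intervalIntegral.integral_congr
      intro y hy
      rw [uIcc_of_le hα.2.le] at hy
      simp only [arcPot_inside hα.2 hy, sub_self, zero_mul]
    rw [this]
    simp
  rw [e, ← Real.norm_eq_abs]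
  refine (intervalIntegral.norm_integral_le_of_norm_le_const
    (C := 2 * log ((√(α - a) + √(b - a)) / 2) - log ((b - α) / 4)) fun y hy => ?_).trans ?_
  · rw [uIoc_of_le hα.1] at hy
    obtain ⟨g1, g2⟩ := arcPot_sub_bounds hα.2 hy.1.le hy.2
    rw [norm_mul, Real.norm_of_nonneg g1, Real.norm_of_nonneg (hp y)]
    exact (mul_le_of_le_one_right g1 (hp1 y)).trans g2
  · rw [abs_of_nonneg (by linarith [hα.1]), mul_comm]

/-- The equation obtained by moving the left endpoint. -/
lemma left_endpoint (h : HoleData L ν θ a b τ) :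
    endTerm (√(a - ν)) (√(b - ν)) - endTerm (√a) (√b)
      + endTerm (√(L - a)) (√(L - b)) - endTerm (√(θ - a)) (√(θ - b))
      = (∫ y in a..b, τ y) / (b - a) := by
  obtain ⟨h0, h1, h2, h3, h4, hm, hp, hp1, -, -, c, hc⟩ := id h
  set M := ∫ y in a..b, τ y with hM
  have key : ∀ α ∈ Ico a b, Integrable (arcPot α b) (volume.restrict (Icc 0 L)) ∧
      ∫ y in a..b, arcPot α b y * τ y
        = c - (potPrim (√(α - 0)) (√(b - 0)) - potPrim (√(α - ν)) (√(b - ν)))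
          - (potPrim (√(L - α)) (√(L - b)) - potPrim (√(θ - α)) (√(θ - b))) := by
    intro α hα
    obtain ⟨i1, i2⟩ := integral_arcPot (L := L) hα.2 (by linarith [hα.1]) (by linarith) h.bddMeas
      (c := c) (by filter_upwards [hc] with x hx hx' using hx ⟨by linarith [hα.1, hx'.1], hx'.2⟩)
    refine ⟨i1, ?_⟩
    rw [h.setIntegral_eq_add i1, integral_arcPot_left hα.2 h0 (by linarith [hα.1]),
      integral_arcPot_right hα.2 h4 h3] at i2
    linarith
  -- H is the contribution of (a,b) minus its leading part log((b-α)/4)·M, rewritten through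
  -- duality: τ is 1 on the forbidden intervals and 0 on the bands, so everything else is an
  -- explicit function of α, differentiable at a. Being o(α-a), H has derivative 0 there, and this
  -- is the endpoint equation.
  set H : ℝ → ℝ := fun α => c - (potPrim (√(α - 0)) (√(b - 0)) - potPrim (√(α - ν)) (√(b - ν)))
    - (potPrim (√(L - α)) (√(L - b)) - potPrim (√(θ - α)) (√(θ - b)))
    - log ((b - α) / 4) * M with hH
  have hHle : ∀ α ∈ Ico a b, |H α|
      ≤ (α - a) * (2 * log ((√(α - a) + √(b - a)) / 2) - log ((b - α) / 4)) := by
    intro α hα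
    obtain ⟨i1, i2⟩ := key α hα
    have := h.abs_edge_le hα i1
    rw [i2] at this
    exact this
  have hlog : HasDerivAt (fun α => log ((b - α) / 4)) (-1 / (b - a)) a := by
    have := (((hasDerivAt_id a).const_sub b).div_const 4).log
      (by simpa using (by linarith : b - a ≠ 0))
    refine this.congr_deriv ?_
    have : b - a ≠ 0 := by linarith
    simp only [id]
    field_simp
  have hd := ((((hasDerivAt_const a c).sub ((hasDerivAt_potPrim_left h2 (by linarith : 0 < a)).sub
    (hasDerivAt_potPrim_left h2 h1))).sub ((hasDerivAt_potPrim_right h2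
      (by linarith : b < L)).sub (hasDerivAt_potPrim_right h2 h3))).sub (hlog.mul_const M))
  have hHa : H a = 0 := by
    have := hHle a ⟨le_rfl, h2⟩
    rw [sub_self, zero_mul] at this
    exact abs_nonpos_iff.1 this
  have hB : Tendsto (fun α => 2 * log ((√(α - a) + √(b - a)) / 2) - log ((b - α) / 4))
      (𝓝[>] a) (𝓝 0) := by
    have hba : 0 < √(b - a) := sqrt_pos.2 (by linarith)
    have : ContinuousAt (fun α => 2 * log ((√(α - a) + √(b - a)) / 2) - log ((b - α) / 4)) a := by
      refine ContinuousAt.sub (ContinuousAt.mul continuousAt_const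
        (ContinuousAt.log (by fun_prop) ?_)) (ContinuousAt.log (by fun_prop) ?_)
      · simp only [sub_self, sqrt_zero, zero_add]
        positivity
      · linarith
    have h5 := this.tendsto
    have e : 2 * log ((√(a - a) + √(b - a)) / 2) - log ((b - a) / 4) = 0 := by
      have e1 : 2 * log (√(b - a) / 2) = log ((√(b - a) / 2) ^ 2) := by rw [log_pow]; norm_num
      rw [sub_self, sqrt_zero, zero_add, e1, div_pow, sq_sqrt (by linarith)]
      norm_num
    rw [e] at h5
    exact h5.mono_left nhdsWithin_le_nhds
  have := deriv_eq_zero_of_abs_le (H := H) h2 hd hHa hB fun α hα => hHle α ⟨hα.1.le, hα.2⟩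
  simp only [sub_zero] at this
  have e : -1 / (b - a) * M = -(M / (b - a)) := by ring
  rw [e] at this
  linarith

/-- The hypotheses are symmetric under x ↦ L-x, so the equation at b comes from the one at a. -/
lemma reflect (h : HoleData L ν θ a b τ) :
    HoleData L (L - θ) (L - ν) (L - b) (L - a) (fun x => τ (L - x)) := by
  obtain ⟨h0, h1, h2, h3, h4, hm, hp, hp1, he1, he0, c, hc⟩ := h
  have hq : Measure.QuasiMeasurePreserving (fun x : ℝ => L - x) volume volume :=
    (Measure.measurePreserving_sub_left volume L).quasiMeasurePreserving
  refine ⟨by linarith, by linarith, by linarith, by linarith, by linarith,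
    hm.comp (measurable_const.sub measurable_id), fun x => hp _, fun x => hp1 _, ?_, ?_, c, ?_⟩
  · filter_upwards [hq.ae he1] with x hx hx'
    refine hx ?_
    rcases hx' with ⟨h5, h6⟩ | ⟨h5, h6⟩
    · exact Or.inr ⟨by linarith, by linarith⟩
    · exact Or.inl ⟨by linarith, by linarith⟩
  · filter_upwards [hq.ae he0] with x hx hx'
    refine hx ?_
    rcases hx' with ⟨h5, h6⟩ | ⟨h5, h6⟩
    · exact Or.inr ⟨by linarith, by linarith⟩
    · exact Or.inl ⟨by linarith, by linarith⟩
  · filter_upwards [hq.ae hc] with x hx hx'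
    rw [← hx ⟨by linarith [hx'.2], by linarith [hx'.1]⟩, logPot, logPot,
      ← integral_reflect L (fun y => log |L - x - y| * τ y)]
    congr 1 with y
    rw [sub_sub_sub_cancel_left, abs_sub_comm]

lemma right_endpoint (h : HoleData L ν θ a b τ) :
    endTerm (√(θ - b)) (√(θ - a)) - endTerm (√(L - b)) (√(L - a))
      + endTerm (√b) (√a) - endTerm (√(b - ν)) (√(a - ν)) = (∫ y in a..b, τ y) / (b - a) := by
  have := h.reflect.left_endpoint
  rw [intervalIntegral.integral_comp_sub_left τ L] at this
  simpa only [sub_sub_sub_cancel_left, sub_sub_cancel] using this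

end HoleData

end

end CutHexagon

/-! ### From a generic minimizer to the endpoint equations. -/

namespace CutHexagon

noncomputable section

open Real Filter Topology

lemma IsMinimizer.holeData {lam ν θ a b : ℝ} {ρ : ℝ → ℝ} (hlam : 0 < lam) (hν : 0 ≤ ν)
    (hθ : θ ≤ lam + 1) (hρ : IsMinimizer lam ν θ ρ) (hg : GenericShape ν θ a b ρ) :
    HoleData (lam + 1) ν θ a b (fun x => 1 - ρ x) where
  nonneg := hν
  lower := hg.lower
  middle := hg.middle
  upper := hg.upper
  le_top := hθ
  measurable := measurable_const.sub hρ.1.measurable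
  pos x := sub_nonneg.2 (hρ.1.le_one x)
  le_one x := by linarith [hρ.1.nonneg x]
  eq_one := ae_of_all _ fun x hx => by
    rw [hρ.1.forbidden x, sub_zero]
    rintro ⟨h1, h2⟩
    rcases hx with hx | hx
    · exact not_lt.2 h1 hx.2
    · exact not_lt.2 h2 hx.1
  eq_zero := by
    filter_upwards [hg.eq_one] with x hx hx'
    rw [hx (hx'.imp (fun h => Ioo_subset_Icc_self h) (fun h => Ioo_subset_Icc_self h)), sub_self]
  pot := hρ.exists_logPot_eq hlam hν hθ hg

/-- The endpoints of a minimizer of generic shape satisfy the endpoint equations. -/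
lemma IsMinimizer.endpointEqs {lam ν θ a b : ℝ} {ρ : ℝ → ℝ} (hlam : 0 < lam) (hν : 0 ≤ ν)
    (hθ : θ ≤ lam + 1) (hρ : IsMinimizer lam ν θ ρ) (hg : GenericShape ν θ a b ρ) :
    EndpointEqs lam ν θ a b := by
  have hd := hρ.holeData hlam hν hθ hg
  have h1 := hg.lower
  have h2 := hg.middle
  have h3 := hg.upper
  have hA := hd.left_endpoint
  have hB := hd.right_endpoint
  have hM : ∫ y in a..b, (1 - ρ y) = lam - ν - (lam + 1 - θ) := by
    have e := hd.setIntegral_eq_add (f := fun _ => 1) (integrable_const _)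
    simp only [one_mul, intervalIntegral.integral_const, smul_eq_mul, mul_one, sub_zero] at e
    rw [integral_sub (integrable_const _) (hρ.1.bddMeas.integrable _),
      integral_Icc_eq_of_forbidden hν (by linarith) hθ hρ.1.forbidden, hρ.1.mass] at e
    simp only [MeasureTheory.integral_const, measureReal_restrict_apply_univ, smul_eq_mul, mul_one,
      Real.volume_real_Icc_of_le (by linarith : 0 ≤ lam + 1)] at e
    linarith
  rw [hM] at hA hB
  -- Rationalizing with Y² - X² = b-a: (Y-X)/(X+Y) = (Y-X)²/(b-a).
  have left : ∀ y, y < a → 0 < √(a - y) ∧ 0 < √(b - y) ∧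
      (√(b - y) - √(a - y)) / (2 * (√(a - y) + √(b - y)))
        = (a + b - 2 * y - 2 * (√(a - y) * √(b - y))) / (2 * (b - a)) := by
    intro y hy
    have hX : 0 < √(a - y) := sqrt_pos.2 (by linarith)
    have hY : 0 < √(b - y) := sqrt_pos.2 (by linarith)
    refine ⟨hX, hY, ?_⟩
    have hX2 := sq_sqrt (by linarith : 0 ≤ a - y)
    have hY2 := sq_sqrt (by linarith : 0 ≤ b - y)
    rw [div_eq_div_iff (by positivity) (by linarith)]
    generalize √(a - y) = X at *
    generalize √(b - y) = Y at *
    obtain rfl : a = X ^ 2 + y := by linarith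
    obtain rfl : b = Y ^ 2 + y := by linarith
    ring
  have right : ∀ y, b < y → 0 < √(y - a) ∧ 0 < √(y - b) ∧
      (√(y - b) - √(y - a)) / (2 * (√(y - a) + √(y - b)))
        = -(2 * y - a - b - 2 * (√(y - a) * √(y - b))) / (2 * (b - a)) := by
    intro y hy
    have hX : 0 < √(y - a) := sqrt_pos.2 (by linarith)
    have hY : 0 < √(y - b) := sqrt_pos.2 (by linarith)
    refine ⟨hX, hY, ?_⟩
    have hX2 := sq_sqrt (by linarith : 0 ≤ y - a)
    have hY2 := sq_sqrt (by linarith : 0 ≤ y - b)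
    rw [div_eq_div_iff (by positivity) (by linarith)]
    generalize √(y - a) = X at *
    generalize √(y - b) = Y at *
    obtain rfl : a = y - X ^ 2 := by linarith
    obtain rfl : b = y - Y ^ 2 := by linarith
    ring
  -- Exchanging the arguments flips the rational part of `endTerm` and keeps the logarithm. Hence
  -- `hA` minus `hB` contains only logarithms and yields `force`, while `hA` plus `hB` contains only
  -- rational parts and yields `mass`.
  have swap : ∀ X Y : ℝ, endTerm Y X = -((Y - X) / (2 * (X + Y))) - log ((X + Y) / 2) := by
    intro X Y
    rw [endTerm, ← neg_div, neg_sub, add_comm Y X]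
  rw [swap, swap (√(lam + 1 - a)), swap (√a), swap (√(a - ν))] at hB
  simp only [endTerm] at hA
  obtain ⟨p1, p2, e1⟩ := left 0 (by linarith)
  obtain ⟨q1, q2, e2⟩ := left ν h1
  obtain ⟨r1, r2, e3⟩ := right θ h3
  obtain ⟨s1, s2, e4⟩ := right (lam + 1) (by linarith)
  simp only [sub_zero] at p1 p2 e1
  refine ⟨hlam, hν, h1, h2, h3, hθ, ?_, ?_⟩
  · have hl : log ((√a + √b) / 2) + log ((√(θ - a) + √(θ - b)) / 2)
        = log ((√(lam + 1 - a) + √(lam + 1 - b)) / 2) + log ((√(a - ν) + √(b - ν)) / 2) := by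
      linarith
    rw [← log_mul (by positivity) (by positivity), ← log_mul (by positivity) (by positivity)] at hl
    have := log_injOn_pos (mem_Ioi.2 (by positivity)) (mem_Ioi.2 (by positivity)) hl
    linarith
  · rw [e1, e2, e3, e4] at hA hB
    have hba : 0 < b - a := by linarith
    have e5 : (lam - ν - (lam + 1 - θ)) / (b - a)
        = (2 * (lam - ν - (lam + 1 - θ))) / (2 * (b - a)) := by
      rw [mul_div_mul_left _ _ two_ne_zero]
    rw [e5] at hA hB
    have hsum : (a + b - 2 * ν - 2 * (√(a - ν) * √(b - ν))) / (2 * (b - a))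
        - (a + b - 2 * 0 - 2 * (√a * √b)) / (2 * (b - a))
        + -(2 * (lam + 1) - a - b - 2 * (√(lam + 1 - a) * √(lam + 1 - b))) / (2 * (b - a))
        - -(2 * θ - a - b - 2 * (√(θ - a) * √(θ - b))) / (2 * (b - a))
        = (2 * (lam - ν - (lam + 1 - θ))) / (2 * (b - a)) := by
      linarith
    rw [← sub_div, ← add_div, ← sub_div, div_left_inj' (by positivity)] at hsum
    linarith

/-! ### Solving the endpoint equations. -/

/-- The endpoint equations in terms of Joukowski coordinates have a unique solution. -/
lemma endpoint_algebra {lam ν θ m p q p' q' e : ℝ} (hlam : 0 < lam) (hp : 0 < p) (hq : 0 < q)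
    (hp' : 0 < p') (hD : 1 < θ - ν) (h1 : θ - m = p + e / p)
    (h2 : lam + 1 - m = p' + e / p') (h3 : m - ν = q + e / q) (h4 : m = q' + e / q')
    (h5 : q' * p = p' * q)
    (h6 : (p' - e / p') - (p - e / p) + (q' - e / q') - (q - e / q) = lam) :
    m = U lam ν θ / (4 * lam ^ 2) ∧ 64 * lam ^ 4 * e = V lam ν θ := by
  -- The force equation says that p'/p and q'/q are equal; their common value k replaces p' and q'.
  obtain ⟨k, rfl⟩ : ∃ k, p' = k * p := ⟨p' / p, by field_simp⟩
  have hk : 0 < k := pos_of_mul_pos_left hp' hp.le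
  obtain rfl : q' = k * q := by
    apply mul_right_cancel₀ hp.ne'
    rw [h5]; ring
  set t := e / p + e / q with ht
  have hkp : e / (k * p) = e / p / k := by field_simp
  have hkq : e / (k * q) = e / q / k := by field_simp
  rw [hkp] at h2 h6
  rw [hkq] at h4 h6
  -- In the symmetric unknowns p+q and t the system decouples: `a1` and `a2` express them through k,
  -- and p+q+t = θ-ν then fixes k in `a3`.
  have a1 : 2 * (k - 1) * (p + q) = 2 * lam + 1 - (θ - ν) := by
    linear_combination h1 + h3 - h2 - h4 + h6
  have a2 : 2 * (k - 1) * t = k * (θ - ν - 1) := by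
    have : 2 * (t - t / k) = θ - ν - 1 := by
      rw [ht, add_div]
      linear_combination h6 - h1 - h3 + h2 + h4
    rw [← this]
    field_simp
  have a3 : k * (1 + (θ - ν)) = 2 * lam + 1 + (θ - ν) := by
    have : θ - ν = p + q + t := by rw [ht]; linear_combination h1 + h3
    linear_combination 2 * (k - 1) * this + a1 + a2
  have hD1 : 0 < 1 + (θ - ν) := by linarith
  have hk1 : (k - 1) * (1 + (θ - ν)) = 2 * lam := by linear_combination a3
  have hs : 4 * lam * (p + q) = (2 * lam + 1 - (θ - ν)) * (1 + (θ - ν)) := by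
    rw [← a1]
    linear_combination (-2) * (p + q) * hk1
  have htv : 4 * lam * t = (2 * lam + 1 + (θ - ν)) * (θ - ν - 1) := by
    rw [← a3]
    linear_combination (1 + (θ - ν)) * a2 - 2 * t * hk1
  have hst : t * (p * q) = e * (p + q) := by
    rw [ht]; field_simp; ring
  have hep : e / p * (p + q) = q * t := by
    rw [ht]; field_simp; ring
  have b1 : (k - 1) * (k * p - e / p) = k * (lam + 1 - θ) := by
    have : lam + 1 - θ = k * p + e / p / k - p - e / p := by linear_combination h2 - h1
    rw [this]; field_simp; ring
  have hs0 : p + q ≠ 0 := by positivity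
  have b2 : k * (p + q) + t = k * (1 + (θ - ν)) / 2 := by
    apply mul_left_cancel₀ (by positivity : 4 * lam ≠ 0)
    linear_combination k * hs + htv - (θ - ν - 1) * a3
  -- The asymmetric relation h2 - h1 splits p+q into p and q; then t = e(p+q)/(pq) determines e.
  have b3 : 2 * lam * p = (p + q) * (2 * lam + 1 - (θ + ν)) := by
    apply mul_left_cancel₀ hk.ne'
    linear_combination 2 * (p + q) * b1 + 2 * (k - 1) * hep - 2 * (k - 1) * p * b2
      - k * p * hk1 + (p + q) * a2
  have b4 : 2 * lam * q = (p + q) * (θ + ν - 1) := by linear_combination -b3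
  have b5 : 4 * lam ^ 2 * e = t * (p + q) * (2 * lam + 1 - (θ + ν)) * (θ + ν - 1) := by
    apply mul_right_cancel₀ hs0
    have : 4 * lam ^ 2 * e * (p + q) = t * (2 * lam * p) * (2 * lam * q) := by
      linear_combination (-4) * lam ^ 2 * hst
    rw [this, b3, b4]; ring
  have b6 : 2 * lam * (e / p) = t * (θ + ν - 1) := by
    apply mul_right_cancel₀ hs0
    linear_combination 2 * lam * hep + t * b4
  constructor
  · rw [eq_div_iff (by positivity), U]
    have hm : m = θ - p - e / p := by linear_combination -h1
    have : m * (4 * lam ^ 2) = 4 * lam ^ 2 * θ - lam * (2 * (2 * lam * p) + 2 * (2 * lam * (e / p))) := by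
      rw [hm]; ring
    rw [this, b3, b6]
    linear_combination (-1 / 2) * (2 * lam + 1 - (θ + ν)) * hs - 1 / 2 * (θ + ν - 1) * htv
  · have : 64 * lam ^ 4 * e = (4 * lam * (p + q)) * (4 * lam * t) * (2 * lam + 1 - (θ + ν))
        * (θ + ν - 1) := by
      linear_combination 16 * lam ^ 2 * b5
    rw [this, hs, htv, V]
    ring

/-- The two Joukowski branches ((X+Y)/2)² and ((X-Y)/2)² have product ((X²-Y²)/4)², and X²-Y² is b-a
for every one of the four poles. -/
lemma add_div_sqrt_sq {X Y : ℝ} (hX : 0 < X) (hY : 0 ≤ Y) :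
    ((X ^ 2 - Y ^ 2) / 4) ^ 2 / ((X + Y) ^ 2 / 4) = (X - Y) ^ 2 / 4 := by
  have : X + Y ≠ 0 := by positivity
  field_simp
  ring

lemma endA_endB_of {lam ν θ m c : ℝ} (hlam : 0 < lam) (hc : 0 ≤ c)
    (hm : m = U lam ν θ / (4 * lam ^ 2)) (hV : 64 * lam ^ 4 * c ^ 2 = V lam ν θ) :
    endA lam ν θ = m - 2 * c ∧ endB lam ν θ = m + 2 * c := by
  have hs : √(V lam ν θ) = 8 * lam ^ 2 * c := by
    rw [← hV, show 64 * lam ^ 4 * c ^ 2 = (8 * lam ^ 2 * c) ^ 2 by ring, sqrt_sq (by positivity)]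
  rw [endA, endB, hs, hm]
  constructor <;> field_simp <;> ring

/-- The endpoint equations determine the endpoints. -/
lemma EndpointEqs.eq_endA_endB {lam ν θ a b : ℝ} (h : EndpointEqs lam ν θ a b)
    (hD : 1 < θ - ν) : a = endA lam ν θ ∧ b = endB lam ν θ := by
  obtain ⟨hlam, hν, h1, h2, h3, hθ, hf, hm⟩ := h
  have pos : ∀ {x : ℝ}, 0 < x → 0 < √x ∧ √x ^ 2 = x := fun hx => ⟨sqrt_pos.2 hx, sq_sqrt hx.le⟩
  obtain ⟨p1, e1⟩ := pos (by linarith : 0 < a)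
  obtain ⟨p2, e2⟩ := pos (by linarith : 0 < b)
  obtain ⟨p3, e3⟩ := pos (by linarith : 0 < a - ν)
  obtain ⟨p4, e4⟩ := pos (by linarith : 0 < b - ν)
  obtain ⟨p5, e5⟩ := pos (by linarith : 0 < θ - a)
  obtain ⟨p6, e6⟩ := pos (by linarith : 0 < θ - b)
  obtain ⟨p7, e7⟩ := pos (by linarith : 0 < lam + 1 - a)
  obtain ⟨p8, e8⟩ := pos (by linarith : 0 < lam + 1 - b)
  have d1 := add_div_sqrt_sq p2 p1.le
  have d2 := add_div_sqrt_sq p4 p3.le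
  have d3 := add_div_sqrt_sq p5 p6.le
  have d4 := add_div_sqrt_sq p7 p8.le
  rw [e1, e2] at d1
  rw [e3, e4, (by ring : b - ν - (a - ν) = b - a)] at d2
  rw [e5, e6, (by ring : θ - a - (θ - b) = b - a)] at d3
  rw [e7, e8, (by ring : lam + 1 - a - (lam + 1 - b) = b - a)] at d4
  -- Each pole y is encoded by ((√|y-a|+√|y-b|)/2)². With e = ((b-a)/4)², this plus e over it is
  -- |y-m|, and their difference is √|y-a|√|y-b|. The force equation becomes its own square divided
  -- by 16.
  obtain ⟨hmid, hV⟩ := endpoint_algebra (lam := lam) (ν := ν) (θ := θ) (m := (a + b) / 2)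
    (p := (√(θ - a) + √(θ - b)) ^ 2 / 4) (q := (√(b - ν) + √(a - ν)) ^ 2 / 4)
    (p' := (√(lam + 1 - a) + √(lam + 1 - b)) ^ 2 / 4) (q' := (√b + √a) ^ 2 / 4)
    (e := ((b - a) / 4) ^ 2) hlam (by positivity) (by positivity) (by positivity) hD
    (by rw [d3]; linear_combination (-1 / 2) * (e5 + e6))
    (by rw [d4]; linear_combination (-1 / 2) * (e7 + e8))
    (by rw [d2]; linear_combination (-1 / 2) * (e3 + e4))
    (by rw [d1]; linear_combination (-1 / 2) * (e1 + e2))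
    (by linear_combination (1 / 16) * ((√a + √b) * (√(θ - a) + √(θ - b))
          + (√(lam + 1 - a) + √(lam + 1 - b)) * (√(a - ν) + √(b - ν))) * hf)
    (by rw [d1, d2, d3, d4]; linear_combination hm)
  obtain ⟨hA, hB⟩ := endA_endB_of (c := (b - a) / 4) hlam (by linarith) hmid hV
  rw [hA, hB]
  constructor <;> ring

/-- The quantities p + c²/p ± 2c are the squares of √p ± c/√p. The condition c < p selects the
branch on which √p - c/√p is the positive root. -/
lemma sqrt_joukowski {p c : ℝ} (hc : 0 < c) (hcp : c < p) :
    0 < p + c ^ 2 / p - 2 * c ∧ √(p + c ^ 2 / p + 2 * c) + √(p + c ^ 2 / p - 2 * c) = 2 * √p ∧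
      √(p + c ^ 2 / p + 2 * c) * √(p + c ^ 2 / p - 2 * c) = p - c ^ 2 / p := by
  have hp : 0 < p := hc.trans hcp
  have hs : 0 < √p := sqrt_pos.2 hp
  have hs2 : √p ^ 2 = p := sq_sqrt hp.le
  have e : c ^ 2 / p = (c / √p) ^ 2 := by rw [div_pow, hs2]
  have e1 : p + c ^ 2 / p + 2 * c = (√p + c / √p) ^ 2 := by
    have : √p * (c / √p) = c := by field_simp
    rw [e]
    linear_combination -hs2 - 2 * this
  have e2 : p + c ^ 2 / p - 2 * c = (√p - c / √p) ^ 2 := by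
    have : √p * (c / √p) = c := by field_simp
    rw [e]
    linear_combination -hs2 + 2 * this
  have hlt : 0 < √p - c / √p := by
    rw [sub_pos, div_lt_iff₀ hs]
    nlinarith
  rw [e1, e2, sqrt_sq (by positivity), sqrt_sq hlt.le]
  refine ⟨by positivity, by ring, ?_⟩
  rw [e]
  linear_combination hs2

lemma sq_lt_of_lt_sqrt {x y R : ℝ} (hx : x < √R) (hy : -x ≤ y) (hR : y ^ 2 < R) :
    x ^ 2 < R := by
  rcases le_or_gt 0 x with h | h
  · exact (lt_sqrt h).1 hx
  · nlinarith

/-- In the generic regime the endpoint equations are solvable in Joukowski coordinates. -/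
lemma exists_joukowski {lam ν θ : ℝ} (hlam : 0 < lam) (hD1 : 1 < θ - ν)
    (hD2 : θ - ν < 2 * lam + 1) (hN1 : 1 < θ + ν) (hN2 : θ + ν < 2 * lam + 1)
    (hθc : (3 * θ - (1 + lam + ν)) ^ 2 < 3 * (1 + 2 * lam) + (1 + lam - 2 * ν) ^ 2)
    (hνc : (1 + lam + θ - 3 * ν) ^ 2 < 3 * (1 + 2 * lam) + (1 + lam - 2 * θ) ^ 2) :
    ∃ m p q k c : ℝ, 0 < c ∧ c < p ∧ c < q ∧ 1 < k ∧ θ - m = p + c ^ 2 / p ∧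
      lam + 1 - m = k * p + c ^ 2 / (k * p) ∧ m - ν = q + c ^ 2 / q ∧
      m = k * q + c ^ 2 / (k * q) ∧
      (k * p - c ^ 2 / (k * p)) - (p - c ^ 2 / p) + (k * q - c ^ 2 / (k * q))
        - (q - c ^ 2 / q) = lam := by
  -- The witnesses are the values forced by `endpoint_algebra`: s = p+q, t = c²/p + c²/q, the ratio
  -- k, and x, y with p = sx/(2λ), q = sy/(2λ).
  obtain ⟨s, hs⟩ : ∃ s, s = (2 * lam + 1 - (θ - ν)) * (1 + (θ - ν)) / (4 * lam) := ⟨_, rfl⟩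
  obtain ⟨t, ht⟩ : ∃ t, t = (2 * lam + 1 + (θ - ν)) * (θ - ν - 1) / (4 * lam) := ⟨_, rfl⟩
  obtain ⟨k, hk⟩ : ∃ k, k = (2 * lam + 1 + (θ - ν)) / (1 + (θ - ν)) := ⟨_, rfl⟩
  obtain ⟨x, hx⟩ : ∃ x, x = 2 * lam + 1 - (θ + ν) := ⟨_, rfl⟩
  obtain ⟨y, hy⟩ : ∃ y, y = θ + ν - 1 := ⟨_, rfl⟩
  have hD0 : 0 < 1 + (θ - ν) := by linarith
  have hk1 : 1 < k := by rw [hk, lt_div_iff₀ hD0]; linarith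
  have hk0 : 0 < k := by linarith
  have hx0 : 0 < x := by linarith
  have hy0 : 0 < y := by linarith
  have hs0 : 0 < s := by
    rw [hs]; exact div_pos (mul_pos (by linarith) hD0) (by linarith)
  have ht0 : 0 < t := by
    rw [ht]; exact div_pos (mul_pos (by linarith) (by linarith)) (by linarith)
  -- Here the critical values enter: c < p amounts to ty < sx, the squared form of θ < θ_c, and c <
  -- q amounts to tx < sy, the squared form of ν > ν_c.
  have hlt1 : t * y < s * x := by
    have : s * x - t * y = 1 / 6 * ((3 * (1 + 2 * lam) + (1 + lam - 2 * ν) ^ 2)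
        - (3 * θ - (1 + lam + ν)) ^ 2) := by
      rw [hs, ht, hx, hy]; field_simp; ring
    linarith
  have hlt2 : t * x < s * y := by
    have : s * y - t * x = 1 / 6 * ((3 * (1 + 2 * lam) + (1 + lam - 2 * θ) ^ 2)
        - (1 + lam + θ - 3 * ν) ^ 2) := by
      rw [hs, ht, hx, hy]; field_simp; ring
    linarith
  obtain ⟨c, hc⟩ : ∃ c, c = √(s * t * x * y) / (2 * lam) := ⟨_, rfl⟩
  have hc0 : 0 < c := by
    rw [hc]; exact div_pos (sqrt_pos.2 (by positivity)) (by positivity)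
  have hc2 : c ^ 2 = s * t * x * y / (2 * lam) ^ 2 := by
    rw [hc, div_pow, sq_sqrt (by positivity)]
  have hp0 : 0 < s * x / (2 * lam) := by positivity
  have hq0 : 0 < s * y / (2 * lam) := by positivity
  have hcp : c ^ 2 / (s * x / (2 * lam)) = t * y / (2 * lam) := by rw [hc2]; field_simp
  have hcq : c ^ 2 / (s * y / (2 * lam)) = t * x / (2 * lam) := by rw [hc2]; field_simp
  have hkp : c ^ 2 / (k * (s * x / (2 * lam))) = t * y / (2 * lam) / k := by
    rw [← hcp]; field_simp
  have hkq : c ^ 2 / (k * (s * y / (2 * lam))) = t * x / (2 * lam) / k := by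
    rw [← hcq]; field_simp
  have lt_of_div : ∀ p, 0 < p → c ^ 2 / p < p → c < p := by
    intro p hp h
    rw [div_lt_iff₀ hp] at h
    exact lt_of_pow_lt_pow_left₀ 2 hp.le (by rwa [sq p])
  refine ⟨θ - s * x / (2 * lam) - t * y / (2 * lam), s * x / (2 * lam), s * y / (2 * lam), k, c,
    hc0, lt_of_div _ hp0 ?_, lt_of_div _ hq0 ?_, hk1, ?_, ?_, ?_, ?_, ?_⟩
  · rw [hcp]; exact div_lt_div_of_pos_right hlt1 (by positivity)
  · rw [hcq]; exact div_lt_div_of_pos_right hlt2 (by positivity)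
  · rw [hcp]; ring
  · have h2 : 2 * lam + 1 + (θ - ν) ≠ 0 := by linarith
    rw [hkp, hk, hs, ht, hx, hy]
    field_simp
    ring
  · rw [hcq, hs, ht, hx, hy]
    field_simp
    ring
  · have h2 : 2 * lam + 1 + (θ - ν) ≠ 0 := by linarith
    rw [hkq, hk, hs, ht, hx, hy]
    field_simp
    ring
  · have h2 : 2 * lam + 1 + (θ - ν) ≠ 0 := by linarith
    rw [hkp, hkq, hcp, hcq, hk, hs, ht, hx, hy]
    field_simp
    ring

/-- In the generic regime the endpoint equations are solvable. -/
lemma endpointEqs_of_generic {lam ν θ : ℝ} (hlam : 0 < lam) (hν : 0 ≤ ν) (hθ : θ ≤ lam + 1)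
    (hD : 1 < θ - ν) (hνc : nuCrit lam θ < ν) (hθc : θ < thetaCrit lam ν) :
    EndpointEqs lam ν θ (endA lam ν θ) (endB lam ν θ) := by
  have hθ2 : (3 * θ - (1 + lam + ν)) ^ 2 < 3 * (1 + 2 * lam) + (1 + lam - 2 * ν) ^ 2 := by
    unfold thetaCrit at hθc
    -- Squaring needs a lower bound on the left side as well. With this y, the condition -x ≤ y is ν
    -- ≤ θ, and y² is the square already under the root.
    exact sq_lt_of_lt_sqrt (y := 1 + lam - 2 * ν) (by linarith) (by linarith) (by linarith)
  have hν2 : (1 + lam + θ - 3 * ν) ^ 2 < 3 * (1 + 2 * lam) + (1 + lam - 2 * θ) ^ 2 := by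
    unfold nuCrit at hνc
    refine sq_lt_of_lt_sqrt (y := 2 * θ - 1 - lam) (by linarith) (by linarith) ?_
    have : (2 * θ - 1 - lam) ^ 2 = (1 + lam - 2 * θ) ^ 2 := by ring
    linarith
  obtain ⟨m, p, q, k, c, hc0, hltp, hltq, hk1, g1, g2, g3, g4, g6⟩ :=
    exists_joukowski hlam hD (by linarith) (by linarith) (by linarith) hθ2 hν2
  have hp0 : 0 < p := hc0.trans hltp
  have hq0 : 0 < q := hc0.trans hltq
  have hpk : p < k * p := lt_mul_of_one_lt_left hp0 hk1
  have hqk : q < k * q := lt_mul_of_one_lt_left hq0 hk1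
  obtain ⟨hmid, hV⟩ := endpoint_algebra hlam hp0 hq0 (hp0.trans hpk) hD g1 g2 g3 g4
    (by ring) g6
  obtain ⟨hA, hB⟩ := endA_endB_of hlam hc0.le hmid hV
  obtain ⟨i1, j1, l1⟩ := sqrt_joukowski hc0 hltp
  obtain ⟨i2, j2, l2⟩ := sqrt_joukowski hc0 hltq
  obtain ⟨i3, j3, l3⟩ := sqrt_joukowski hc0 (hltp.trans hpk)
  obtain ⟨i4, j4, l4⟩ := sqrt_joukowski hc0 (hltq.trans hqk)
  rw [← g1] at i1 j1 l1
  rw [← g3] at i2 j2 l2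
  rw [← g2] at i3 j3 l3
  rw [← g4] at i4 j4 l4
  have f1 : θ - (m - 2 * c) = θ - m + 2 * c := by ring
  have f2 : θ - (m + 2 * c) = θ - m - 2 * c := by ring
  have f3 : lam + 1 - (m - 2 * c) = lam + 1 - m + 2 * c := by ring
  have f4 : lam + 1 - (m + 2 * c) = lam + 1 - m - 2 * c := by ring
  have f5 : m - 2 * c - ν = m - ν - 2 * c := by ring
  have f6 : m + 2 * c - ν = m - ν + 2 * c := by ring
  rw [hA, hB]
  refine ⟨hlam, hν, by linarith, by linarith, by linarith, hθ, ?_, ?_⟩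
  · rw [f1, f2, f3, f4, f5, f6, j1, j3, add_comm (√(m - 2 * c)), j4,
      add_comm (√(m - ν - 2 * c)), j2, sqrt_mul (by linarith), sqrt_mul (by linarith)]
    ring
  · rw [f1, f2, f3, f4, f5, f6, l1, l3, mul_comm (√(m - 2 * c)), l4,
      mul_comm (√(m - ν - 2 * c)), l2]
    exact g6

lemma limitDensity_eq_profile (lam ν θ : ℝ) :
    limitDensity lam ν θ = profile lam ν θ (endA lam ν θ) (endB lam ν θ) := rfl

/-- The mass is 1 while ρ ≤ 1, strictly on a set of positive measure, so [ν,θ] must be longer than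
1. This supplies for part (ii) the inequality that part (i) assumes. -/
lemma one_lt_sub_of_genericShape {ν θ a b : ℝ} {ρ : ℝ → ℝ} (hρ : Admissible ν θ ρ)
    (hg : GenericShape ν θ a b ρ) : 1 < θ - ν := by
  have h1 := hg.lower
  have h2 := hg.middle
  have h3 := hg.upper
  have hνθ : ν ≤ θ := by linarith
  have hb : BddMeas (fun x => 1 - ρ x) := (BddMeas.const 1).sub hρ.bddMeas
  have hpos : 0 < ∫ x in Ioc ν θ, (1 - ρ x) := by
    rw [integral_pos_iff_support_of_nonneg (fun x => sub_nonneg.2 (hρ.le_one x)) (hb.integrable _)]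
    have h4 : Ioo a b ≤ᵐ[volume.restrict (Ioc ν θ)] Function.support (fun x => 1 - ρ x) := by
      filter_upwards [ae_restrict_of_ae hg.nonconst] with x hx hx2
      exact (sub_pos.2 (hx hx2).2).ne'
    refine lt_of_lt_of_le ?_ (measure_mono_ae h4)
    have hsub : Ioo a b ⊆ Ioc ν θ := fun x hx => ⟨by linarith [hx.1], by linarith [hx.2]⟩
    rw [Measure.restrict_apply measurableSet_Ioo, inter_eq_left.2 hsub, Real.volume_Ioo]
    simpa using h2
  have hm := hρ.mass
  rw [intervalIntegral.integral_of_le hνθ] at hm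
  rw [integral_sub (integrable_const _) (hρ.bddMeas.integrable _), hm] at hpos
  simp only [MeasureTheory.integral_const, measureReal_restrict_apply_univ, smul_eq_mul, mul_one,
    Real.volume_real_Ioc_of_le hνθ] at hpos
  linarith

end

end CutHexagon

theorem mainTheorem2 (lam ν θ : ℝ) (hlam : 0 < lam) (hν : 0 ≤ ν) (hθ : θ ≤ lam + 1) :
    (1 < θ - ν → CutHexagon.nuCrit lam θ < ν → θ < CutHexagon.thetaCrit lam ν →
      CutHexagon.GenericShape ν θ (CutHexagon.endA lam ν θ) (CutHexagon.endB lam ν θ)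
          (CutHexagon.limitDensity lam ν θ) ∧
        CutHexagon.IsMinimizer lam ν θ (CutHexagon.limitDensity lam ν θ) ∧
        ∀ ρ : ℝ → ℝ, CutHexagon.IsMinimizer lam ν θ ρ →
          ρ =ᵐ[volume] CutHexagon.limitDensity lam ν θ) ∧
    (∀ (ρ : ℝ → ℝ) (a b : ℝ), CutHexagon.IsMinimizer lam ν θ ρ →
      CutHexagon.GenericShape ν θ a b ρ →
        a = CutHexagon.endA lam ν θ ∧ b = CutHexagon.endB lam ν θ ∧
          ρ =ᵐ[volume] CutHexagon.limitDensity lam ν θ) := by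
  rw [CutHexagon.limitDensity_eq_profile]
  refine ⟨fun hD hνc hθc => ?_, fun ρ a b hρ hg => ?_⟩
  · have h := CutHexagon.endpointEqs_of_generic hlam hν hθ hD hνc hθc
    exact ⟨h.genericShape, h.isMinimizer, fun ρ hρ => h.ae_eq_of_isMinimizer hρ⟩
  -- The endpoint equations alone make the explicit profile with these endpoints the unique
  -- minimizer, so the generic conditions on ν and θ are not needed here.
  · have h := hρ.endpointEqs hlam hν hθ hg
    obtain ⟨ha, hb⟩ := h.eq_endA_endB (CutHexagon.one_lt_sub_of_genericShape hρ.1 hg)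
    refine ⟨ha, hb, ?_⟩
    rw [← ha, ← hb]
    exact h.ae_eq_of_isMinimizer hρ
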